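/- Let $N\ge 2$, let $F_N$ be the free group of rank $N$, and let $\varphi\in Out(F_N)$ be a hyperbolic iwip: no positive power of $\varphi$ fixes the conjugacy class of a proper nontrivial free factor of $F_N$, and no positive power of $\varphi$ fixes the conjugacy class of a nontrivial element. Let $\Gamma$ be a finite connected graph without valence-one vertices, with a marking $\alpha$ identifying $F_N$ with $\pi_1(\Gamma)$, and let $f:\Gamma\to\Gamma$ be an irreducible train-track representative of $\varphi$, i.e. $f$ maps vertices to vertices and edges to nontrivial edge-paths, $f$ induces $\varphi$ on $\pi_1(\Gamma)\cong F_N$, the path $f^k(e)$ is reduced for every edge $e$ and every $k\ge1$, and the transition matrix of $f$ is irreducible. Let $\partial^2F_N$ be the set of ordered pairs of distinct points of $\partial F_N$. Let $L_{BFH}(\varphi)\subset\partial^2F_N$ be the set of all $(X,Y)$ such that every finite subpath of the geodesic realization of $(X,Y)$ in $\Gamma$ is a subpath of $f^k(e)$ or of $f^k(e)^{-1}$ for some oriented edge $e$ and some $k\ge 0$. A geodesic current is a Radon measure on $\partial^2F_N$ invariant under $F_N$ and under the flip $(X,Y)\mapsto(Y,X)$; $[\mu]$ denotes the class of a nonzero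 current $\mu$ up to positive real factors. For a reduced edge-path $v$ in $\Gamma$ let $\langle v,\mu\rangle$ be the $\mu$-measure of the set of pairs $(X,Y)$ for which the geodesic from $X$ to $Y$ in the universal cover $\tilde\Gamma$ runs through a fixed lift of $v$. Then there is exactly one geodesic current $\mu_+$ (the stable current) such that, for every nontrivial reduced edge-path $v$ in $\Gamma$ and every oriented edge $e$ of $\Gamma$, $$\langle v,\mu_+\rangle=\lim_{n\to\infty}\frac{\langle v,f^n(e)\rangle}{\ell_\Gamma(f^n(e))},$$ where $\langle v,w\rangle$ is the number of occurrences of $v$ and of $v^{-1}$ in $w$, and $\ell_\Gamma$ is the number of edges of a path (the limit exists and does not depend on $e$). The current $\mu_+$ is nonzero, and the lamination $L_{BFH}(\varphi)$ is uniquely ergodic: there is exactly one class $[\mu]$ of nonzero geodesic currents with $supp(\mu)\subset L_{BFH}(\varphi)$, namely $[\mu]=[\mu_+]$. -/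

import Mathlib

open Filter Topology MeasureTheory
open scoped ENNReal NNReal

noncomputable section

/-! ## Letters, infinite reduced words and the boundary of a free group

A letter over `A` is a pair `(a, b)`: `(a, true)` is `a` and `(a, false)` is `a⁻¹`, as in Mathlib's
`FreeGroup`. -/

/-- The formal inverse of a letter (the same edge with the opposite orientation). -/
def flipLetter {A : Type*} (d : A × Bool) : A × Bool := (d.1, !d.2)

/-- The Gromov boundary of the free group on `A` (`A` finite), as the space of infinite reduced
words. -/
def FreeBoundary (A : Type*) : Type _ :=
  {x : ℕ → A × Bool // ∀ n, x (n + 1) ≠ flipLetter (x n)}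

/-- The topology of letterwise convergence: the product topology on infinite words, for the discrete
topology on letters. -/
instance FreeBoundary.instTopologicalSpace {A : Type*} : TopologicalSpace (FreeBoundary A) :=
  TopologicalSpace.induced (fun x => x.1)
    (@Pi.topologicalSpace ℕ (fun _ => A × Bool) (fun _ => ⊥))

namespace FreeBoundary

variable {A : Type*}

/-- The prefix of length `n` of an infinite word. -/
def initialWord (x : FreeBoundary A) (n : ℕ) : List (A × Bool) := List.ofFn fun i : Fin n => x.1 i

/-- The infinite word with its first letter erased. -/
def tail (x : FreeBoundary A) : FreeBoundary A := ⟨fun n => x.1 (n + 1), fun n => x.2 (n + 1)⟩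

/-- The infinite word with a letter `d` put in front, if no cancellation occurs. -/
def cons (d : A × Bool) (x : FreeBoundary A) (h : x.1 0 ≠ flipLetter d) : FreeBoundary A :=
  ⟨fun n => Nat.casesOn n d x.1, fun n => by cases n with
    | zero => exact h
    | succ k => exact x.2 k⟩

/-- Left multiplication of an infinite reduced word by a letter: put the letter in front, and cancel
if necessary. -/
def mulLetter [DecidableEq A] (d : A × Bool) (x : FreeBoundary A) : FreeBoundary A :=
  if h : x.1 0 = flipLetter d then x.tail else x.cons d h

theorem mulLetter_flip [DecidableEq A] (d : A × Bool) (x : FreeBoundary A) :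
    mulLetter (flipLetter d) (mulLetter d x) = x := by
  have hff : flipLetter (flipLetter d) = d := by simp [flipLetter]
  by_cases h : x.1 0 = flipLetter d
  · have h1 : mulLetter d x = x.tail := by simp [mulLetter, h]
    have h2 : ¬ (x.tail.1 0 = flipLetter (flipLetter d)) := by
      have := x.2 0
      rwa [h] at this
    rw [h1, mulLetter, dif_neg h2]
    apply Subtype.ext
    funext n
    cases n with
    | zero => exact h.symm
    | succ k => rfl
  · have h1 : mulLetter d x = x.cons d h := by simp [mulLetter, h]
    have h2 : (x.cons d h).1 0 = flipLetter (flipLetter d) := hff.symm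
    rw [h1, mulLetter, dif_pos h2]
    rfl

/-- Left multiplication by a generator as a permutation of the boundary. -/
def generatorPerm [DecidableEq A] (a : A) : Equiv.Perm (FreeBoundary A) where
  toFun := mulLetter (a, true)
  invFun := mulLetter (a, false)
  left_inv x := mulLetter_flip (a, true) x
  right_inv x := mulLetter_flip (a, false) x

/-- The action of the free group on its boundary by left multiplication. -/
instance instMulAction [DecidableEq A] : MulAction (FreeGroup A) (FreeBoundary A) :=
  MulAction.compHom (FreeBoundary A)
    (FreeGroup.lift generatorPerm : FreeGroup A →* Equiv.Perm (FreeBoundary A))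

end FreeBoundary

/-- The double boundary: ordered pairs of distinct boundary points. -/
def DoubleBoundary (A : Type*) : Type _ :=
  {q : FreeBoundary A × FreeBoundary A // q.1 ≠ q.2}

namespace DoubleBoundary

variable {A : Type*}

instance instTopologicalSpace : TopologicalSpace (DoubleBoundary A) :=
  inferInstanceAs (TopologicalSpace {q : FreeBoundary A × FreeBoundary A // q.1 ≠ q.2})

instance instMeasurableSpace : MeasurableSpace (DoubleBoundary A) := borel _

instance instBorelSpace : BorelSpace (DoubleBoundary A) := ⟨rfl⟩

/-- The flip map `(x, y) ↦ (y, x)`. -/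
def flip (q : DoubleBoundary A) : DoubleBoundary A := ⟨(q.1.2, q.1.1), q.2.symm⟩

/-- The diagonal action of the free group. -/
def translate [DecidableEq A] (g : FreeGroup A) (q : DoubleBoundary A) : DoubleBoundary A :=
  ⟨(g • q.1.1, g • q.1.2), fun h => q.2 (MulAction.injective g h)⟩

end DoubleBoundary

/-! ## Geodesic currents -/

/-- A geodesic current on the free group of rank `N`: a Radon measure on the double boundary which
is invariant under the free group and under the flip. -/
@[ext]
structure GeodesicCurrent (N : ℕ) where
  toMeasure : Measure (DoubleBoundary (Fin N))
  regular : toMeasure.Regular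
  translate_invariant : ∀ (g : FreeGroup (Fin N)) (S : Set (DoubleBoundary (Fin N))),
    MeasurableSet S → toMeasure (DoubleBoundary.translate g ⁻¹' S) = toMeasure S
  flip_invariant : ∀ S : Set (DoubleBoundary (Fin N)),
    MeasurableSet S → toMeasure (DoubleBoundary.flip ⁻¹' S) = toMeasure S

/-- Two nonzero currents are projectively equivalent if they differ by a positive real factor. -/
def GeodesicCurrent.projSetoid (N : ℕ) : Setoid {μ : GeodesicCurrent N // μ.toMeasure ≠ 0} where
  r μ ν := ∃ r : ℝ≥0, 0 < r ∧ μ.1.toMeasure = r • ν.1.toMeasure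
  iseqv :=
    { refl := fun μ => ⟨1, one_pos, by simp⟩
      symm := by
        rintro μ ν ⟨r, hr, h⟩
        exact ⟨r⁻¹, inv_pos.2 hr, by rw [h, smul_smul, inv_mul_cancel₀ hr.ne', one_smul]⟩
      trans := by
        rintro μ ν κ ⟨r, hr, h⟩ ⟨s, hs, h'⟩
        exact ⟨r * s, mul_pos hr hs, by rw [h, h', smul_smul]⟩ }

/-- The space of projectivized geodesic currents. -/
def ProjCurrent (N : ℕ) : Type := Quotient (GeodesicCurrent.projSetoid N)

/-- The class of a nonzero current. -/
def ProjCurrent.mk {N : ℕ} (μ : GeodesicCurrent N) (h : μ.toMeasure ≠ 0) : ProjCurrent N :=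
  Quotient.mk (GeodesicCurrent.projSetoid N) ⟨μ, h⟩

/-- `p.SupportedIn L` says that the support of the current `μ` is contained in `L`,
where `p = [μ]` (for one representative or, equivalently, for all of them). -/
def ProjCurrent.SupportedIn {N : ℕ} (p : ProjCurrent N) (L : Set (DoubleBoundary (Fin N))) : Prop :=
  ∃ (μ : GeodesicCurrent N) (h : μ.toMeasure ≠ 0),
    ProjCurrent.mk μ h = p ∧ μ.toMeasure.support ⊆ L

/-- A lamination `L` is uniquely ergodic if there is exactly one projective class of nonzero
geodesic currents with support in `L`. -/
def IsUniquelyErgodic {N : ℕ} (L : Set (DoubleBoundary (Fin N))) : Prop :=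
  ∃! p : ProjCurrent N, p.SupportedIn L

/-! ## Outer automorphisms -/

instance innNormal (G : Type*) [Group G] : (MulAut.conj : G →* MulAut G).range.Normal where
  conj_mem := by
    rintro _ ⟨g, rfl⟩ Φ
    exact ⟨Φ g, by ext x; simp [MulAut.mul_apply]⟩

/-- The outer automorphism group: automorphisms modulo inner automorphisms. -/
abbrev OutAut (G : Type*) [Group G] : Type _ := MulAut G ⧸ (MulAut.conj : G →* MulAut G).range

namespace OutAut

variable {G : Type*} [Group G]

/-- The outer automorphism `φ` fixes the conjugacy class of the element `g`. -/
def FixesElementClass (φ : OutAut G) (g : G) : Prop :=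
  ∃ Φ : MulAut G, (QuotientGroup.mk Φ : OutAut G) = φ ∧ IsConj (Φ g) g

/-- The outer automorphism `φ` fixes the conjugacy class of the subgroup `H`. -/
def FixesSubgroupClass (φ : OutAut G) (H : Subgroup G) : Prop :=
  ∃ Φ : MulAut G, (QuotientGroup.mk Φ : OutAut G) = φ ∧
    ∃ g : G, H.map Φ.toMonoidHom = H.map (MulAut.conj g).toMonoidHom

/-- `H` is a free factor: `G` is the (internal) free product of `H` and some subgroup `K`. -/
def _root_.IsFreeFactor (H : Subgroup G) : Prop :=
  ∃ K : Subgroup G, Function.Bijective (Monoid.Coprod.lift H.subtype K.subtype)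

/-- Fully irreducible (iwip): no positive power fixes the conjugacy class of a proper
(nontrivial, and not the whole group) free factor. -/
def IsIwip (φ : OutAut G) : Prop :=
  ∀ k : ℕ, 1 ≤ k → ∀ H : Subgroup G, IsFreeFactor H → H ≠ ⊥ → H ≠ ⊤ →
    ¬ FixesSubgroupClass (φ ^ k) H

/-- Atoroidal: there are no periodic conjugacy classes of nontrivial elements. -/
def IsAtoroidal (φ : OutAut G) : Prop :=
  ∀ k : ℕ, 1 ≤ k → ∀ g : G, g ≠ 1 → ¬ FixesElementClass (φ ^ k) g

/-- A hyperbolic iwip. -/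
def IsHyperbolicIwip (φ : OutAut G) : Prop := φ.IsIwip ∧ φ.IsAtoroidal

end OutAut

/-! ## Graphs, edge-paths and markings -/

/-- A graph with vertices `V` and positively oriented edges `E`; loops and multiple edges are
allowed. The oriented edges are the letters `E × Bool`, where `(e, true)` is `e` and `(e, false)` is
`e⁻¹`. Edge-paths are words in these letters. -/
structure EdgeGraph (V E : Type*) where
  src : E → V
  tgt : E → V

namespace EdgeGraph

variable {V E : Type*} (Γ : EdgeGraph V E)

/-- Initial vertex of an oriented edge. -/
def init (d : E × Bool) : V := if d.2 then Γ.src d.1 else Γ.tgt d.1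

/-- Terminal vertex of an oriented edge. -/
def term (d : E × Bool) : V := if d.2 then Γ.tgt d.1 else Γ.src d.1

/-- `Γ.IsPath u w v`: the word `w` is an edge-path from `u` to `v`. -/
def IsPath : V → List (E × Bool) → V → Prop
  | u, [], v => u = v
  | u, d :: w, v => Γ.init d = u ∧ IsPath (Γ.term d) w v

/-- Any two vertices are joined by an edge-path. -/
def IsConnected : Prop := ∀ u v, ∃ w, Γ.IsPath u w v

/-- No vertex has valence one. -/
def NoValenceOne : Prop := ∀ v, Nat.card {d : E × Bool // Γ.init d = v} ≠ 1

/-- `c` is the homotopy class relative to endpoints of an edge-path from `u` to `v`.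
Two edge-paths with the same endpoints are homotopic relative to endpoints iff they differ by
insertions and deletions of backtracks `d d⁻¹`, i.e. iff they define the same element of
`FreeGroup E`; so homotopy classes of edge-paths are treated as elements of `FreeGroup E`. -/
def IsPathClass (u : V) (c : FreeGroup E) (v : V) : Prop :=
  ∃ w, Γ.IsPath u w v ∧ FreeGroup.mk w = c

theorem isPath_append {u v x : V} {w w' : List (E × Bool)} (h : Γ.IsPath u w v)
    (h' : Γ.IsPath v w' x) : Γ.IsPath u (w ++ w') x := by
  induction w generalizing u with
  | nil => cases h; exact h'
  | cons d w ih => exact ⟨h.1, ih h.2⟩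

theorem isPath_invRev {u v : V} {w : List (E × Bool)} (h : Γ.IsPath u w v) :
    Γ.IsPath v (FreeGroup.invRev w) u := by
  induction w generalizing u with
  | nil => exact Eq.symm h
  | cons d w ih =>
    have hd : FreeGroup.invRev (d :: w) = FreeGroup.invRev w ++ [flipLetter d] := by
      simp [FreeGroup.invRev, flipLetter]
    rw [hd]
    refine Γ.isPath_append (ih h.2) ⟨?_, ?_⟩
    · rcases d with ⟨e, b⟩
      cases b <;> rfl
    · rw [← h.1]
      rcases d with ⟨e, b⟩
      cases b <;> rfl

/-- The fundamental group of `Γ` at `p`: homotopy classes of closed edge-paths at `p`. -/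
def fundGroup (p : V) : Subgroup (FreeGroup E) where
  carrier := {c | Γ.IsPathClass p c p}
  mul_mem' := by
    rintro _ _ ⟨w, hw, rfl⟩ ⟨w', hw', rfl⟩
    exact ⟨w ++ w', Γ.isPath_append hw hw', rfl⟩
  one_mem' := ⟨[], rfl, rfl⟩
  inv_mem' := by
    rintro _ ⟨w, hw, rfl⟩
    exact ⟨FreeGroup.invRev w, Γ.isPath_invRev hw, by rw [FreeGroup.inv_mk]⟩

end EdgeGraph

/-- A marking of `Γ` by the rose with `N` petals: a base vertex `base` (the image of the vertex of
the rose) and the isomorphism `hom` from the free group of rank `N` (the fundamental group of the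
rose) onto the fundamental group of `Γ` at `base`. -/
structure Marking (N : ℕ) {V E : Type*} (Γ : EdgeGraph V E) where
  base : V
  hom : FreeGroup (Fin N) →* FreeGroup E
  injective : Function.Injective hom
  range_eq : hom.range = Γ.fundGroup base

/-! ## Geodesics in the universal cover

The vertices of the universal cover are the classes of edge-paths starting at the base vertex; the
boundary of the universal cover consists of the infinite reduced edge-paths starting there. -/

/-- A family of elements of a free group converges to the boundary point `ξ`: the reduced words
eventually start with any given prefix of `ξ`. -/
def ConvergesTo {ι A : Type*} [DecidableEq A] (g : ι → FreeGroup A) (l : Filter ι)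
    (ξ : FreeBoundary A) : Prop :=
  ∀ k, ∀ᶠ i in l, ξ.initialWord k <+: (g i).toWord

namespace Marking

variable {N : ℕ} {V E : Type*} [DecidableEq E] {Γ : EdgeGraph V E} (α : Marking N Γ)

/-- `ξ` is the image of `X` under the map of boundaries induced by the marking. -/
def MapsBoundary (X : FreeBoundary (Fin N)) (ξ : FreeBoundary E) : Prop :=
  ConvergesTo (fun n => α.hom (FreeGroup.mk (X.initialWord n))) atTop ξ

/-- `γ̃` is a bi-infinite geodesic in the universal cover, running through the vertices
`vert n`, which projects to the bi-infinite reduced edge-path `γ` in `Γ`. -/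
structure IsGeodesicLine (vert : ℤ → FreeGroup E) (γ : ℤ → E × Bool) : Prop where
  is_vertex : ∀ n, Γ.IsPathClass α.base (vert n) (Γ.init (γ n))
  path : ∀ n, Γ.term (γ n) = Γ.init (γ (n + 1))
  step : ∀ n, vert (n + 1) = vert n * FreeGroup.mk [γ n]
  reduced : ∀ n, γ (n + 1) ≠ flipLetter (γ n)

/-- The geodesic in the universal cover of `Γ` from the image of `X` to the image of `Y`,
where `q = (X, Y)`; then `γ` is the geodesic realization of `q` in `Γ`. -/
structure IsGeodesicFor (q : DoubleBoundary (Fin N)) (vert : ℤ → FreeGroup E)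
    (γ : ℤ → E × Bool) : Prop where
  line : α.IsGeodesicLine vert γ
  left : ∃ ξ, α.MapsBoundary q.1.1 ξ ∧ ConvergesTo vert atBot ξ
  right : ∃ η, α.MapsBoundary q.1.2 η ∧ ConvergesTo vert atTop η

/-- The subpath of length `k` of a bi-infinite path that starts at position `n`. -/
def _root_.segment_of_line {B : Type*} (γ : ℤ → B) (n : ℤ) (k : ℕ) : List B :=
  List.ofFn fun i : Fin k => γ (n + (i : ℕ))

/-- The cylinder of the lift of the edge-path `v` that starts at the vertex `c` of the universal
cover: all pairs `(X, Y)` such that the geodesic from `X` to `Y` runs through this lift. -/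
def cylinder (c : FreeGroup E) (v : List (E × Bool)) : Set (DoubleBoundary (Fin N)) :=
  {q | ∃ vert γ, α.IsGeodesicFor q vert γ ∧
    ∃ n, vert n = c ∧ segment_of_line γ n v.length = v}

/-- The lamination generated by a family `P` of finite paths: all `(X, Y)` such that every finite
subpath of the geodesic realization is a subpath of some `v' ∈ P` or of its inverse. -/
def laminationGeneratedBy (P : Set (List (E × Bool))) : Set (DoubleBoundary (Fin N)) :=
  {q | ∃ vert γ, α.IsGeodesicFor q vert γ ∧
    ∀ n k, ∃ v' ∈ P, segment_of_line γ n k <:+: v' ∨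
      segment_of_line γ n k <:+: FreeGroup.invRev v'}

end Marking

/-! ## Graph maps and train tracks -/

/-- A graph map `Γ → Γ`: vertices go to vertices, edges go to edge-paths. -/
structure GraphMap {V E : Type*} (Γ : EdgeGraph V E) where
  onV : V → V
  onE : E → List (E × Bool)
  isPath : ∀ e, Γ.IsPath (onV (Γ.src e)) (onE e) (onV (Γ.tgt e))

namespace GraphMap

variable {V E : Type*} {Γ : EdgeGraph V E} (f : GraphMap Γ)

/-- The image of an oriented edge. -/
def onOriented (d : E × Bool) : List (E × Bool) :=
  if d.2 then f.onE d.1 else FreeGroup.invRev (f.onE d.1)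

/-- The image of an edge-path, without any reduction. -/
def onPath (w : List (E × Bool)) : List (E × Bool) := w.flatMap f.onOriented

/-- The path `fⁿ(d)`, without any reduction. -/
def iter (n : ℕ) (d : E × Bool) : List (E × Bool) := f.onPath^[n] [d]

/-- The map induced on homotopy classes of edge-paths. -/
def onClass : FreeGroup E →* FreeGroup E := FreeGroup.lift fun e => FreeGroup.mk (f.onE e)

/-- The transition matrix: the entry `(i, j)` counts the occurrences of `i` and `i⁻¹` in `f(j)`. -/
def transitionMatrix [DecidableEq E] : Matrix E E ℝ :=
  Matrix.of fun i j => (((f.onE j).map Prod.fst).count i : ℝ)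

/-- `f` determines the outer automorphism `φ` with respect to the marking `α`: some automorphism
`Φ` in the class `φ` is the map induced by `f` on fundamental groups, where the base vertex `p` and
its image `f(p)` are joined by a path `u`. -/
def Determines {N : ℕ} (α : Marking N Γ) (φ : OutAut (FreeGroup (Fin N))) : Prop :=
  ∃ Φ : MulAut (FreeGroup (Fin N)), (QuotientGroup.mk Φ : OutAut (FreeGroup (Fin N))) = φ ∧
    ∃ u, Γ.IsPathClass α.base u (f.onV α.base) ∧
      ∀ g, α.hom (Φ g) = u * f.onClass (α.hom g) * u⁻¹

/-- An irreducible train-track representative of `φ`, on a connected graph without valence-one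
vertices. -/
structure IsTrainTrackFor {N : ℕ} [DecidableEq E] (α : Marking N Γ)
    (φ : OutAut (FreeGroup (Fin N))) : Prop where
  connected : Γ.IsConnected
  noValenceOne : Γ.NoValenceOne
  determines : f.Determines α φ
  nondegenerate : ∀ e, f.onE e ≠ []
  tight : ∀ e, FreeGroup.IsReduced (f.onE e)
  noBacktracking : ∀ k, 1 ≤ k → ∀ e, FreeGroup.IsReduced (f.iter k (e, true))
  irreducible : f.transitionMatrix.IsIrreducible

/-- The Bestvina–Feighn–Handel lamination: the lamination generated by the paths `fᵏ(e)` with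
`k ≥ 0` and `e` an (oriented) edge. -/
def bfhLamination {N : ℕ} [DecidableEq E] (α : Marking N Γ) : Set (DoubleBoundary (Fin N)) :=
  α.laminationGeneratedBy {w | ∃ (k : ℕ) (d : E × Bool), w = f.iter k d}

/-- The number of positions of `w` from which `v` can be read off in forward direction
(for nonempty `v`). -/
def _root_.occForward {B : Type*} [DecidableEq B] (v w : List B) : ℕ :=
  w.tails.countP fun s => v.isPrefixOf s

/-- The number of occurrences `⟨v, w⟩` of `v` or `v⁻¹` in `w`. -/
def _root_.occ [DecidableEq E] (v w : List (E × Bool)) : ℕ :=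
  occForward v w + occForward (FreeGroup.invRev v) w

/-- `μ` is the stable current of `f`: for every nontrivial reduced edge-path `v` in `Γ` the limits
`a_v = lim ⟨v, fⁿ(e)⟩ / length (fⁿ(e))` exist for all (oriented) edges `e` and do not depend on `e`,
and the number of occurrences `⟨v, μ⟩ = μ(Cyl(lift of v))` is `a_v`, for every lift of `v`. -/
def IsStableCurrent {N : ℕ} [DecidableEq E] (α : Marking N Γ) (μ : GeodesicCurrent N) : Prop :=
  ∀ (x y : V) (v : List (E × Bool)), Γ.IsPath x v y → FreeGroup.IsReduced v → v ≠ [] →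
    ∃ a : ℝ,
      (∀ d : E × Bool, Tendsto (fun n : ℕ => (occ v (f.iter n d) : ℝ) / (f.iter n d).length)
        atTop (𝓝 a)) ∧
      ∀ c, Γ.IsPathClass α.base c x → μ.toMeasure (α.cylinder c v) = ENNReal.ofReal a

end GraphMap

end

/-! ## Counting occurrences of words -/

/-! Everything rests on one fact: a nonempty word `v` has the same asymptotic frequency in the
iterates fⁿ(e) of all edges, and this frequency is approached uniformly on all long words of the
language of the lamination.

The hypothesis on the outer automorphism serves to prove two properties of `f`. Expansion
(`IsExpanding`): if all edges were mapped to single edges, `f` would permute the oriented edges, a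
power of `f` would be the identity, and conjugacy classes would be periodic, against atoroidality.
Mixing (`IsMixing`): otherwise some proper edge set, invariant under a power of `f`, connected and
disjoint from its image, carries a proper nontrivial free factor (`isFreeFactor_subgraphGroup`). A
power of the automorphism maps this factor into a conjugate of itself, hence onto it by the Hopf
property (`IsFreeFactor.map_eq_of_map_le`), against full irreducibility.

Frequencies: a high iterate is a concatenation of blocks fⁿ(d), and counts of `v` are additive up to
a bounded error for each junction. By mixing every type of block occurs in every image, which
contracts the gap between the largest and the smallest frequency (`exists_common_limit`). Words of
the language are concatenations of blocks up to two bounded end pieces, whence the uniform estimate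
`abs_occ_sub_frequency_le`.

Existence: the frequencies satisfy the Kirchhoff rules and are invariant under inversion, and every
such weight comes from a current (`exists_current`). Pairs of incomparable cones form a basis of the
double boundary; the weight of a pair is that of the segment between the cones, and the measure is
obtained as a limit of sums of point masses.

Uniqueness: the cylinder masses `m` of a current supported in the lamination are shift-invariant and
live on the language. The number of occurrences of `v` or its inverse, averaged against `m` over
words of length `l`, grows like `2 * m v * l` by invariance (`wordSum_mul_occForward`), and like the
frequency of `v` times `l` times the total mass of the letters by the uniform estimate. So `m` is
proportional to the frequency (`weight_eq_frequency`), and cylinder masses determine a measure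
(`ext_of_cylinder`). -/

theorem flipLetter_flipLetter {A : Type*} (d : A × Bool) : flipLetter (flipLetter d) = d := by
  simp [flipLetter]

theorem invRev_cons {A : Type*} (d : A × Bool) (w : List (A × Bool)) :
    FreeGroup.invRev (d :: w) = FreeGroup.invRev w ++ [flipLetter d] := by
  simp [FreeGroup.invRev, flipLetter]

theorem invRev_ne_nil {A : Type*} {v : List (A × Bool)} (h : v ≠ []) :
    FreeGroup.invRev v ≠ [] := by
  simpa [FreeGroup.invRev] using h

theorem invRev_isSuffix_iff {A : Type*} {v w : List (A × Bool)} :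
    FreeGroup.invRev v <:+ FreeGroup.invRev w ↔ v <+: w := by
  constructor
  · rintro ⟨t, ht⟩
    refine ⟨FreeGroup.invRev t, ?_⟩
    have := congrArg FreeGroup.invRev ht
    rwa [FreeGroup.invRev_append, FreeGroup.invRev_invRev, FreeGroup.invRev_invRev] at this
  · rintro ⟨t, rfl⟩
    exact ⟨FreeGroup.invRev t, FreeGroup.invRev_append.symm⟩

theorem invRev_isInfix_iff {A : Type*} {v w : List (A × Bool)} :
    FreeGroup.invRev v <:+: FreeGroup.invRev w ↔ v <:+: w := by
  have key : ∀ v w : List (A × Bool), v <:+: w → FreeGroup.invRev v <:+: FreeGroup.invRev w := by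
    rintro v w ⟨s, t, rfl⟩
    exact ⟨FreeGroup.invRev t, FreeGroup.invRev s, by simp⟩
  refine ⟨fun h => ?_, key v w⟩
  simpa using key _ _ h

section Occurrences

variable {B : Type*} [DecidableEq B]

theorem occForward_nil {v : List B} (hv : v ≠ []) : occForward v [] = 0 := by
  cases v with
  | nil => exact absurd rfl hv
  | cons a v => simp [occForward]

theorem occForward_cons (v : List B) (x : B) (w : List B) :
    occForward v (x :: w) = occForward v w + if v <+: x :: w then 1 else 0 := by
  simp only [occForward, List.tails_cons, List.countP_cons, List.isPrefixOf_iff_prefix]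

theorem occForward_append_ge {v : List B} (hv : v ≠ []) (a b : List B) :
    occForward v a + occForward v b ≤ occForward v (a ++ b) := by
  induction a with
  | nil => simp [occForward_nil hv]
  | cons x a ih =>
    rw [List.cons_append, occForward_cons, occForward_cons]
    have : v <+: x :: a → v <+: x :: (a ++ b) := fun h => h.trans ⟨b, by simp⟩
    split_ifs <;> first | omega | (exfalso; tauto)

/-- An occurrence that is in neither piece starts in `a` at distance less than the length of `v`
from the junction. The minimum, rather than the length of `v` alone, is the bound that survives
induction on `a`. -/
theorem occForward_append_le_min {v : List B} (hv : v ≠ []) (a b : List B) :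
    occForward v (a ++ b) ≤ occForward v a + occForward v b + min a.length v.length := by
  induction a with
  | nil => simp [occForward_nil hv]
  | cons x a ih =>
    rw [List.cons_append, occForward_cons, occForward_cons]
    by_cases hl : v.length ≤ (x :: a).length
    · have : v <+: x :: (a ++ b) → v <+: x :: a := fun h =>
        List.prefix_of_prefix_length_le h (⟨b, by simp⟩ : x :: a <+: x :: (a ++ b)) hl
      have hm : min a.length v.length ≤ min (x :: a).length v.length := by
        simp only [List.length_cons]; omega
      split_ifs <;> first | omega | (exfalso; tauto)
    · simp only [List.length_cons] at hl ⊢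
      have hm : min a.length v.length + 1 = min (a.length + 1) v.length := by omega
      split_ifs <;> omega

theorem occForward_append_le {v : List B} (hv : v ≠ []) (a b : List B) :
    occForward v (a ++ b) ≤ occForward v a + occForward v b + v.length :=
  (occForward_append_le_min hv a b).trans (by omega)

theorem occForward_le_length {v : List B} (hv : v ≠ []) (w : List B) :
    occForward v w ≤ w.length := by
  induction w with
  | nil => simp [occForward_nil hv]
  | cons x w ih =>
    rw [occForward_cons, List.length_cons]
    split_ifs <;> omega

theorem isInfix_of_occForward_pos {v w : List B} (hv : v ≠ []) (h : 0 < occForward v w) :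
    v <:+: w := by
  induction w with
  | nil => simp [occForward_nil hv] at h
  | cons x w ih =>
    rw [occForward_cons] at h
    split_ifs at h with hp
    · exact hp.isInfix
    · exact (ih (by simpa using h)).trans (List.suffix_cons x w).isInfix

/-- The count is defined by starting positions; this is the mirror image by ending positions, needed
because inversion turns prefixes into suffixes. -/
theorem occForward_concat {v : List B} (hv : v ≠ []) (w : List B) (x : B) :
    occForward v (w ++ [x]) = occForward v w + if v <:+ w ++ [x] then 1 else 0 := by
  induction w with
  | nil =>
    have : v <+: [x] ↔ v <:+ [x] := by
      rw [List.prefix_cons_iff, List.suffix_cons_iff]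
      simp [hv]
    simp [occForward_cons, occForward_nil hv, this]
  | cons y w ih =>
    rw [List.cons_append, occForward_cons, ih, occForward_cons]
    by_cases hvw : v = y :: (w ++ [x])
    · have h1 : ¬ v <:+ w ++ [x] := fun h => by
        have := h.length_le; rw [hvw] at this; simp at this
      have h2 : ¬ v <+: y :: w := fun h => by
        have := h.length_le; rw [hvw] at this; simp at this
      simp [hvw ▸ h1, hvw ▸ h2, hvw]
    · have h1 : v <:+ y :: (w ++ [x]) ↔ v <:+ w ++ [x] := by
        rw [List.suffix_cons_iff]; simp [hvw]
      have h2 : v <+: y :: (w ++ [x]) ↔ v <+: y :: w := by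
        have := List.prefix_concat_iff (l₁ := v) (l₂ := y :: w) (a := x)
        simp only [List.cons_append] at this
        rw [this]; simp [hvw]
      simp only [h1, h2]
      omega

/-- An occurrence of `v` is followed by exactly one letter unless it ends the word. This is the
source of the Kirchhoff rule for frequencies. -/
theorem sum_occForward_concat [Fintype B] {v : List B} (hv : v ≠ []) (w : List B) :
    occForward v w = ∑ d, occForward (v ++ [d]) w + if v <:+ w then 1 else 0 := by
  induction w with
  | nil => simp [occForward_nil hv, occForward_nil, hv]
  | cons x w ih =>
    simp only [occForward_cons, Finset.sum_add_distrib]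
    rw [ih]
    by_cases hvw : v = x :: w
    · subst hvw
      have h1 : ¬ (x :: w <:+ w) := fun h => by simpa using h.length_le
      have h2 : ∀ d, ¬ (x :: w ++ [d] <+: x :: w) := fun d h => by simpa using h.length_le
      simpa [h1] using h2
    · have h1 : v <:+ x :: w ↔ v <:+ w := by rw [List.suffix_cons_iff]; simp [hvw]
      have h3 : (if v <+: x :: w then 1 else 0) =
          ∑ d, if v ++ [d] <+: x :: w then 1 else 0 := by
        split_ifs with hp
        · obtain ⟨t, ht⟩ := hp
          cases t with
          | nil => simp [← ht] at *
          | cons e t =>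
            have : ∀ d, v ++ [d] <+: x :: w ↔ d = e := by
              intro d
              rw [← ht, List.prefix_append_right_inj]
              simp
            simp [this]
        · symm
          apply Finset.sum_eq_zero
          intro d _
          rw [if_neg]
          exact fun h => hp ((List.prefix_append v [d]).trans h)
      simp only [h1, h3]
      omega

end Occurrences

section SignedOccurrences

variable {E : Type*} [DecidableEq E]

theorem occForward_invRev {v : List (E × Bool)} (hv : v ≠ []) (w : List (E × Bool)) :
    occForward (FreeGroup.invRev v) (FreeGroup.invRev w) = occForward v w := by
  induction w with
  | nil => simp [occForward_nil hv, occForward_nil (invRev_ne_nil hv)]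
  | cons x w ih =>
    rw [invRev_cons, occForward_concat (invRev_ne_nil hv), ih, occForward_cons, ← invRev_cons]
    simp only [invRev_isSuffix_iff]

theorem occ_invRev_right {v : List (E × Bool)} (hv : v ≠ []) (w : List (E × Bool)) :
    occ v (FreeGroup.invRev w) = occ v w := by
  have h1 := occForward_invRev hv w
  have h2 := occForward_invRev (invRev_ne_nil hv) w
  rw [FreeGroup.invRev_invRev] at h2
  rw [occ, occ, h1, h2, add_comm]

theorem occ_invRev_left (v w : List (E × Bool)) :
    occ (FreeGroup.invRev v) w = occ v w := by
  rw [occ, occ, FreeGroup.invRev_invRev, add_comm]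

theorem occ_append_ge {v : List (E × Bool)} (hv : v ≠ []) (a b : List (E × Bool)) :
    occ v a + occ v b ≤ occ v (a ++ b) := by
  have h1 := occForward_append_ge hv a b
  have h2 := occForward_append_ge (invRev_ne_nil hv) a b
  simp only [occ]
  omega

theorem occ_append_le {v : List (E × Bool)} (hv : v ≠ []) (a b : List (E × Bool)) :
    occ v (a ++ b) ≤ occ v a + occ v b + 2 * v.length := by
  have h1 := occForward_append_le hv a b
  have h2 := occForward_append_le (invRev_ne_nil hv) a b
  rw [FreeGroup.invRev_length] at h2
  simp only [occ]
  omega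

theorem occ_le {v : List (E × Bool)} (hv : v ≠ []) (w : List (E × Bool)) :
    occ v w ≤ 2 * w.length := by
  have h1 := occForward_le_length hv w
  have h2 := occForward_le_length (invRev_ne_nil hv) w
  simp only [occ]
  omega

theorem isInfix_of_occ_pos {v w : List (E × Bool)} (hv : v ≠ []) (h : 0 < occ v w) :
    v <:+: w ∨ v <:+: FreeGroup.invRev w := by
  rw [occ] at h
  rcases Nat.eq_zero_or_pos (occForward v w) with h0 | h0
  · right
    rw [h0, zero_add] at h
    have := isInfix_of_occForward_pos (invRev_ne_nil hv) h
    rw [← invRev_isInfix_iff, FreeGroup.invRev_invRev] at this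
    exact this
  · exact Or.inl (isInfix_of_occForward_pos hv h0)

theorem sum_occ_singleton [Fintype E] (w : List (E × Bool)) :
    ∑ d : E × Bool, occ [d] w = 2 * w.length := by
  have key : ∀ w : List (E × Bool), ∑ d : E × Bool, occForward [d] w = w.length := by
    intro w
    induction w with
    | nil => simp [occForward_nil]
    | cons x w ih =>
      simp only [occForward_cons, Finset.sum_add_distrib, ih]
      simp [List.prefix_cons_iff]
  have h2 : ∑ d : E × Bool, occForward (FreeGroup.invRev [d]) w = w.length := by
    rw [← FreeGroup.invRev_length (L₁ := w), ← key (FreeGroup.invRev w)]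
    refine Finset.sum_congr rfl fun d _ => ?_
    have := occForward_invRev (v := FreeGroup.invRev [d]) (invRev_ne_nil (by simp)) w
    rw [← this, FreeGroup.invRev_invRev]
  simp only [occ, Finset.sum_add_distrib, key, h2]
  omega

/-- The loss 2 has two sources: `v` may end `w`, and it may end the inverse of `w`. -/
theorem occ_concat_le [Fintype E] {v : List (E × Bool)} (hv : v ≠ []) (w : List (E × Bool)) :
    ∑ d, occ (v ++ [d]) w ≤ occ v w ∧ occ v w ≤ ∑ d, occ (v ++ [d]) w + 2 := by
  have h1 := sum_occForward_concat hv w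
  have h2 := sum_occForward_concat hv (FreeGroup.invRev w)
  have e : ∀ v : List (E × Bool), v ≠ [] →
      occForward (FreeGroup.invRev v) w = occForward v (FreeGroup.invRev w) := by
    intro v hv
    have := occForward_invRev (invRev_ne_nil hv) w
    rw [FreeGroup.invRev_invRev] at this
    exact this.symm
  have h3 : ∑ d, occForward (FreeGroup.invRev (v ++ [d])) w =
      ∑ d, occForward (v ++ [d]) (FreeGroup.invRev w) :=
    Finset.sum_congr rfl fun d _ => e _ (by simp)
  simp only [occ, Finset.sum_add_distrib, h3, e v hv]
  split_ifs at h1 h2 <;> omega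

end SignedOccurrences

/-! ## Convergence of frequencies -/

/-- Each `s n + ε n` bounds all later terms, hence also the upper limit. As `ε` tends to zero, the
terms cannot stay a fixed amount below the upper limit. -/
theorem exists_tendsto_of_almost_antitone {s ε : ℕ → ℝ} (hb : BddAbove (Set.range s))
    (hb' : BddBelow (Set.range s)) (hε : Tendsto ε atTop (𝓝 0))
    (h : ∀ n m, s (n + m) ≤ s n + ε n) : ∃ S, Tendsto s atTop (𝓝 S) := by
  obtain ⟨A, hA⟩ := hb
  obtain ⟨A', hA'⟩ := hb'
  have hA : ∀ n, s n ≤ A := fun n => hA ⟨n, rfl⟩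
  have hA' : ∀ n, A' ≤ s n := fun n => hA' ⟨n, rfl⟩
  have bd : IsBoundedUnder (· ≤ ·) atTop s := isBoundedUnder_of ⟨A, hA⟩
  have bd' : IsCoboundedUnder (· ≤ ·) atTop s :=
    (isBoundedUnder_of ⟨A', hA'⟩ : IsBoundedUnder (· ≥ ·) atTop s).isCoboundedUnder_le
  refine ⟨limsup s atTop, tendsto_order.2 ⟨fun b hb => ?_, fun b hb => ?_⟩⟩
  · have h1 : ∀ n, limsup s atTop ≤ s n + ε n := by
      intro n
      refine limsup_le_of_le bd' ?_
      filter_upwards [eventually_ge_atTop n] with k hk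
      obtain ⟨m, rfl⟩ := Nat.exists_eq_add_of_le hk
      exact h n m
    filter_upwards [hε.eventually_lt_const (sub_pos.2 hb)] with n hn
    linarith [h1 n]
  · exact eventually_lt_of_limsup_lt hb bd

theorem List.sum_map_le_mul_sum {D : Type*} {x L : D → ℝ} {s : ℝ} (h : ∀ d, x d ≤ s * L d)
    (l : List D) : (l.map x).sum ≤ s * (l.map L).sum := by
  induction l with
  | nil => simp
  | cons a l ih => simp only [List.map_cons, List.sum_cons, mul_add]; linarith [h a]

/-- One summand of smaller ratio pulls the weighted average down in proportion to its weight; this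
gain drives the contraction in `exists_common_limit`. -/
theorem List.sum_map_le_mul_sum_of_mem {D : Type*} {x L : D → ℝ} {s i : ℝ}
    (h : ∀ d, x d ≤ s * L d) {l : List D} {a : D} (ha : a ∈ l) (hi : x a ≤ i * L a) :
    (l.map x).sum ≤ s * (l.map L).sum - (s - i) * L a := by
  obtain ⟨l₁, l₂, rfl⟩ := List.append_of_mem ha
  have h1 := List.sum_map_le_mul_sum h l₁
  have h2 := List.sum_map_le_mul_sum h l₂
  simp only [List.map_append, List.map_cons, List.sum_append, List.sum_cons]
  linarith

/-- If the additive quantity `L` grows under a mixing substitution `β` and `x` is additive up to an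
error bounded by the number of blocks, then the quotients `x / L` converge to a common limit. -/
theorem exists_common_limit {D : Type*} [Fintype D] [Nonempty D] (β : ℕ → D → List D)
    (x L : ℕ → D → ℝ) (K C : ℝ) (hK : 0 ≤ K)
    (hL : ∀ n m d, L (n + m) d = ((β m d).map (L n)).sum)
    (hβ : ∀ m d, ((β m d).length : ℝ) = L m d)
    (hx : ∀ n m d, |x (n + m) d - ((β m d).map (x n)).sum| ≤ K * L m d)
    (hpos : ∀ n d, 0 < L n d) (hgrow : ∀ d, Tendsto (fun n => L n d) atTop atTop)
    (hmix : ∃ m, ∀ d d', d' ∈ β m d) (hx0 : ∀ n d, 0 ≤ x n d) (hxC : ∀ n d, x n d ≤ C * L n d) :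
    ∃ a, ∀ d, Tendsto (fun n => x n d / L n d) atTop (𝓝 a) := by
  classical
  obtain ⟨m₀, hm₀⟩ := hmix
  have hne : (Finset.univ : Finset D).Nonempty := Finset.univ_nonempty
  set r : ℕ → D → ℝ := fun n d => x n d / L n d with hr
  set s : ℕ → ℝ := fun n => Finset.univ.sup' hne (r n) with hs
  set i : ℕ → ℝ := fun n => Finset.univ.inf' hne (r n) with hi
  set ε : ℕ → ℝ := fun n => Finset.univ.sup' hne (fun d => K / L n d) with hε
  have hrs : ∀ n d, r n d ≤ s n := fun n d => Finset.le_sup' (r n) (Finset.mem_univ d)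
  have hir : ∀ n d, i n ≤ r n d := fun n d => Finset.inf'_le (r n) (Finset.mem_univ d)
  have hxs : ∀ n d, x n d ≤ s n * L n d := fun n d => (div_le_iff₀ (hpos n d)).1 (hrs n d)
  have hxi : ∀ n d, i n * L n d ≤ x n d := fun n d => (le_div_iff₀ (hpos n d)).1 (hir n d)
  have hKε : ∀ n d, K ≤ ε n * L n d := fun n d =>
    (div_le_iff₀ (hpos n d)).1 (Finset.le_sup' (fun d => K / L n d) (Finset.mem_univ d))
  -- There are `L m d` blocks, each costing an error `K`, which is at most `ε n` times the length of
  -- the block; the sum is absorbed into the total length.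
  have hKL : ∀ n m d, K * L m d ≤ ε n * L (n + m) d := by
    intro n m d
    have := List.sum_map_le_mul_sum (x := fun _ => K) (hKε n) (β m d)
    rw [← hL] at this
    simpa [hβ, mul_comm] using this
  have hε0 : Tendsto ε atTop (𝓝 0) := by
    have : ∀ d, Tendsto (fun n => K / L n d) atTop (𝓝 0) := fun d =>
      (hgrow d).const_div_atTop K
    rw [tendsto_order]
    constructor
    · intro b hb
      filter_upwards with n
      obtain ⟨d⟩ := ‹Nonempty D›
      exact hb.trans_le ((div_nonneg hK (hpos n d).le).trans
        (Finset.le_sup' (fun d => K / L n d) (Finset.mem_univ d)))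
    · intro b hb
      filter_upwards [eventually_all.2 fun d => (this d).eventually_lt_const hb] with n hn
      exact (Finset.sup'_lt_iff hne).2 fun d _ => hn d
  have hup : ∀ n m d, r (n + m) d ≤ s n + ε n := by
    intro n m d
    rw [hr, div_le_iff₀ (hpos _ _)]
    have h1 := (abs_le.1 (hx n m d)).2
    have h2 := List.sum_map_le_mul_sum (hxs n) (β m d)
    rw [← hL] at h2
    linarith [hKL n m d]
  have hlow : ∀ n m d, i n - ε n ≤ r (n + m) d := by
    intro n m d
    rw [hr, le_div_iff₀ (hpos _ _)]
    have h1 := (abs_le.1 (hx n m d)).1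
    have h2 := List.sum_map_le_mul_sum (x := fun d => - x n d) (s := - i n) (L := L n)
      (fun d => by linarith [hxi n d]) (β m d)
    rw [← hL] at h2
    have h3 : ((β m d).map fun d => - x n d).sum = - ((β m d).map (x n)).sum := by
      rw [List.sum_neg]; simp [Function.comp_def]
    linarith [hKL n m d]
  have hr0 : ∀ n d, 0 ≤ r n d := fun n d => div_nonneg (hx0 n d) (hpos n d).le
  have hrC : ∀ n d, r n d ≤ C := fun n d => (div_le_iff₀ (hpos n d)).2 (hxC n d)
  have d₀ : D := Classical.arbitrary D
  obtain ⟨S, hS⟩ : ∃ S, Tendsto s atTop (𝓝 S) := by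
    refine exists_tendsto_of_almost_antitone ⟨C, ?_⟩ ⟨0, ?_⟩ hε0 ?_
    · rintro _ ⟨n, rfl⟩
      exact Finset.sup'_le _ _ fun d _ => hrC n d
    · rintro _ ⟨n, rfl⟩
      exact (hr0 n d₀).trans (hrs n d₀)
    · intro n m
      exact Finset.sup'_le _ _ fun d _ => hup n m d
  obtain ⟨I', hI'⟩ : ∃ I, Tendsto (fun n => - i n) atTop (𝓝 I) := by
    refine exists_tendsto_of_almost_antitone ⟨0, ?_⟩ ⟨-C, ?_⟩ hε0 ?_
    · rintro _ ⟨n, rfl⟩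
      exact neg_nonpos.2 (Finset.le_inf' _ _ fun d _ => hr0 n d)
    · rintro _ ⟨n, rfl⟩
      exact neg_le_neg ((hir n d₀).trans (hrC n d₀))
    · intro n m
      have : i n - ε n ≤ i (n + m) := Finset.le_inf' _ _ fun d _ => hlow n m d
      linarith
  have hI : Tendsto i atTop (𝓝 (-I')) := by simpa using hI'.neg
  obtain ⟨M, hM1, hM⟩ : ∃ M : ℝ, 0 < M ∧ ∀ d, L m₀ d ≤ M := by
    obtain ⟨M, hM⟩ := (Set.finite_range (L m₀)).bddAbove
    exact ⟨max M 1, by positivity, fun d => (hM ⟨d, rfl⟩).trans (le_max_left _ _)⟩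
  -- Here the iterate is cut the other way, into the blocks of `β n d`, each expanded to length at
  -- most `M`.
  have hlen : ∀ n d, L (n + m₀) d ≤ M * L n d := by
    intro n d
    have := List.sum_map_le_mul_sum (x := L m₀) (L := fun _ => 1) (s := M)
      (by simpa using hM) (β n d)
    rw [← hL] at this
    rw [add_comm]
    simpa [hβ] using this
  have hsingle : ∀ n d d', L n d ≤ L (n + m₀) d' := by
    intro n d d'
    rw [hL]
    exact List.single_le_sum (by simpa using fun a _ => (hpos n a).le) _
      (List.mem_map_of_mem (hm₀ d' d))
  -- The block `d` of smallest ratio occurs in every image, and by `h3` it fills at least the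
  -- fraction `M⁻¹ * M⁻¹` of it: there are at most `M` blocks, and none is longer than `M` times the
  -- block `d`.
  have hcontr : ∀ n, s (n + m₀) ≤ s n - (s n - i n) * (M⁻¹ * M⁻¹) + ε n := by
    intro n
    refine Finset.sup'_le _ _ fun e _ => ?_
    obtain ⟨d, -, hd⟩ := Finset.exists_mem_eq_inf' hne (r n)
    have hd : i n = r n d := hd
    have h1 := (abs_le.1 (hx n m₀ e)).2
    have h2 := List.sum_map_le_mul_sum_of_mem (hxs n) (hm₀ e d) (i := i n)
      (by rw [hd, hr]; exact (div_mul_cancel₀ _ (hpos n d).ne').ge)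
    rw [← hL] at h2
    have h3 : M⁻¹ * M⁻¹ * L (n + m₀) e ≤ L n d := by
      have h4 : L (n + m₀) e ≤ M * (M * L n d) := by
        rw [hL]
        have h5 := List.sum_map_le_mul_sum (x := L n) (L := fun _ => 1) (s := M * L n d)
          (fun a => by rw [mul_one]; exact (hsingle n a d).trans (hlen n d)) (β m₀ e)
        refine h5.trans ?_
        have : M * L n d * L m₀ e ≤ M * L n d * M :=
          mul_le_mul_of_nonneg_left (hM e) (mul_nonneg hM1.le (hpos n d).le)
        simp only [List.map_const', List.sum_replicate, nsmul_eq_mul, mul_one, hβ]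
        linarith
      calc M⁻¹ * M⁻¹ * L (n + m₀) e ≤ M⁻¹ * M⁻¹ * (M * (M * L n d)) := by gcongr
        _ = L n d := by field_simp
    have h6 : 0 ≤ s n - i n := sub_nonneg.2 ((hir n d).trans (hrs n d))
    rw [hr, div_le_iff₀ (hpos _ _)]
    have h7 := mul_le_mul_of_nonneg_left h3 h6
    linarith [hKL n m₀ e]
  -- In the limit `hcontr` reads `S ≤ S - (S + I') * (M⁻¹ * M⁻¹)`, so the largest and the smallest
  -- ratio have the same limit.
  have hSI : S = -I' := by
    have h1 := le_of_tendsto_of_tendsto' ((tendsto_add_atTop_iff_nat m₀).2 hS)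
      ((hS.sub ((hS.sub hI).mul_const (M⁻¹ * M⁻¹))).add hε0) hcontr
    have h2 : -I' ≤ S := le_of_tendsto_of_tendsto' hI hS fun n => (hir n d₀).trans (hrs n d₀)
    have h3 : 0 < M⁻¹ * M⁻¹ := by positivity
    nlinarith
  refine ⟨S, fun d => ?_⟩
  rw [← hSI] at hI
  exact tendsto_of_tendsto_of_tendsto_of_le_of_le hI hS (fun n => hir n d) (fun n => hrs n d)

/-! ## Iterates of graph maps -/

namespace EdgeGraph

variable {V E : Type*} {Γ : EdgeGraph V E}

theorem init_flipLetter (d : E × Bool) : Γ.init (flipLetter d) = Γ.term d := by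
  rcases d with ⟨e, b⟩
  cases b <;> rfl

theorem term_flipLetter (d : E × Bool) : Γ.term (flipLetter d) = Γ.init d := by
  rcases d with ⟨e, b⟩
  cases b <;> rfl

theorem isPath_append_iff {u v : V} {w w' : List (E × Bool)} :
    Γ.IsPath u (w ++ w') v ↔ ∃ x, Γ.IsPath u w x ∧ Γ.IsPath x w' v := by
  induction w generalizing u with
  | nil => simp [IsPath]
  | cons d w ih => simp [IsPath, ih, and_assoc]

theorem isPath_singleton (d : E × Bool) : Γ.IsPath (Γ.init d) [d] (Γ.term d) := ⟨rfl, rfl⟩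

theorem IsPath.unique_start {u u' v v' : V} {w : List (E × Bool)} (h : Γ.IsPath u w v)
    (h' : Γ.IsPath u' w v') (hw : w ≠ []) : u = u' := by
  cases w with
  | nil => exact absurd rfl hw
  | cons d w => exact h.1.symm.trans h'.1

theorem IsPath.unique_end {u v v' : V} {w : List (E × Bool)} (h : Γ.IsPath u w v)
    (h' : Γ.IsPath u w v') : v = v' := by
  induction w generalizing u with
  | nil => exact Eq.trans (Eq.symm h) h'
  | cons d w ih => exact ih h.2 h'.2

/-- A word is an edge-path for some endpoints. -/
def IsEdgePath (Γ : EdgeGraph V E) (w : List (E × Bool)) : Prop := ∃ u v, Γ.IsPath u w v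

theorem IsEdgePath.infix {v w : List (E × Bool)} (h : Γ.IsEdgePath w) (hv : v <:+: w) :
    Γ.IsEdgePath v := by
  obtain ⟨x, y, h⟩ := h
  obtain ⟨s, t, rfl⟩ := hv
  obtain ⟨z, h, -⟩ := isPath_append_iff.1 h
  obtain ⟨z', -, h⟩ := isPath_append_iff.1 h
  exact ⟨_, _, h⟩

end EdgeGraph

namespace GraphMap

variable {V E : Type*} {Γ : EdgeGraph V E} (f : GraphMap Γ)

theorem onPath_append (v w : List (E × Bool)) : f.onPath (v ++ w) = f.onPath v ++ f.onPath w := by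
  simp [onPath]

theorem onOriented_flipLetter (d : E × Bool) :
    f.onOriented (flipLetter d) = FreeGroup.invRev (f.onOriented d) := by
  rcases d with ⟨e, b⟩
  cases b <;> simp [onOriented, flipLetter]

theorem onPath_invRev (w : List (E × Bool)) :
    f.onPath (FreeGroup.invRev w) = FreeGroup.invRev (f.onPath w) := by
  induction w with
  | nil => rfl
  | cons d w ih =>
    rw [invRev_cons, onPath_append, ih]
    simp [onPath, onOriented_flipLetter]

theorem isPath_onOriented (d : E × Bool) :
    Γ.IsPath (f.onV (Γ.init d)) (f.onOriented d) (f.onV (Γ.term d)) := by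
  rcases d with ⟨e, b⟩
  cases b
  · exact Γ.isPath_invRev (f.isPath e)
  · exact f.isPath e

theorem isPath_onPath {x y : V} {w : List (E × Bool)} (h : Γ.IsPath x w y) :
    Γ.IsPath (f.onV x) (f.onPath w) (f.onV y) := by
  induction w generalizing x with
  | nil => exact congrArg f.onV h
  | cons d w ih =>
    have := f.isPath_onOriented d
    rw [h.1] at this
    exact Γ.isPath_append this (ih h.2)

theorem isPath_onPath_iterate (n : ℕ) {x y : V} {w : List (E × Bool)} (h : Γ.IsPath x w y) :
    Γ.IsPath (f.onV^[n] x) (f.onPath^[n] w) (f.onV^[n] y) := by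
  induction n with
  | zero => exact h
  | succ n ih =>
    simp only [Function.iterate_succ_apply']
    exact f.isPath_onPath ih

theorem isEdgePath_iter (n : ℕ) (d : E × Bool) : Γ.IsEdgePath (f.iter n d) :=
  ⟨_, _, f.isPath_onPath_iterate n (EdgeGraph.isPath_singleton d)⟩

theorem iterate_onPath_append (n : ℕ) (v w : List (E × Bool)) :
    f.onPath^[n] (v ++ w) = f.onPath^[n] v ++ f.onPath^[n] w := by
  induction n generalizing v w with
  | zero => rfl
  | succ n ih => simp only [Function.iterate_succ_apply, onPath_append, ih]

theorem iterate_onPath_nil (n : ℕ) : f.onPath^[n] [] = [] := by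
  induction n with
  | zero => rfl
  | succ n ih => rw [Function.iterate_succ_apply]; exact ih

theorem iterate_onPath_invRev (n : ℕ) (w : List (E × Bool)) :
    f.onPath^[n] (FreeGroup.invRev w) = FreeGroup.invRev (f.onPath^[n] w) := by
  induction n generalizing w with
  | zero => rfl
  | succ n ih => simp only [Function.iterate_succ_apply, onPath_invRev, ih]

theorem iterate_onPath_eq_flatMap (n : ℕ) (w : List (E × Bool)) :
    f.onPath^[n] w = w.flatMap (f.iter n) := by
  induction w with
  | nil => exact f.iterate_onPath_nil n
  | cons d w ih =>
    rw [← List.singleton_append, iterate_onPath_append, ih]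
    rfl

theorem iter_add (n m : ℕ) (d : E × Bool) :
    f.iter (n + m) d = (f.iter m d).flatMap (f.iter n) := by
  rw [← iterate_onPath_eq_flatMap, iter, Function.iterate_add_apply]
  rfl

theorem iter_flipLetter (n : ℕ) (d : E × Bool) :
    f.iter n (flipLetter d) = FreeGroup.invRev (f.iter n d) := by
  rw [iter, iter, ← iterate_onPath_invRev]
  rfl

theorem iter_false (n : ℕ) (e : E) :
    f.iter n (e, false) = FreeGroup.invRev (f.iter n (e, true)) :=
  f.iter_flipLetter n (e, true)

theorem length_iter (n : ℕ) (d : E × Bool) :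
    (f.iter n d).length = (f.iter n (d.1, true)).length := by
  rcases d with ⟨e, b⟩
  cases b
  · rw [iter_false, FreeGroup.invRev_length]
  · rfl

theorem isReduced_iter (h : ∀ k, 1 ≤ k → ∀ e, FreeGroup.IsReduced (f.iter k (e, true)))
    (k : ℕ) (d : E × Bool) : FreeGroup.IsReduced (f.iter k d) := by
  classical
  rcases Nat.eq_zero_or_pos k with rfl | hk
  · exact FreeGroup.IsReduced.singleton
  · rcases d with ⟨e, b⟩
    cases b
    · rw [iter_false, FreeGroup.isReduced_iff_reduce_eq, FreeGroup.reduce_invRev,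
        (h k hk e).reduce_eq]
    · exact h k hk e

theorem onClass_mk (w : List (E × Bool)) :
    f.onClass (FreeGroup.mk w) = FreeGroup.mk (f.onPath w) := by
  induction w with
  | nil => exact map_one _
  | cons d w ih =>
    have h1 : FreeGroup.mk (d :: w) = FreeGroup.mk [d] * FreeGroup.mk w := by
      rw [FreeGroup.mul_mk]; rfl
    have h2 : f.onPath (d :: w) = f.onOriented d ++ f.onPath w := rfl
    rw [h1, map_mul, ih, h2, ← FreeGroup.mul_mk]
    congr 1
    rcases d with ⟨e, b⟩
    cases b
    · have : FreeGroup.mk [(e, false)] = (FreeGroup.of e)⁻¹ := rfl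
      rw [this, map_inv, onClass, FreeGroup.lift_apply_of]
      simp [onOriented, FreeGroup.inv_mk]
    · exact FreeGroup.lift_apply_of

theorem iterate_onClass_mk (n : ℕ) (w : List (E × Bool)) :
    f.onClass^[n] (FreeGroup.mk w) = FreeGroup.mk (f.onPath^[n] w) := by
  induction n with
  | zero => rfl
  | succ n ih => simp only [Function.iterate_succ_apply', ih, onClass_mk]

theorem isPathClass_iterate (n : ℕ) {x y : V} {c : FreeGroup E} (h : Γ.IsPathClass x c y) :
    Γ.IsPathClass (f.onV^[n] x) (f.onClass^[n] c) (f.onV^[n] y) := by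
  obtain ⟨w, hw, rfl⟩ := h
  exact ⟨_, f.isPath_onPath_iterate n hw, (f.iterate_onClass_mk n w).symm⟩

/-- Some iterate of `f` maps every edge over all edges. -/
def IsMixing : Prop := ∃ m, ∀ d d' : E, d' ∈ (f.iter m (d, true)).map Prod.fst

/-- The iterated images of all edges grow. -/
def IsExpanding : Prop := ∀ d, Tendsto (fun n => (f.iter n d).length) atTop atTop

/-- The words that occur in iterated images of edges. -/
def language : Set (List (E × Bool)) := {v | ∃ k d, v <:+: f.iter k d}

variable {f}

/-- Both orientations of an edge are iterated, so the language is closed under inversion and the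
second alternative adds nothing. -/
theorem mem_language_iff_or {v : List (E × Bool)} :
    v ∈ f.language ↔ ∃ v' ∈ {w | ∃ (k : ℕ) (d : E × Bool), w = f.iter k d},
      v <:+: v' ∨ v <:+: FreeGroup.invRev v' := by
  constructor
  · rintro ⟨k, d, h⟩
    exact ⟨_, ⟨k, d, rfl⟩, Or.inl h⟩
  · rintro ⟨_, ⟨k, d, rfl⟩, h | h⟩
    · exact ⟨k, d, h⟩
    · exact ⟨k, flipLetter d, by rwa [iter_flipLetter]⟩

theorem isEdgePath_of_mem_language {v : List (E × Bool)} (h : v ∈ f.language) :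
    Γ.IsEdgePath v := by
  obtain ⟨k, d, h⟩ := h
  exact (f.isEdgePath_iter k d).infix h

/-! ### Frequencies of words in long iterates -/

section Frequency

variable [DecidableEq E]

theorem occ_iter (v : List (E × Bool)) (hv : v ≠ []) (n : ℕ) (d : E × Bool) :
    occ v (f.iter n d) = occ v (f.iter n (d.1, true)) := by
  rcases d with ⟨e, b⟩
  cases b
  · rw [iter_false, occ_invRev_right hv]
  · rfl

theorem abs_occ_append_sub_le {v : List (E × Bool)} (hv : v ≠ []) (a b : List (E × Bool)) :
    |(occ v (a ++ b) : ℝ) - occ v a - occ v b| ≤ 2 * v.length := by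
  have h1 : (occ v a : ℝ) + occ v b ≤ occ v (a ++ b) := by exact_mod_cast occ_append_ge hv a b
  have h2 : (occ v (a ++ b) : ℝ) ≤ occ v a + occ v b + 2 * v.length := by
    exact_mod_cast occ_append_le hv a b
  rw [abs_le]
  constructor
  · have : (0 : ℝ) ≤ 2 * v.length := by positivity
    linarith
  · linarith

theorem occ_nil {v : List (E × Bool)} (hv : v ≠ []) : occ v ([] : List (E × Bool)) = 0 := by
  have := occ_le hv ([] : List (E × Bool))
  simpa using this

/-- Each junction costs at most `2 * v.length`. Orientations can be forgotten on the right because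
`occ` does not distinguish a block from its inverse. -/
theorem abs_occ_flatMap_sub_le {v : List (E × Bool)} (hv : v ≠ []) (n : ℕ) (w : List (E × Bool)) :
    |(occ v (w.flatMap (f.iter n)) : ℝ) -
      ((w.map Prod.fst).map fun e => (occ v (f.iter n (e, true)) : ℝ)).sum| ≤
      2 * v.length * w.length := by
  induction w with
  | nil => simp [occ_nil hv]
  | cons d w ih =>
    simp only [List.flatMap_cons, List.map_cons, List.sum_cons, List.length_cons]
    have h1 := abs_occ_append_sub_le hv (f.iter n d) (w.flatMap (f.iter n))
    rw [occ_iter v hv n d] at h1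
    rw [abs_le] at *
    push_cast
    constructor <;> linarith [h1.1, h1.2, ih.1, ih.2]

theorem exists_frequency [Fintype E] [Nonempty E] (hm : f.IsMixing) (he : f.IsExpanding)
    (hne : ∀ n d, f.iter n d ≠ []) {v : List (E × Bool)} (hv : v ≠ []) :
    ∃ a : ℝ, ∀ d : E × Bool,
      Tendsto (fun n : ℕ => (occ v (f.iter n d) : ℝ) / (f.iter n d).length) atTop (𝓝 a) := by
  have hlenmap : ∀ n (w : List (E × Bool)), ((w.flatMap (f.iter n)).length : ℝ) =
      ((w.map Prod.fst).map fun e => ((f.iter n (e, true)).length : ℝ)).sum := by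
    intro n w
    induction w with
    | nil => simp
    | cons d w ih =>
      simp only [List.flatMap_cons, List.map_cons, List.sum_cons, List.length_append,
        Nat.cast_add, ih, f.length_iter n d]
  -- The substitution acts on unoriented edges: mixing is stated for them, and neither counts nor
  -- lengths see the orientation.
  obtain ⟨a, ha⟩ := exists_common_limit (fun m e => (f.iter m (e, true)).map Prod.fst)
    (fun n e => (occ v (f.iter n (e, true)) : ℝ)) (fun n e => ((f.iter n (e, true)).length : ℝ))
    (2 * v.length) 2 (by positivity)
    (fun n m e => by rw [iter_add]; exact hlenmap _ _)
    (fun m e => by simp)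
    (fun n m e => by rw [iter_add]; exact abs_occ_flatMap_sub_le hv n _)
    (fun n e => by exact_mod_cast List.length_pos_iff.2 (hne n _))
    (fun e => tendsto_natCast_atTop_atTop.comp (he (e, true)))
    hm (fun n e => by positivity) (fun n e => by exact_mod_cast occ_le hv _)
  refine ⟨a, fun d => ?_⟩
  simpa only [occ_iter v hv _ d, f.length_iter _ d] using ha d.1

variable (f) in
/-- The frequency of a word in the long iterates of edges. -/
noncomputable def frequency [Nonempty E] (v : List (E × Bool)) : ℝ :=
  limUnder atTop fun n : ℕ => (occ v (f.iter n (Classical.arbitrary E, true)) : ℝ) /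
    (f.iter n (Classical.arbitrary E, true)).length

variable [Fintype E] [Nonempty E] (hm : f.IsMixing) (he : f.IsExpanding)
  (hne : ∀ n d, f.iter n d ≠ [])

include hm he hne

theorem tendsto_frequency {v : List (E × Bool)} (hv : v ≠ []) (d : E × Bool) :
    Tendsto (fun n : ℕ => (occ v (f.iter n d) : ℝ) / (f.iter n d).length) atTop
      (𝓝 (f.frequency v)) := by
  obtain ⟨a, ha⟩ := exists_frequency hm he hne hv
  have : f.frequency v = a := (ha _).limUnder_eq
  rw [this]
  exact ha d

theorem frequency_nonneg {v : List (E × Bool)} (hv : v ≠ []) : 0 ≤ f.frequency v :=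
  ge_of_tendsto' (tendsto_frequency hm he hne hv (Classical.arbitrary E, true))
    fun _ => by positivity

theorem frequency_invRev {v : List (E × Bool)} (hv : v ≠ []) :
    f.frequency (FreeGroup.invRev v) = f.frequency v := by
  refine tendsto_nhds_unique (tendsto_frequency hm he hne (invRev_ne_nil hv)
    (Classical.arbitrary E, true)) ?_
  simpa only [occ_invRev_left] using tendsto_frequency hm he hne hv (Classical.arbitrary E, true)

theorem mem_language_of_frequency_ne_zero {v : List (E × Bool)} (hv : v ≠ [])
    (h : f.frequency v ≠ 0) : v ∈ f.language := by
  by_contra hl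
  refine h (tendsto_nhds_unique
    (tendsto_frequency hm he hne hv (Classical.arbitrary E, true)) ?_)
  have : ∀ n : ℕ, occ v (f.iter n (Classical.arbitrary E, true)) = 0 := by
    intro n
    by_contra hn
    exact hl (mem_language_iff_or.2
      ⟨_, ⟨n, _, rfl⟩, isInfix_of_occ_pos hv (Nat.pos_of_ne_zero hn)⟩)
  simp [this]

/-- By `occ_concat_le` the two sides differ at level `n` by at most 2 divided by the length of the
iterate, which tends to infinity. -/
theorem sum_frequency_concat {v : List (E × Bool)} (hv : v ≠ []) :
    ∑ d, f.frequency (v ++ [d]) = f.frequency v := by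
  set d₀ : E × Bool := (Classical.arbitrary E, true)
  have h1 : Tendsto (fun n : ℕ => ∑ d, (occ (v ++ [d]) (f.iter n d₀) : ℝ) / (f.iter n d₀).length)
      atTop (𝓝 (∑ d, f.frequency (v ++ [d]))) :=
    tendsto_finsetSum _ fun d _ => tendsto_frequency hm he hne (by simp) d₀
  have h2 := tendsto_frequency hm he hne hv d₀
  have h3 : Tendsto (fun n : ℕ => (2 : ℝ) / (f.iter n d₀).length) atTop (𝓝 0) :=
    (tendsto_natCast_atTop_atTop.comp (he d₀)).const_div_atTop 2
  have h4 : ∀ n, (∑ d, (occ (v ++ [d]) (f.iter n d₀) : ℝ)) ≤ occ v (f.iter n d₀) ∧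
      (occ v (f.iter n d₀) : ℝ) ≤ (∑ d, (occ (v ++ [d]) (f.iter n d₀) : ℝ)) + 2 := by
    intro n
    obtain ⟨ha, hb⟩ := occ_concat_le hv (f.iter n d₀)
    exact ⟨by exact_mod_cast ha, by exact_mod_cast hb⟩
  apply le_antisymm
  · refine le_of_tendsto_of_tendsto' h1 h2 fun n => ?_
    rw [← Finset.sum_div]
    exact div_le_div_of_nonneg_right (h4 n).1 (by positivity)
  · have h5 := h1.add h3
    rw [add_zero] at h5
    refine le_of_tendsto_of_tendsto' h2 h5 fun n => ?_
    rw [← Finset.sum_div, ← add_div]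
    exact div_le_div_of_nonneg_right (h4 n).2 (by positivity)

theorem sum_frequency_singleton : ∑ d : E × Bool, f.frequency [d] = 2 := by
  set d₀ : E × Bool := (Classical.arbitrary E, true)
  have h1 : Tendsto (fun n : ℕ => ∑ d : E × Bool, (occ [d] (f.iter n d₀) : ℝ) /
      (f.iter n d₀).length) atTop (𝓝 (∑ d : E × Bool, f.frequency [d])) :=
    tendsto_finsetSum _ fun d _ => tendsto_frequency hm he hne (by simp) d₀
  refine tendsto_nhds_unique h1 ?_
  have : ∀ n : ℕ, ∑ d : E × Bool, (occ [d] (f.iter n d₀) : ℝ) / (f.iter n d₀).length = 2 := by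
    intro n
    have h2 : ((∑ d : E × Bool, occ [d] (f.iter n d₀) : ℕ) : ℝ) = 2 * (f.iter n d₀).length := by
      exact_mod_cast sum_occ_singleton (f.iter n d₀)
    rw [← Finset.sum_div, ← Nat.cast_sum, h2]
    have : ((f.iter n d₀).length : ℝ) ≠ 0 := by simpa using hne n d₀
    field_simp
  simp [this]

end Frequency

end GraphMap

/-! ## Uniform frequencies in the language -/

/-- A suffix cuts at most one block; what it retains of that block is `s`. -/
theorem List.exists_eq_append_flatMap_of_isSuffix {A B : Type*} {g : A → List B} {M : ℕ}
    (hM : ∀ a, (g a).length ≤ M) {l : List A} {t : List B} (h : t <:+ l.flatMap g) :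
    ∃ (s : List B) (l' : List A), t = s ++ l'.flatMap g ∧ s.length ≤ M := by
  induction l with
  | nil => exact ⟨[], [], by simpa using h, by simp⟩
  | cons a l ih =>
    rw [List.flatMap_cons] at h
    obtain ⟨r, hr⟩ := h
    rcases List.append_eq_append_iff.1 hr with ⟨u, hu, ht⟩ | ⟨u, hu, ht⟩
    · exact ⟨u, l, ht, le_trans (by rw [hu]; simp) (hM a)⟩
    · exact ih ⟨u, ht.symm⟩

theorem List.exists_eq_flatMap_append_of_isPrefix {A B : Type*} {g : A → List B} {M : ℕ}
    (hM : ∀ a, (g a).length ≤ M) {l : List A} {t : List B} (h : t <+: l.flatMap g) :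
    ∃ (l' : List A) (p : List B), t = l'.flatMap g ++ p ∧ p.length ≤ M := by
  induction l generalizing t with
  | nil => exact ⟨[], [], by simpa using h, by simp⟩
  | cons a l ih =>
    rw [List.flatMap_cons] at h
    obtain ⟨r, hr⟩ := h
    rcases List.append_eq_append_iff.1 hr with ⟨u, hu, ht⟩ | ⟨u, hu, ht⟩
    · exact ⟨[], t, by simp, le_trans (by rw [hu]; simp) (hM a)⟩
    · obtain ⟨l', p, h1, h2⟩ := ih ⟨r, ht.symm⟩
      exact ⟨a :: l', p, by rw [hu, h1]; simp, h2⟩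

theorem List.exists_eq_append_flatMap_append_of_isInfix {A B : Type*} {g : A → List B} {M : ℕ}
    (hM : ∀ a, (g a).length ≤ M) {l : List A} {t : List B} (h : t <:+: l.flatMap g) :
    ∃ (s : List B) (l' : List A) (p : List B),
      t = s ++ (l'.flatMap g ++ p) ∧ s.length ≤ M ∧ p.length ≤ M := by
  obtain ⟨u, hu, hs⟩ := List.infix_iff_prefix_suffix.1 h
  obtain ⟨s, l', rfl, hsM⟩ := List.exists_eq_append_flatMap_of_isSuffix hM hs
  obtain ⟨r, hr⟩ := hu
  rcases List.append_eq_append_iff.1 hr with ⟨u, hu, ht⟩ | ⟨u, hu, ht⟩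
  · exact ⟨t, [], [], by simp, le_trans (by rw [hu]; simp) hsM, by simp⟩
  · obtain ⟨l'', p, h1, h2⟩ := List.exists_eq_flatMap_append_of_isPrefix hM ⟨r, ht.symm⟩
    exact ⟨s, l'', p, by rw [hu, h1], hsM, h2⟩

namespace GraphMap

variable {V E : Type*} {Γ : EdgeGraph V E} {f : GraphMap Γ} [DecidableEq E] [Fintype E] [Nonempty E]
  (hm : f.IsMixing) (he : f.IsExpanding) (hne : ∀ n d, f.iter n d ≠ [])

include hm he hne

/-- Fix a level `n` at which the deviation of every block, plus the cost of a junction, is at most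
`ε` times its length; whole blocks can then be concatenated without additive loss. A word from an
iterate of order at least `n` is such a concatenation up to two bounded end pieces, and a word from
an earlier iterate is itself bounded. That `K` does not depend on the word is what the averaging
argument needs. -/
theorem abs_occ_sub_frequency_le {v : List (E × Bool)} (hv : v ≠ []) {ε : ℝ} (hε : 0 < ε) :
    ∃ K : ℝ, 0 ≤ K ∧ ∀ w ∈ f.language,
      |(occ v w : ℝ) - f.frequency v * w.length| ≤ ε * w.length + K := by
  set a := f.frequency v with ha
  set δ : List (E × Bool) → ℝ := fun w => (occ v w : ℝ) - a * w.length with hδ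
  set C : ℝ := 2 * v.length with hC
  have hC0 : 0 ≤ C := by positivity
  have ha0 : 0 ≤ a := frequency_nonneg hm he hne hv
  have hadd : ∀ x y, |δ (x ++ y)| ≤ |δ x| + |δ y| + C := by
    intro x y
    have h1 := abs_occ_append_sub_le hv x y
    have h2 : δ (x ++ y) = δ x + δ y + ((occ v (x ++ y) : ℝ) - occ v x - occ v y) := by
      simp only [hδ, List.length_append, Nat.cast_add]
      ring
    rw [h2]
    exact (abs_add_le _ _).trans (add_le_add (abs_add_le _ _) h1)
  have htriv : ∀ w, |δ w| ≤ (2 + a) * w.length := by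
    intro w
    have h1 : (occ v w : ℝ) ≤ 2 * w.length := by exact_mod_cast occ_le hv w
    have h2 : 0 ≤ a * w.length := by positivity
    have h3 : (0 : ℝ) ≤ occ v w := by positivity
    rw [abs_le]
    constructor <;> simp only [hδ] <;> linarith
  obtain ⟨n, hn⟩ : ∃ n, ∀ d, |δ (f.iter n d)| + C ≤ ε * (f.iter n d).length := by
    have h1 : ∀ᶠ n in atTop, ∀ d, |δ (f.iter n d)| + C ≤ ε * (f.iter n d).length := by
      rw [eventually_all]
      intro d
      have h2 := (Metric.tendsto_nhds.1 (tendsto_frequency hm he hne hv d)) (ε / 2) (by positivity)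
      have h3 := (tendsto_natCast_atTop_atTop (R := ℝ).comp (he d)).eventually_ge_atTop (2 * C / ε)
      filter_upwards [h2, h3] with n h2 h3
      have hpos : (0 : ℝ) < (f.iter n d).length := by
        exact_mod_cast List.length_pos_iff.2 (hne n d)
      rw [Real.dist_eq, ← ha] at h2
      have h4 : δ (f.iter n d) =
          ((occ v (f.iter n d) : ℝ) / (f.iter n d).length - a) * (f.iter n d).length := by
        simp only [hδ]; field_simp
      have h5 : |δ (f.iter n d)| ≤ ε / 2 * (f.iter n d).length := by
        rw [h4, abs_mul, abs_of_pos hpos]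
        exact mul_le_mul_of_nonneg_right h2.le hpos.le
      have h6 : 2 * C ≤ (f.iter n d).length * ε := (div_le_iff₀ hε).1 h3
      linarith
    exact h1.exists
  have hblocks : ∀ l : List (E × Bool),
      |δ (l.flatMap (f.iter n))| ≤ ε * (l.flatMap (f.iter n)).length := by
    intro l
    induction l with
    | nil => simp [hδ, occ_nil hv]
    | cons d l ih =>
      rw [List.flatMap_cons, List.length_append, Nat.cast_add]
      linarith [hadd (f.iter n d) (l.flatMap (f.iter n)), hn d]
  -- The bound covers all levels up to `n`, because words from iterates of lower order are treated
  -- as end pieces.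
  obtain ⟨M, hM⟩ : ∃ M : ℕ, ∀ k ≤ n, ∀ d, (f.iter k d).length ≤ M := by
    refine ⟨(Finset.range (n + 1) ×ˢ (Finset.univ : Finset (E × Bool))).sup
      fun p => (f.iter p.1 p.2).length, fun k hk d => ?_⟩
    exact Finset.le_sup (f := fun p : ℕ × (E × Bool) => (f.iter p.1 p.2).length)
      (b := (k, d)) (by simp; omega)
  refine ⟨2 * ((2 + a) * M) + 2 * C, by positivity, ?_⟩
  have hshort : ∀ w : List (E × Bool), w.length ≤ M → |δ w| ≤ (2 + a) * M := fun w hw =>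
    (htriv w).trans (mul_le_mul_of_nonneg_left (by exact_mod_cast hw) (by positivity))
  have hMa : 0 ≤ (2 + a) * M := by positivity
  rintro w ⟨k, d, hw⟩
  change |δ w| ≤ _
  rcases le_total k n with hk | hk
  · have h1 := hshort w (hw.length_le.trans (hM k hk d))
    have h2 : 0 ≤ ε * w.length := by positivity
    linarith
  · obtain ⟨m, rfl⟩ := Nat.exists_eq_add_of_le hk
    rw [iter_add] at hw
    obtain ⟨s, l, p, rfl, hs, hp⟩ :=
      List.exists_eq_append_flatMap_append_of_isInfix (hM n le_rfl) hw
    have h1 := hadd s (l.flatMap (f.iter n) ++ p)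
    have h2 := hadd (l.flatMap (f.iter n)) p
    have h3 := hblocks l
    have h4 := hshort s hs
    have h5 := hshort p hp
    have h6 : ε * ((l.flatMap (f.iter n)).length : ℝ) ≤
        ε * (s ++ (l.flatMap (f.iter n) ++ p)).length := by
      refine mul_le_mul_of_nonneg_left ?_ hε.le
      simp only [List.length_append, Nat.cast_add]
      have : (0 : ℝ) ≤ s.length := by positivity
      have : (0 : ℝ) ≤ p.length := by positivity
      linarith
    linarith

end GraphMap

/-! ## Sums over words and shift-invariant weights -/

section WordSum

variable {B M : Type*} [Fintype B] [AddCommMonoid M]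

/-- The sum of `F` over all words of length `n`. -/
def wordSum : ℕ → (List B → M) → M
  | 0, F => F []
  | n + 1, F => ∑ x, wordSum n fun w => F (x :: w)

theorem wordSum_congr {n : ℕ} {F G : List B → M} (h : ∀ w, w.length = n → F w = G w) :
    wordSum n F = wordSum n G := by
  induction n generalizing F G with
  | zero => exact h [] rfl
  | succ n ih => exact Finset.sum_congr rfl fun x _ => ih fun w hw => h _ (by simp [hw])

theorem wordSum_zero (n : ℕ) : wordSum n (fun _ : List B => (0 : M)) = 0 := by
  induction n with
  | zero => rfl
  | succ n ih => simp [wordSum, ih]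

theorem wordSum_add (n : ℕ) (F G : List B → M) :
    wordSum n (fun w => F w + G w) = wordSum n F + wordSum n G := by
  induction n generalizing F G with
  | zero => rfl
  | succ n ih => simp only [wordSum, ih, Finset.sum_add_distrib]

theorem wordSum_prefix [DecidableEq B] (v : List B) (j : ℕ) (F : List B → M) :
    wordSum (v.length + j) (fun w => if v <+: w then F w else 0) =
      wordSum j fun w => F (v ++ w) := by
  induction v generalizing F with
  | nil => simp
  | cons a v ih =>
    have : (a :: v).length + j = (v.length + j) + 1 := by simp; omega
    rw [this, wordSum, Finset.sum_eq_single a]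
    · simp only [List.cons_prefix_cons, true_and, List.cons_append]
      exact ih fun w => F (a :: w)
    · intro b _ hb
      simp only [List.cons_prefix_cons, Ne.symm hb, false_and, if_false]
      exact wordSum_zero _
    · simp

theorem wordSum_append {m : List B → M} (hm : ∀ v, v ≠ [] → ∑ d, m (v ++ [d]) = m v)
    {v : List B} (hv : v ≠ []) (n : ℕ) : wordSum n (fun w => m (v ++ w)) = m v := by
  induction n generalizing v with
  | zero => simp [wordSum]
  | succ n ih =>
    rw [wordSum, ← hm v hv]
    refine Finset.sum_congr rfl fun x _ => ?_
    rw [← ih (v := v ++ [x]) (by simp)]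
    simp

theorem wordSum_eq_apply_nil {F : List B → M} (hF : ∀ v, ∑ d, F (v ++ [d]) = F v) (n : ℕ) :
    wordSum n F = F [] := by
  induction n generalizing F with
  | zero => rfl
  | succ n ih =>
    rw [wordSum, ← hF []]
    exact Finset.sum_congr rfl fun x _ => ih fun v => hF (x :: v)

theorem map_wordSum {M' : Type*} [AddCommMonoid M'] (φ : M →+ M') (n : ℕ) (F : List B → M) :
    φ (wordSum n F) = wordSum n fun w => φ (F w) := by
  induction n generalizing F with
  | zero => rfl
  | succ n ih => simp only [wordSum, map_sum, ih]

theorem wordSum_mono {M : Type*} [AddCommMonoid M] [PartialOrder M] [IsOrderedAddMonoid M] {n : ℕ}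
    {F G : List B → M} (h : ∀ w, w.length = n → F w ≤ G w) :
    wordSum n F ≤ wordSum n G := by
  induction n generalizing F G with
  | zero => exact h [] rfl
  | succ n ih => exact Finset.sum_le_sum fun x _ => ih fun w hw => h _ (by simp [hw])

theorem wordSum_mul_const (n : ℕ) (F : List B → ℝ) (c : ℝ) :
    wordSum n (fun w => F w * c) = wordSum n F * c :=
  (map_wordSum (AddMonoidHom.mulRight c) n F).symm

/-- A word of this length offers `j` starting positions for `v`, and each contributes `m v` on
average. In the induction the first position is evaluated by the right rule, and the left rule moves
the other positions into words shorter by one letter. -/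
theorem wordSum_mul_occForward [DecidableEq B] {m : List B → ℝ}
    (hr : ∀ v, v ≠ [] → ∑ d, m (v ++ [d]) = m v) (hl : ∀ v, v ≠ [] → ∑ d, m (d :: v) = m v)
    {v : List B} (hv : v ≠ []) (j : ℕ) :
    wordSum (v.length - 1 + j) (fun w => m w * occForward v w) = j * m v := by
  have hlen : 0 < v.length := List.length_pos_iff.2 hv
  induction j with
  | zero =>
    rw [Nat.cast_zero, zero_mul, ← wordSum_zero (B := B) (M := ℝ) (v.length - 1 + 0)]
    refine wordSum_congr fun w hw => ?_
    have : occForward v w = 0 := by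
      by_contra h
      have := (isInfix_of_occForward_pos hv (Nat.pos_of_ne_zero h)).length_le
      omega
    simp [this]
  | succ j ih =>
    set l := v.length - 1 + j
    have h1 : ∀ w : List B, m w * occForward v w = m w * occForward v w.tail +
        if v <+: w then m w else 0 := by
      intro w
      cases w with
      | nil => simp [occForward_nil hv, hv]
      | cons x w =>
        rw [occForward_cons]
        split_ifs <;> simp [mul_add]
    have h2 : wordSum (l + 1) (fun w => m w * occForward v w.tail) = j * m v := by
      rw [← ih]
      have : ∀ (n : ℕ) (F : B → List B → ℝ),
          ∑ x, wordSum n (fun w => F x w) = wordSum n fun w => ∑ x, F x w := by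
        intro n
        induction n with
        | zero => intro F; rfl
        | succ n ihn =>
          intro F
          simp only [wordSum]
          rw [Finset.sum_comm]
          exact Finset.sum_congr rfl fun y _ => ihn fun x w => F x (y :: w)
      rw [wordSum]
      simp only [List.tail_cons]
      rw [this]
      refine wordSum_congr fun w _ => ?_
      rw [← Finset.sum_mul]
      -- The left rule is not assumed for the empty word, but there the count vanishes.
      by_cases hw : w = []
      · simp [hw, occForward_nil hv]
      · rw [hl w hw]
    have h3 : wordSum (l + 1) (fun w => if v <+: w then m w else 0) = m v := by
      have : l + 1 = v.length + j := by omega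
      rw [this, wordSum_prefix, wordSum_append hr hv]
    rw [← add_assoc, wordSum_congr fun w _ => h1 w, wordSum_add, h2, h3]
    push_cast
    ring

end WordSum

/-! ### Rigidity of invariant weights on the language -/

namespace GraphMap

variable {V E : Type*} {Γ : EdgeGraph V E} {f : GraphMap Γ} [DecidableEq E] [Fintype E] [Nonempty E]
  (hm : f.IsMixing) (he : f.IsExpanding) (hne : ∀ n d, f.iter n d ≠ [])

include hm he hne

/-- Invariant weights which live on the language are proportional to the frequencies. -/
theorem weight_eq_frequency {m : List (E × Bool) → ℝ} (h0 : ∀ v, 0 ≤ m v)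
    (hr : ∀ v, v ≠ [] → ∑ d, m (v ++ [d]) = m v) (hl : ∀ v, v ≠ [] → ∑ d, m (d :: v) = m v)
    (hi : ∀ v, v ≠ [] → m (FreeGroup.invRev v) = m v)
    (hL : ∀ v, v ≠ [] → m v ≠ 0 → v ∈ f.language)
    {v : List (E × Bool)} (hv : v ≠ []) : 2 * m v = f.frequency v * ∑ d : E × Bool, m [d] := by
  set T := ∑ d : E × Bool, m [d] with hT
  set a := f.frequency v
  set q := v.length - 1 with hq
  have hT0 : 0 ≤ T := Finset.sum_nonneg fun d _ => h0 _
  have htotal : ∀ l, wordSum (l + 1) m = T := by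
    intro l
    exact Finset.sum_congr rfl fun x _ => wordSum_append hr (v := [x]) (by simp) l
  have hcount : ∀ l, wordSum (q + l) (fun w => m w * occ v w) = l * (2 * m v) := by
    intro l
    have h1 := wordSum_mul_occForward hr hl hv l
    have h2 := wordSum_mul_occForward hr hl (invRev_ne_nil hv) l
    rw [FreeGroup.invRev_length, hi v hv] at h2
    have : ∀ w : List (E × Bool), m w * (occ v w : ℝ) =
        m w * occForward v w + m w * occForward (FreeGroup.invRev v) w := by
      intro w
      simp only [occ, Nat.cast_add, mul_add]
    rw [wordSum_congr fun w _ => this w, wordSum_add, h1, h2]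
    ring
  have key : ∀ ε : ℝ, 0 < ε → |2 * m v - a * T| ≤ ε * T := by
    intro ε hε
    obtain ⟨K, hK0, hK⟩ := abs_occ_sub_frequency_le hm he hne hv hε
    -- The averaged count over words of length `q + (j + 1)` is compared with `a` times that length.
    -- The last summand does not depend on `j`, so it disappears after division by `j + 1`.
    have hj : ∀ j : ℕ, (j + 1 : ℝ) * |2 * m v - a * T| ≤
        (j + 1) * (ε * T) + ((ε * q + K) * T + a * q * T) := by
      intro j
      set l := q + (j + 1) with hl
      have hb : ∀ w : List (E × Bool), w.length = l →
          |m w * occ v w - m w * (a * l)| ≤ m w * (ε * l + K) := by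
        intro w hw
        rw [← mul_sub, abs_mul, abs_of_nonneg (h0 w)]
        -- Words without weight do not matter; all others lie in the language, where the uniform
        -- estimate applies.
        by_cases hw0 : m w = 0
        · simp [hw0]
        · have hwne : w ≠ [] := by
            rintro rfl
            simp at hw
          have := hK w (hL w hwne hw0)
          rw [hw] at this
          exact mul_le_mul_of_nonneg_left this (h0 w)
      have hTl : wordSum l m = T := htotal (q + j)
      have hc := hcount (j + 1)
      have e1 : wordSum l (fun w => m w * (a * l)) = T * (a * l) := by
        rw [wordSum_mul_const, hTl]
      have e2 : wordSum l (fun w => m w * (ε * l + K)) = T * (ε * l + K) := by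
        rw [wordSum_mul_const, hTl]
      have b1 : wordSum l (fun w => m w * occ v w) ≤ T * (a * l) + T * (ε * l + K) := by
        rw [← e1, ← e2, ← wordSum_add]
        exact wordSum_mono fun w hw => by linarith [(abs_le.1 (hb w hw)).2]
      have b2 : T * (a * l) ≤ wordSum l (fun w => m w * occ v w) + T * (ε * l + K) := by
        rw [← e1, ← e2, ← wordSum_add]
        exact wordSum_mono fun w hw => by linarith [(abs_le.1 (hb w hw)).1]
      rw [hc] at b1 b2
      have hlr : (l : ℝ) = q + (j + 1) := by rw [hl]; push_cast; ring
      have ha0 : 0 ≤ a := frequency_nonneg hm he hne hv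
      have haq : 0 ≤ a * q * T := by positivity
      have hj1 : (0 : ℝ) ≤ j + 1 := by positivity
      rw [← abs_of_nonneg hj1, ← abs_mul, abs_of_nonneg hj1, abs_le]
      rw [hlr] at b1 b2
      push_cast at b1 b2
      constructor <;> linarith
    by_contra hcon
    push Not at hcon
    obtain ⟨j, hj'⟩ := exists_nat_gt
      (((ε * q + K) * T + a * q * T) / (|2 * m v - a * T| - ε * T))
    rw [div_lt_iff₀ (sub_pos.2 hcon)] at hj'
    have := hj j
    linarith
  have : |2 * m v - a * T| ≤ 0 := by
    by_contra hcon
    push Not at hcon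
    -- The denominator has `T + 1` instead of `T` to include the case of total weight zero.
    have h1 := key (|2 * m v - a * T| / (2 * (T + 1))) (by positivity)
    have h2 : |2 * m v - a * T| / (2 * (T + 1)) * T < |2 * m v - a * T| := by
      rw [div_mul_eq_mul_div, div_lt_iff₀ (by positivity)]
      nlinarith
    linarith
  exact sub_eq_zero.1 (abs_nonpos_iff.1 this)

end GraphMap

/-! ## Residual finiteness of free groups, and self-maps of free factors -/

/-- The relation is a bijection between two subsets of a finite set, so their complements have the
same size and it extends. -/
theorem exists_perm_of_partial_injection {X : Type*} [Finite X] (R : X → X → Prop)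
    (h1 : ∀ x y y', R x y → R x y' → y = y') (h2 : ∀ x x' y, R x y → R x' y → x = x') :
    ∃ σ : Equiv.Perm X, ∀ x y, R x y → σ x = y := by
  classical
  have := Fintype.ofFinite X
  choose g hg using fun x : {x // ∃ y, R x y} => x.2
  have hbij : Function.Bijective
      (fun x : {x // ∃ y, R x y} => (⟨g x, x.1, hg x⟩ : {y // ∃ x, R x y})) := by
    constructor
    · intro x x' h
      have : g x = g x' := congrArg Subtype.val h
      exact Subtype.ext (h2 _ _ _ (hg x) (this ▸ hg x'))
    · rintro ⟨y, x, hxy⟩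
      exact ⟨⟨x, y, hxy⟩, Subtype.ext (h1 _ _ _ (hg _) hxy)⟩
  refine ⟨(Equiv.ofBijective _ hbij).extendSubtype, fun x y hxy => ?_⟩
  rw [Equiv.extendSubtype_apply_of_mem _ x ⟨y, hxy⟩]
  exact h1 _ _ _ (hg ⟨x, y, hxy⟩) hxy

/-- Let the letters of the reduced word act as steps on `0, …, n`, the letter at position `i` moving
`i + 1` to `i`. By reducedness the steps asked of one generator form a partial injection. Extended
to permutations, they give an action in which `g` moves the last point to `0`. -/
theorem FreeGroup.exists_finite_hom_ne_one {A : Type*} {g : FreeGroup A} (hg : g ≠ 1) :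
    ∃ (n : ℕ) (ρ : FreeGroup A →* Equiv.Perm (Fin n)), ρ g ≠ 1 := by
  classical
  set w := g.toWord with hw
  have hred : FreeGroup.IsReduced w := FreeGroup.isReduced_toWord
  have hadj : ∀ (i : ℕ) (hi : i + 1 < w.length), w[i].1 = w[i + 1].1 → w[i].2 = w[i + 1].2 :=
    fun i hi => List.isChain_iff_getElem.1 hred i hi
  have hnil : w ≠ [] := fun h => hg (FreeGroup.toWord_eq_nil_iff.1 h)
  set n := w.length with hn
  let R : A → Fin (n + 1) → Fin (n + 1) → Prop := fun a x y =>
    (∃ h : (y : ℕ) < w.length, (x : ℕ) = y + 1 ∧ w[(y : ℕ)] = (a, true)) ∨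
    (∃ h : (x : ℕ) < w.length, (y : ℕ) = x + 1 ∧ w[(x : ℕ)] = (a, false))
  have hσ : ∀ a, ∃ σ : Equiv.Perm (Fin (n + 1)), ∀ x y, R a x y → σ x = y := by
    intro a
    -- Neighbouring letters of the same generator have the same sign, so no generator has to move a
    -- point to both of its neighbours, or both neighbours to one point.
    have conflict : ∀ (i j : ℕ) (hi : i < w.length) (hj : j < w.length), i = j + 1 →
        w[i].1 = w[j].1 → w[i].2 = w[j].2 := by
      rintro i j hi hj rfl h
      exact (hadj j hi h.symm).symm
    apply exists_perm_of_partial_injection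
    · rintro x y y' (⟨h, e, hw1⟩ | ⟨h, e, hw1⟩) (⟨h', e', hw1'⟩ | ⟨h', e', hw1'⟩)
      · exact Fin.ext (by omega)
      · have := conflict x y h' h e (by rw [hw1', hw1])
        rw [hw1, hw1'] at this
        simp at this
      · have := conflict x y' h h' e' (by rw [hw1', hw1])
        rw [hw1, hw1'] at this
        simp at this
      · exact Fin.ext (by omega)
    · rintro x x' y (⟨h, e, hw1⟩ | ⟨h, e, hw1⟩) (⟨h', e', hw1'⟩ | ⟨h', e', hw1'⟩)
      · exact Fin.ext (by omega)
      · have := conflict y x' h h' e' (by rw [hw1', hw1])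
        rw [hw1, hw1'] at this
        simp at this
      · have := conflict y x h' h e (by rw [hw1', hw1])
        rw [hw1, hw1'] at this
        simp at this
      · exact Fin.ext (by omega)
  choose σ hσ using hσ
  refine ⟨n + 1, FreeGroup.lift σ, fun h => ?_⟩
  have hlift : ∀ (i : ℕ) (hi : i < w.length),
      FreeGroup.lift σ (FreeGroup.mk [w[i]]) ⟨i + 1, by omega⟩ = ⟨i, by omega⟩ := by
    intro i hi
    obtain ⟨⟨a, b⟩, hd⟩ : ∃ d, w[i] = d := ⟨_, rfl⟩
    rw [hd]
    cases b
    · have : FreeGroup.mk [(a, false)] = (FreeGroup.of a)⁻¹ := rfl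
      rw [this, _root_.map_inv, FreeGroup.lift_apply_of, Equiv.Perm.inv_eq_iff_eq]
      exact (hσ a ⟨i, by omega⟩ ⟨i + 1, by omega⟩ (Or.inr ⟨hi, rfl, hd⟩)).symm
    · have : FreeGroup.mk [(a, true)] = FreeGroup.of a := rfl
      rw [this, FreeGroup.lift_apply_of]
      exact hσ a ⟨i + 1, by omega⟩ ⟨i, by omega⟩ (Or.inl ⟨hi, rfl, hd⟩)
  have hdrop : ∀ k, (hk : k ≤ n) → FreeGroup.lift σ (FreeGroup.mk (w.drop (n - k))) (Fin.last n) =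
      ⟨n - k, by omega⟩ := by
    intro k
    induction k with
    | zero =>
      intro _
      have : FreeGroup.mk (w.drop (n - 0)) = 1 := by simp [hn, FreeGroup.one_eq_mk]
      rw [this, _root_.map_one]
      rfl
    | succ k ih =>
      intro hk
      have hi : n - (k + 1) < w.length := by omega
      rw [List.drop_eq_getElem_cons hi]
      have : FreeGroup.mk (w[n - (k + 1)] :: w.drop (n - (k + 1) + 1)) =
          FreeGroup.mk [w[n - (k + 1)]] * FreeGroup.mk (w.drop (n - (k + 1) + 1)) := by
        rw [FreeGroup.mul_mk]; rfl
      have e : n - (k + 1) + 1 = n - k := by omega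
      rw [this, _root_.map_mul, Equiv.Perm.mul_apply, e, ih (by omega), ← hlift _ hi]
      congr 1
      exact Fin.ext e.symm
  have h1 := hdrop n le_rfl
  simp only [Nat.sub_self, List.drop_zero] at h1
  rw [hw, FreeGroup.mk_toWord, h] at h1
  have h2 := congrArg Fin.val h1
  simp only [Equiv.Perm.coe_one, id_eq, Fin.val_last] at h2
  have : 0 < n := List.length_pos_iff.2 hnil
  omega

theorem Group.FG.finite_monoidHom {G Q : Type*} [Group G] [Group Q] [Group.FG G] [Finite Q] :
    Finite (G →* Q) := by
  obtain ⟨S, hS⟩ := Group.fg_def.1 (inferInstance : Group.FG G)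
  have : Function.Injective (fun (ρ : G →* Q) (s : S) => ρ s) := by
    intro ρ ρ' h
    refine MonoidHom.eq_of_eqOn_dense hS fun x hx => ?_
    exact congrFun h ⟨x, hx⟩
  exact Finite.of_injective _ this

/-- Finitely generated residually finite groups are Hopfian. -/
theorem MonoidHom.injective_of_surjective_of_residuallyFinite {G : Type*} [Group G] [Group.FG G]
    (hG : ∀ g : G, g ≠ 1 → ∃ (n : ℕ) (ρ : G →* Equiv.Perm (Fin n)), ρ g ≠ 1) {ψ : G →* G}
    (hψ : Function.Surjective ψ) : Function.Injective ψ := by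
  rw [injective_iff_map_eq_one]
  intro g hg
  by_contra hne
  obtain ⟨n, ρ, hρ⟩ := hG g hne
  have := Group.FG.finite_monoidHom (G := G) (Q := Equiv.Perm (Fin n))
  -- Precomposition with `ψ` is an injective self-map of a finite set of homomorphisms, hence onto;
  -- so `ρ` factors through `ψ` and cannot detect `g`.
  have hinj : Function.Injective (fun ρ : G →* Equiv.Perm (Fin n) => ρ.comp ψ) :=
    fun ρ ρ' h => (MonoidHom.cancel_right hψ).1 h
  obtain ⟨ρ', rfl⟩ := Finite.surjective_of_injective hinj ρ
  exact hρ (by simp [hg])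

theorem IsFreeFactor.exists_retraction {G : Type*} [Group G] {H : Subgroup G}
    (h : IsFreeFactor H) : ∃ r : G →* H, ∀ x : H, r x = x := by
  obtain ⟨K, hK⟩ := h
  let e := MulEquiv.ofBijective (Monoid.Coprod.lift H.subtype K.subtype) hK
  refine ⟨(Monoid.Coprod.lift (MonoidHom.id H) (1 : K →* H)).comp e.symm.toMonoidHom, fun x => ?_⟩
  have : e.symm (x : G) = Monoid.Coprod.inl x := by
    rw [MulEquiv.symm_apply_eq]
    simp [e]
  simp [this]

/-- The retraction shows that `H` is finitely generated and, composed with the inverse of `Ψ`, gives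
a left inverse `θ` of the restriction of `Ψ` to `H`. As a surjective endomorphism of `H`, `θ` is
injective by the Hopf property, so the restriction of `Ψ` is onto `H`. -/
theorem IsFreeFactor.map_eq_of_map_le {G : Type*} [Group G] [Group.FG G]
    (hG : ∀ g : G, g ≠ 1 → ∃ (n : ℕ) (ρ : G →* Equiv.Perm (Fin n)), ρ g ≠ 1) {H : Subgroup G}
    (h : IsFreeFactor H) (Ψ : MulAut G) (hle : H.map Ψ.toMonoidHom ≤ H) :
    H.map Ψ.toMonoidHom = H := by
  obtain ⟨r, hr⟩ := h.exists_retraction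
  have hrs : Function.Surjective r := fun x => ⟨x, hr x⟩
  have : Group.FG H := Group.fg_of_surjective hrs
  have hΨ : ∀ x : H, Ψ x ∈ H := fun x => hle ⟨x, x.2, rfl⟩
  let θ : H →* H := r.comp (Ψ.symm.toMonoidHom.comp H.subtype)
  have hθ : ∀ x : H, θ ⟨Ψ x, hΨ x⟩ = x := by
    intro x
    have : Ψ.symm (Ψ (x : G)) = x := Ψ.symm_apply_apply _
    simp [θ, this, hr]
  have hθi : Function.Injective θ := by
    refine MonoidHom.injective_of_surjective_of_residuallyFinite (fun g hg => ?_)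
      fun x => ⟨_, hθ x⟩
    obtain ⟨n, ρ, hρ⟩ := hG g (by simpa using hg)
    exact ⟨n, ρ.comp H.subtype, hρ⟩
  refine le_antisymm hle fun x hx => ?_
  have h1 : (⟨Ψ (θ ⟨x, hx⟩), hΨ _⟩ : H) = ⟨x, hx⟩ := hθi (hθ _)
  exact ⟨θ ⟨x, hx⟩, (θ ⟨x, hx⟩).2, congrArg Subtype.val h1⟩

theorem isFreeFactor_of_leftInverse {G : Type*} [Group G] {H K : Subgroup G}
    (τ : G →* Monoid.Coprod H K) (hH : ∀ x : H, τ x = Monoid.Coprod.inl x)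
    (hK : ∀ x : K, τ x = Monoid.Coprod.inr x)
    (hτ : ∀ g, Monoid.Coprod.lift H.subtype K.subtype (τ g) = g) : IsFreeFactor H := by
  refine ⟨K, ?_, fun g => ⟨τ g, hτ g⟩⟩
  have : τ.comp (Monoid.Coprod.lift H.subtype K.subtype) = MonoidHom.id _ := by
    apply Monoid.Coprod.hom_ext
    · ext x; simp [hH]
    · ext x; simp [hK]
  exact Function.LeftInverse.injective (g := τ) fun x => DFunLike.congr_fun this x

/-! ## Connected subgraphs carry free factors -/

namespace EdgeGraph

variable {V E : Type*} {Γ : EdgeGraph V E}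

theorem IsPathClass.refl (x : V) : Γ.IsPathClass x 1 x := ⟨[], rfl, rfl⟩

theorem IsPathClass.mul {x y z : V} {c c' : FreeGroup E} (h : Γ.IsPathClass x c y)
    (h' : Γ.IsPathClass y c' z) : Γ.IsPathClass x (c * c') z := by
  obtain ⟨w, hw, rfl⟩ := h
  obtain ⟨w', hw', rfl⟩ := h'
  exact ⟨w ++ w', Γ.isPath_append hw hw', by rw [FreeGroup.mul_mk]⟩

theorem IsPathClass.inv {x y : V} {c : FreeGroup E} (h : Γ.IsPathClass x c y) :
    Γ.IsPathClass y c⁻¹ x := by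
  obtain ⟨w, hw, rfl⟩ := h
  exact ⟨_, Γ.isPath_invRev hw, by rw [FreeGroup.inv_mk]⟩

theorem isPathClass_letter (d : E × Bool) :
    Γ.IsPathClass (Γ.init d) (FreeGroup.mk [d]) (Γ.term d) := ⟨[d], ⟨rfl, rfl⟩, rfl⟩

/-- `c` is the class of an edge-path from `x` to `y` with all edges in `S`. -/
def IsClassIn (Γ : EdgeGraph V E) (S : Set E) (x : V) (c : FreeGroup E) (y : V) : Prop :=
  ∃ w, Γ.IsPath x w y ∧ (∀ d ∈ w, d.1 ∈ S) ∧ FreeGroup.mk w = c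

variable {S : Set E}

theorem IsClassIn.isPathClass {x y : V} {c : FreeGroup E} (h : Γ.IsClassIn S x c y) :
    Γ.IsPathClass x c y := by
  obtain ⟨w, hw, -, rfl⟩ := h
  exact ⟨w, hw, rfl⟩

theorem isClassIn_univ {x y : V} {c : FreeGroup E} :
    Γ.IsClassIn Set.univ x c y ↔ Γ.IsPathClass x c y := by
  simp [IsClassIn, IsPathClass]

theorem IsClassIn.refl (x : V) : Γ.IsClassIn S x 1 x := ⟨[], rfl, by simp, rfl⟩

theorem IsClassIn.mul {x y z : V} {c c' : FreeGroup E} (h : Γ.IsClassIn S x c y)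
    (h' : Γ.IsClassIn S y c' z) : Γ.IsClassIn S x (c * c') z := by
  obtain ⟨w, hw, hS, rfl⟩ := h
  obtain ⟨w', hw', hS', rfl⟩ := h'
  refine ⟨w ++ w', Γ.isPath_append hw hw', fun d hd => ?_, by rw [FreeGroup.mul_mk]⟩
  rcases List.mem_append.1 hd with hd | hd
  · exact hS d hd
  · exact hS' d hd

theorem fst_mem_of_mem_invRev {w : List (E × Bool)} (h : ∀ d ∈ w, d.1 ∈ S) :
    ∀ d ∈ FreeGroup.invRev w, d.1 ∈ S := by
  intro d hd
  simp only [FreeGroup.invRev, List.mem_reverse, List.mem_map] at hd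
  obtain ⟨d', hd', rfl⟩ := hd
  exact h d' hd'

theorem IsClassIn.inv {x y : V} {c : FreeGroup E} (h : Γ.IsClassIn S x c y) :
    Γ.IsClassIn S y c⁻¹ x := by
  obtain ⟨w, hw, hS, rfl⟩ := h
  exact ⟨_, Γ.isPath_invRev hw, fst_mem_of_mem_invRev hS, by rw [FreeGroup.inv_mk]⟩

theorem isClassIn_letter {d : E × Bool} (hd : d.1 ∈ S) :
    Γ.IsClassIn S (Γ.init d) (FreeGroup.mk [d]) (Γ.term d) :=
  ⟨[d], ⟨rfl, rfl⟩, by simpa using hd, rfl⟩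

/-- A tree of edge-paths from `x` to the vertices in `R`, with edges in `S`. -/
structure IsPartialTree (Γ : EdgeGraph V E) (x : V) (S : Set E) (R : Set V)
    (t : V → FreeGroup E) : Prop where
  mem : x ∈ R
  root : t x = 1
  isClassIn : ∀ y ∈ R, Γ.IsClassIn S x (t y) y
  mem_closure : ∀ y ∈ R, t y ∈ Subgroup.closure {g | ∃ e, g = FreeGroup.of e ∧
    Γ.src e ∈ R ∧ Γ.tgt e ∈ R ∧ t (Γ.src e) * FreeGroup.of e * (t (Γ.tgt e))⁻¹ = 1}

/-- The new vertex gets the old path followed by `d`, which makes the loop of the edge of `d`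
trivial. Tree edges are thus recorded as the edges with trivial loop, and no separate edge set is
needed. -/
theorem IsPartialTree.exists_insert {x : V} {R : Set V} {t : V → FreeGroup E}
    (h : Γ.IsPartialTree x S R t) {d : E × Bool} (hd : d.1 ∈ S) (hi : Γ.init d ∈ R)
    (ht : Γ.term d ∉ R) :
    ∃ t', (∀ y ∈ R, t' y = t y) ∧ Γ.IsPartialTree x S (insert (Γ.term d) R) t' := by
  classical
  have hne : ∀ y ∈ R, y ≠ Γ.term d := fun y hy h => ht (h ▸ hy)
  set t' := Function.update t (Γ.term d) (t (Γ.init d) * FreeGroup.mk [d]) with ht'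
  have hold : ∀ y ∈ R, t' y = t y := fun y hy => Function.update_of_ne (hne y hy) _ _
  have hnew : t' (Γ.term d) = t (Γ.init d) * FreeGroup.mk [d] := Function.update_self ..
  refine ⟨t', hold, Set.mem_insert_of_mem _ h.mem, by rw [hold x h.mem, h.root], ?_, ?_⟩
  · rintro y (rfl | hy)
    · rw [hnew]
      exact (h.isClassIn _ hi).mul (isClassIn_letter hd)
    · rw [hold y hy]
      exact h.isClassIn y hy
  · have hsub : {g | ∃ e, g = FreeGroup.of e ∧
        Γ.src e ∈ R ∧ Γ.tgt e ∈ R ∧ t (Γ.src e) * FreeGroup.of e * (t (Γ.tgt e))⁻¹ = 1} ⊆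
        {g | ∃ e, g = FreeGroup.of e ∧ Γ.src e ∈ insert (Γ.term d) R ∧
          Γ.tgt e ∈ insert (Γ.term d) R ∧
          t' (Γ.src e) * FreeGroup.of e * (t' (Γ.tgt e))⁻¹ = 1} := by
      rintro _ ⟨e, rfl, h1, h2, h3⟩
      exact ⟨e, rfl, Or.inr h1, Or.inr h2, by rwa [hold _ h1, hold _ h2]⟩
    have hmem : ∀ y ∈ R, t y ∈ Subgroup.closure {g | ∃ e, g = FreeGroup.of e ∧
        Γ.src e ∈ insert (Γ.term d) R ∧ Γ.tgt e ∈ insert (Γ.term d) R ∧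
          t' (Γ.src e) * FreeGroup.of e * (t' (Γ.tgt e))⁻¹ = 1} := fun y hy =>
      Subgroup.closure_mono hsub (h.mem_closure y hy)
    rintro y (rfl | hy)
    · rw [hnew]
      refine mul_mem (hmem _ hi) ?_
      rcases d with ⟨e, b⟩
      cases b
      · have e1 : FreeGroup.mk [(e, false)] = (FreeGroup.of e)⁻¹ := rfl
        rw [e1]
        refine inv_mem (Subgroup.subset_closure ⟨e, rfl, Or.inl rfl, Or.inr hi, ?_⟩)
        have hs : t' (Γ.src e) = _ := hnew
        have htt : t' (Γ.tgt e) = _ := hold _ hi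
        rw [hs, htt, e1]
        simp [EdgeGraph.init]
      · have e1 : FreeGroup.mk [(e, true)] = FreeGroup.of e := rfl
        rw [e1]
        refine Subgroup.subset_closure ⟨e, rfl, Or.inr hi, Or.inl rfl, ?_⟩
        have hs : t' (Γ.tgt e) = _ := hnew
        have htt : t' (Γ.src e) = _ := hold _ hi
        rw [hs, htt, e1]
        simp [EdgeGraph.init]
    · rw [hold y hy]
      exact hmem y hy

theorem IsPartialTree.exists_closed [Finite V] {x : V} {R : Set V} {t : V → FreeGroup E}
    (h : Γ.IsPartialTree x S R t) :
    ∃ R' t', R ⊆ R' ∧ (∀ y ∈ R, t' y = t y) ∧ Γ.IsPartialTree x S R' t' ∧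
      ∀ d : E × Bool, d.1 ∈ S → Γ.init d ∈ R' → Γ.term d ∈ R' := by
  induction hn : (Rᶜ).ncard using Nat.strong_induction_on generalizing R t with
  | _ n ih =>
    subst hn
    by_cases hc : ∀ d : E × Bool, d.1 ∈ S → Γ.init d ∈ R → Γ.term d ∈ R
    · exact ⟨R, t, subset_rfl, fun _ _ => rfl, h, hc⟩
    · push Not at hc
      obtain ⟨d, hd, hi, ht⟩ := hc
      obtain ⟨t', h1, h2⟩ := h.exists_insert hd hi ht
      have hlt : ((insert (Γ.term d) R)ᶜ).ncard < (Rᶜ).ncard := by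
        refine Set.ncard_lt_ncard ⟨Set.compl_subset_compl.2 (Set.subset_insert _ _), fun h => ?_⟩
          (Set.toFinite _)
        exact h ht (Set.mem_insert _ _)
      obtain ⟨R', t'', h3, h4, h5, h6⟩ := ih _ hlt h2 rfl
      refine ⟨R', t'', (Set.subset_insert _ _).trans h3, fun y hy => ?_, h5, h6⟩
      rw [h4 y (Set.mem_insert_of_mem _ hy), h1 y hy]

theorem mem_of_isPath_of_closed {R : Set V}
    (hR : ∀ d : E × Bool, d.1 ∈ S → Γ.init d ∈ R → Γ.term d ∈ R) {x y : V}
    {w : List (E × Bool)} (h : Γ.IsPath x w y) (hS : ∀ d ∈ w, d.1 ∈ S) (hx : x ∈ R) : y ∈ R := by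
  induction w generalizing x with
  | nil => exact (show x = y from h) ▸ hx
  | cons d w ih =>
    refine ih h.2 (fun d' hd' => hS d' (List.mem_cons_of_mem _ hd')) ?_
    exact hR d (hS d List.mem_cons_self) (h.1 ▸ hx)

/-- A maximal tree that extends a maximal tree of the component of `x` in the subgraph `S`. -/
theorem IsConnected.exists_tree [Finite V] (hΓ : Γ.IsConnected) (x : V) (S : Set E) :
    ∃ t : V → FreeGroup E, t x = 1 ∧ (∀ y, Γ.IsPathClass x (t y) y) ∧
      (∀ y, (∃ c, Γ.IsClassIn S x c y) → Γ.IsClassIn S x (t y) y) ∧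
      ∀ y, t y ∈ Subgroup.closure {g | ∃ e, g = FreeGroup.of e ∧
        t (Γ.src e) * FreeGroup.of e * (t (Γ.tgt e))⁻¹ = 1} := by
  have h0 : Γ.IsPartialTree x S {x} fun _ => 1 :=
    ⟨rfl, rfl, by rintro y rfl; exact IsClassIn.refl _, fun _ _ => one_mem _⟩
  -- The tree is grown inside `S` first and over all edges afterwards. The second stage keeps the
  -- paths already chosen, so the vertices of the component in `S` retain paths in `S`.
  obtain ⟨R₁, t₁, hR₁, -, ht₁, hc₁⟩ := h0.exists_closed
  have h1 : Γ.IsPartialTree x Set.univ R₁ t₁ :=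
    ⟨ht₁.mem, ht₁.root, fun y hy => isClassIn_univ.2 (ht₁.isClassIn y hy).isPathClass,
      ht₁.mem_closure⟩
  obtain ⟨R₂, t₂, hR₂, heq, ht₂, hc₂⟩ := h1.exists_closed
  have huniv : ∀ y, y ∈ R₂ := by
    intro y
    obtain ⟨w, hw⟩ := hΓ x y
    exact mem_of_isPath_of_closed hc₂ hw (fun _ _ => Set.mem_univ _) ht₂.mem
  refine ⟨t₂, ht₂.root, fun y => (ht₂.isClassIn y (huniv y)).isPathClass, ?_, fun y => ?_⟩
  · rintro y ⟨_, w, hw, hwS, rfl⟩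
    have hy : y ∈ R₁ := mem_of_isPath_of_closed hc₁ hw hwS ht₁.mem
    rw [heq y hy]
    exact ht₁.isClassIn y hy
  · refine Subgroup.closure_mono ?_ (ht₂.mem_closure y (huniv y))
    rintro _ ⟨e, rfl, -, -, h⟩
    exact ⟨e, rfl, h⟩

end EdgeGraph

namespace Marking

variable {N : ℕ} {V E : Type*} {Γ : EdgeGraph V E} (α : Marking N Γ)

theorem isPathClass_hom (g : FreeGroup (Fin N)) : Γ.IsPathClass α.base (α.hom g) α.base := by
  have : α.hom g ∈ α.hom.range := ⟨g, rfl⟩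
  rw [α.range_eq] at this
  exact this

theorem exists_hom_eq {c : FreeGroup E} (h : Γ.IsPathClass α.base c α.base) :
    ∃ g, α.hom g = c := by
  have : c ∈ Γ.fundGroup α.base := h
  rw [← α.range_eq] at this
  exact this

/-- The subgroup carried by the part of the subgraph `S` that contains `x`, where `b` is a path from
the base vertex to `x`. -/
def subgraphGroup (S : Set E) (x : V) (b : FreeGroup E) : Subgroup (FreeGroup (Fin N)) where
  carrier := {g | Γ.IsClassIn S x (b⁻¹ * α.hom g * b) x}
  mul_mem' {g g'} h h' := by
    have := EdgeGraph.IsClassIn.mul h h'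
    simp only [Set.mem_ofPred_eq, map_mul]
    convert this using 1
    group
  one_mem' := by simpa using EdgeGraph.IsClassIn.refl x
  inv_mem' {g} h := by
    have := EdgeGraph.IsClassIn.inv h
    simp only [Set.mem_ofPred_eq, map_inv]
    convert this using 1
    group

theorem mem_subgraphGroup {S : Set E} {x : V} {b : FreeGroup E} {g : FreeGroup (Fin N)} :
    g ∈ α.subgraphGroup S x b ↔ Γ.IsClassIn S x (b⁻¹ * α.hom g * b) x := Iff.rfl

/-- Take a maximal tree that extends one of the part of `S` around `x`, and assign to each edge the
loop that follows the tree, crosses the edge and returns. The loops of edges in `S` lie in `H`, and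
the others generate a complement `K`. Sending each edge to its loop, in the factor where it belongs,
inverts the natural map from the free product to the group. By `hS` all of `S` is reachable from `x`
inside `S`. -/
theorem isFreeFactor_subgraphGroup [Finite V] (hΓ : Γ.IsConnected) {S : Set E} {x : V}
    {b : FreeGroup E} (hb : Γ.IsPathClass α.base b x)
    (hS : ∀ e ∈ S, ∃ c, Γ.IsClassIn S x c (Γ.src e)) : IsFreeFactor (α.subgraphGroup S x b) := by
  classical
  obtain ⟨t, htx, htp, htS, htc⟩ := hΓ.exists_tree x S
  let θ : FreeGroup (Fin N) →* FreeGroup E := (MulAut.conj b⁻¹).toMonoidHom.comp α.hom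
  have hθ : ∀ g, θ g = b⁻¹ * α.hom g * b := fun g => by simp [θ]
  have hθi : Function.Injective θ := (MulAut.conj b⁻¹).injective.comp α.injective
  have hθs : ∀ c, Γ.IsPathClass x c x → ∃ g, θ g = c := by
    intro c hc
    obtain ⟨g, hg⟩ := α.exists_hom_eq ((hb.mul hc).mul hb.inv)
    exact ⟨g, by rw [hθ, hg]; group⟩
  set s : E → FreeGroup E := fun e => t (Γ.src e) * FreeGroup.of e * (t (Γ.tgt e))⁻¹ with hs
  have hsp : ∀ e, Γ.IsPathClass x (s e) x := fun e =>
    ((htp _).mul (EdgeGraph.isPathClass_letter (e, true))).mul (htp _).inv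
  choose k hk using fun e => hθs (s e) (hsp e)
  set H := α.subgraphGroup S x b with hH
  set K := Subgroup.closure {g | ∃ e, e ∉ S ∧ g = k e} with hK
  have hkH : ∀ e, e ∈ S → k e ∈ H := by
    intro e he
    rw [hH, mem_subgraphGroup, ← hθ, hk]
    obtain ⟨c, hc⟩ := hS e he
    have h1 : Γ.IsClassIn S (Γ.src e) (FreeGroup.of e) (Γ.tgt e) :=
      EdgeGraph.isClassIn_letter (d := (e, true)) he
    exact ((htS _ ⟨c, hc⟩).mul h1).mul (htS _ ⟨_, hc.mul h1⟩).inv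
  have hkK : ∀ e, e ∉ S → k e ∈ K := fun e he => Subgroup.subset_closure ⟨e, he, rfl⟩
  let τ₀ : FreeGroup E →* Monoid.Coprod H K := FreeGroup.lift fun e =>
    if he : e ∈ S then Monoid.Coprod.inl ⟨k e, hkH e he⟩ else Monoid.Coprod.inr ⟨k e, hkK e he⟩
  have hτS : ∀ e (he : e ∈ S), τ₀ (FreeGroup.of e) = Monoid.Coprod.inl ⟨k e, hkH e he⟩ := by
    intro e he
    simp [τ₀, he]
  have hτK : ∀ e (he : e ∉ S), τ₀ (FreeGroup.of e) = Monoid.Coprod.inr ⟨k e, hkK e he⟩ := by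
    intro e he
    simp [τ₀, he]
  have hlift : ∀ e, Monoid.Coprod.lift H.subtype K.subtype (τ₀ (FreeGroup.of e)) = k e := by
    intro e
    by_cases he : e ∈ S
    · simp [hτS e he]
    · simp [hτK e he]
  have hσ : ∀ c, θ (Monoid.Coprod.lift H.subtype K.subtype (τ₀ c)) = FreeGroup.lift s c := by
    intro c
    have : (θ.comp (Monoid.Coprod.lift H.subtype K.subtype)).comp τ₀ = FreeGroup.lift s := by
      ext e
      simp [hlift, hk]
    exact DFunLike.congr_fun this c
  -- The tree paths between consecutive edges cancel, and only those at the two ends survive; for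
  -- loops at `x` these are trivial.
  have hσp : ∀ (w : List (E × Bool)) (y z : V), Γ.IsPath y w z →
      FreeGroup.lift s (FreeGroup.mk w) = t y * FreeGroup.mk w * (t z)⁻¹ := by
    intro w
    induction w with
    | nil =>
      intro y z h
      have : y = z := h
      rw [← FreeGroup.one_eq_mk, map_one, this]
      group
    | cons d w ih =>
      intro y z h
      have e1 : FreeGroup.mk (d :: w) = FreeGroup.mk [d] * FreeGroup.mk w := by
        rw [FreeGroup.mul_mk]; rfl
      have e2 : FreeGroup.lift s (FreeGroup.mk [d]) =
          t (Γ.init d) * FreeGroup.mk [d] * (t (Γ.term d))⁻¹ := by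
        rcases d with ⟨e, b⟩
        cases b
        · have : FreeGroup.mk [(e, false)] = (FreeGroup.of e)⁻¹ := rfl
          rw [this, map_inv, FreeGroup.lift_apply_of]
          simp [hs, EdgeGraph.init, EdgeGraph.term, mul_assoc]
        · have : FreeGroup.mk [(e, true)] = FreeGroup.of e := rfl
          rw [this, FreeGroup.lift_apply_of]
          simp [hs, EdgeGraph.init, EdgeGraph.term]
      rw [e1, map_mul, ih _ _ h.2, e2, h.1]
      group
  let τ : FreeGroup (Fin N) →* Monoid.Coprod H K := τ₀.comp θ
  have hτ : ∀ g, Monoid.Coprod.lift H.subtype K.subtype (τ g) = g := by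
    intro g
    apply hθi
    have hp : Γ.IsPathClass x (θ g) x := by
      rw [hθ]
      exact (hb.inv.mul (α.isPathClass_hom g)).mul hb
    obtain ⟨w, hw, hwg⟩ := hp
    change θ (Monoid.Coprod.lift H.subtype K.subtype (τ₀ (θ g))) = θ g
    rw [hσ, ← hwg, hσp w x x hw, htx]
    group
  -- Tree edges have trivial loops, so `τ₀` kills them and hence all tree paths.
  have hτt : ∀ y, τ₀ (t y) = 1 := by
    intro y
    have : Subgroup.closure {g | ∃ e, g = FreeGroup.of e ∧
        t (Γ.src e) * FreeGroup.of e * (t (Γ.tgt e))⁻¹ = 1} ≤ τ₀.ker := by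
      rw [Subgroup.closure_le]
      rintro _ ⟨e, rfl, he⟩
      have hke : k e = 1 := hθi (by rw [hk, map_one]; exact he)
      rw [SetLike.mem_coe, MonoidHom.mem_ker]
      by_cases heS : e ∈ S
      · rw [hτS e heS]
        simp only [hke]
        exact map_one Monoid.Coprod.inl
      · rw [hτK e heS]
        simp only [hke]
        exact map_one Monoid.Coprod.inr
    exact this (htc y)
  refine isFreeFactor_of_leftInverse τ (fun g => ?_) (fun g => ?_) hτ
  · obtain ⟨w, -, hwS, hwg⟩ := α.mem_subgraphGroup.1 g.2
    have hr : τ₀ (FreeGroup.mk w) ∈ (Monoid.Coprod.inl : H →* Monoid.Coprod H K).range := by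
      clear hwg
      induction w with
      | nil => exact one_mem _
      | cons d w ih =>
        have e1 : FreeGroup.mk (d :: w) = FreeGroup.mk [d] * FreeGroup.mk w := by
          rw [FreeGroup.mul_mk]; rfl
        rw [e1, map_mul]
        refine mul_mem ?_ (ih fun d' hd' => hwS d' (List.mem_cons_of_mem _ hd'))
        have hd := hwS d List.mem_cons_self
        rcases d with ⟨e, b⟩
        cases b
        · have : FreeGroup.mk [(e, false)] = (FreeGroup.of e)⁻¹ := rfl
          rw [this, map_inv, hτS e hd]
          exact inv_mem ⟨_, rfl⟩
        · have : FreeGroup.mk [(e, true)] = FreeGroup.of e := rfl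
          rw [this, hτS e hd]
          exact ⟨_, rfl⟩
    -- Once `τ g` is known to lie in the first factor, multiplying out shows that it is `g` itself.
    obtain ⟨h, hh⟩ := hr
    have e1 : τ g = Monoid.Coprod.inl h := by
      rw [hh, hwg, ← hθ]
      rfl
    have e2 := hτ g
    rw [e1, Monoid.Coprod.lift_apply_inl] at e2
    rw [e1, Subtype.ext e2.symm]
  · have hr : τ g ∈ (Monoid.Coprod.inr : K →* Monoid.Coprod H K).range := by
      have : K ≤ (Monoid.Coprod.inr : K →* Monoid.Coprod H K).range.comap τ := by
        refine (Subgroup.closure_le _).2 ?_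
        rintro _ ⟨e, he, rfl⟩
        refine ⟨⟨k e, hkK e he⟩, ?_⟩
        change _ = τ₀ (θ (k e))
        rw [hk, hs]
        simp only [map_mul, map_inv, hτt, hτK e he]
        simp
      exact this g.2
    obtain ⟨h, hh⟩ := hr
    have e2 := hτ g
    rw [← hh, Monoid.Coprod.lift_apply_inr] at e2
    rw [← hh, Subtype.ext e2.symm]

end Marking

/-! ## Expansion and mixing of irreducible train tracks -/

namespace GraphMap

variable {V E : Type*} {Γ : EdgeGraph V E} (f : GraphMap Γ)

/-- The edges that occur in `fⁿ(e)`. -/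
def edges (n : ℕ) (e : E) : List E := (f.iter n (e, true)).map Prod.fst

theorem map_fst_iter (n : ℕ) (d : E × Bool) (e : E) :
    e ∈ (f.iter n d).map Prod.fst ↔ e ∈ f.edges n d.1 := by
  rcases d with ⟨e', b⟩
  cases b
  · rw [iter_false, edges]
    simp [FreeGroup.invRev]
  · rfl

theorem mem_edges_add {n m : ℕ} {e e'' : E} :
    e'' ∈ f.edges (n + m) e ↔ ∃ e' ∈ f.edges m e, e'' ∈ f.edges n e' := by
  have key : ∀ w : List (E × Bool), e'' ∈ (w.flatMap (f.iter n)).map Prod.fst ↔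
      ∃ e' ∈ w.map Prod.fst, e'' ∈ f.edges n e' := by
    intro w
    induction w with
    | nil => simp
    | cons d w ih =>
      rw [List.flatMap_cons, List.map_append, List.mem_append, ih, map_fst_iter, List.map_cons]
      simp only [List.mem_cons, exists_eq_or_imp]
  rw [edges, iter_add]
  exact key _

theorem mem_edges_trans {n m : ℕ} {e e' e'' : E} (h : e' ∈ f.edges m e) (h' : e'' ∈ f.edges n e') :
    e'' ∈ f.edges (n + m) e := (f.mem_edges_add).2 ⟨e', h, h'⟩

theorem mem_edges_zero (e : E) : e ∈ f.edges 0 e := by simp [edges, iter]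

theorem iter_one (d : E × Bool) : f.iter 1 d = f.onOriented d := by
  simp [iter, onPath]

theorem iter_succ_eq_flatMap (n : ℕ) (d : E × Bool) :
    f.iter (n + 1) d = (f.iter n d).flatMap f.onOriented := by
  rw [add_comm, iter_add]
  congr 1
  funext d
  exact f.iter_one d

variable {f}

/-- Since the entries are nonnegative, the entry `(i, j)` of the `k`-th power of the transition
matrix is positive exactly when `i` occurs in the `k`-th iterate of `j`. -/
theorem exists_mem_edges [Fintype E] [DecidableEq E] (h : f.transitionMatrix.IsIrreducible)
    (e e' : E) : ∃ k, 1 ≤ k ∧ e' ∈ f.edges k e := by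
  have hpow : ∀ k i j, 0 < (f.transitionMatrix ^ k) i j ↔ i ∈ f.edges k j := by
    intro k
    induction k with
    | zero =>
      intro i j
      by_cases hij : i = j
      · simp [hij, mem_edges_zero]
      · simp [hij, edges, iter]
    | succ k ih =>
      intro i j
      have h1 : ∀ l, 0 < f.transitionMatrix l j ↔ l ∈ f.edges 1 j := by
        intro l
        simp [transitionMatrix, edges, iter_one, onOriented, List.count_pos_iff]
      rw [pow_succ, Matrix.mul_apply, Finset.sum_pos_iff_of_nonneg
        (fun x _ => mul_nonneg (Matrix.pow_apply_nonneg h.nonneg k i x) (h.nonneg x j)),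
        mem_edges_add]
      simp only [Finset.mem_univ, true_and]
      refine exists_congr fun l => ?_
      rw [← h1, ← ih]
      constructor
      · intro hp
        have h2 := Matrix.pow_apply_nonneg h.nonneg k i l
        have h3 := h.nonneg l j
        rcases h2.eq_or_lt with h2 | h2
        · rw [← h2] at hp; simp at hp
        · exact ⟨(pos_iff_pos_of_mul_pos hp).1 h2, h2⟩
      · rintro ⟨h2, h3⟩
        exact mul_pos h3 h2
  obtain ⟨k, hk, hp⟩ := (Matrix.isIrreducible_iff_exists_pow_pos h.nonneg).1 h e' e
  exact ⟨k, hk, (hpow k e' e).1 hp⟩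

theorem onOriented_ne_nil (hn : ∀ e, f.onE e ≠ []) (d : E × Bool) : f.onOriented d ≠ [] := by
  rcases d with ⟨e, b⟩
  cases b
  · exact invRev_ne_nil (hn e)
  · exact hn e

theorem length_le_length_flatMap (hn : ∀ e, f.onE e ≠ []) (w : List (E × Bool)) :
    w.length ≤ (w.flatMap f.onOriented).length := by
  induction w with
  | nil => simp
  | cons d w ih =>
    have := List.length_pos_iff.2 (onOriented_ne_nil hn d)
    simp only [List.flatMap_cons, List.length_append, List.length_cons]
    omega

theorem monotone_length_iter (hn : ∀ e, f.onE e ≠ []) (d : E × Bool) :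
    Monotone fun n => (f.iter n d).length := by
  refine monotone_nat_of_le_succ fun n => ?_
  rw [iter_succ_eq_flatMap]
  exact length_le_length_flatMap hn _

theorem iter_ne_nil (hn : ∀ e, f.onE e ≠ []) (n : ℕ) (d : E × Bool) : f.iter n d ≠ [] := by
  have : 1 ≤ (f.iter n d).length := monotone_length_iter hn d (Nat.zero_le n)
  exact List.length_pos_iff.1 this

/-- Some iterate of any path crosses `e₁`, and the next application of `f` makes it strictly longer.
Lengths never decrease, so repetition makes them unbounded. -/
theorem isExpanding_of_exists (hn : ∀ e, f.onE e ≠ [])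
    (hreach : ∀ e e', ∃ k, 1 ≤ k ∧ e' ∈ f.edges k e) {e₁ : E} (he₁ : 2 ≤ (f.onE e₁).length) :
    f.IsExpanding := by
  intro d
  have hmono := monotone_length_iter hn d
  refine tendsto_atTop_atTop_of_monotone hmono fun b => ?_
  induction b with
  | zero => exact ⟨0, Nat.zero_le _⟩
  | succ b ih =>
    obtain ⟨n, hb⟩ := ih
    obtain ⟨k, -, hk⟩ := hreach d.1 e₁
    have hmem : e₁ ∈ (f.iter k d).map Prod.fst := (f.map_fst_iter k d e₁).2 hk
    obtain ⟨d₀, hd₀⟩ := List.exists_mem_of_ne_nil _ (iter_ne_nil hn n d)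
    obtain ⟨k, -, hk⟩ := hreach d₀.1 e₁
    have hmem : e₁ ∈ (f.iter (k + n) d).map Prod.fst :=
      (f.map_fst_iter _ d e₁).2 (f.mem_edges_trans
        ((f.map_fst_iter n d _).1 (List.mem_map_of_mem hd₀)) hk)
    obtain ⟨d₁, hd₁, rfl⟩ := List.mem_map.1 hmem
    refine ⟨k + n + 1, ?_⟩
    have h1 : (f.iter n d).length ≤ (f.iter (k + n) d).length := hmono (by omega)
    obtain ⟨w₁, w₂, hw⟩ := List.append_of_mem hd₁
    have h2 : 2 ≤ (f.onOriented d₁).length := by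
      rcases d₁ with ⟨e, b⟩
      cases b
      · rw [onOriented, if_neg (by simp), FreeGroup.invRev_length]
        exact he₁
      · exact he₁
    have h3 := length_le_length_flatMap hn w₁
    have h4 := length_le_length_flatMap hn w₂
    rw [iter_succ_eq_flatMap, hw]
    rw [hw] at h1
    simp only [List.flatMap_append, List.flatMap_cons, List.length_append, List.length_cons] at *
    omega

theorem iterate_onClass_mul (n : ℕ) (c c' : FreeGroup E) :
    f.onClass^[n] (c * c') = f.onClass^[n] c * f.onClass^[n] c' := by
  induction n with
  | zero => rfl
  | succ n ih => simp only [Function.iterate_succ_apply', ih, map_mul]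

theorem iterate_onClass_inv (n : ℕ) (c : FreeGroup E) :
    f.onClass^[n] c⁻¹ = (f.onClass^[n] c)⁻¹ := by
  induction n with
  | zero => rfl
  | succ n ih => simp only [Function.iterate_succ_apply', ih, map_inv]

section Determines

variable {N : ℕ} {α : Marking N Γ} {Φ : MulAut (FreeGroup (Fin N))} {u : FreeGroup E}

theorem exists_conjugator_pow (hu : Γ.IsPathClass α.base u (f.onV α.base))
    (hΦ : ∀ g, α.hom (Φ g) = u * f.onClass (α.hom g) * u⁻¹) (n : ℕ) :
    ∃ v, Γ.IsPathClass α.base v (f.onV^[n] α.base) ∧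
      ∀ g, α.hom ((Φ ^ n) g) = v * f.onClass^[n] (α.hom g) * v⁻¹ := by
  induction n with
  | zero => exact ⟨1, EdgeGraph.IsPathClass.refl _, fun g => by simp⟩
  | succ n ih =>
    obtain ⟨v, hv, hg⟩ := ih
    refine ⟨u * f.onClass v, ?_, fun g => ?_⟩
    · rw [Function.iterate_succ_apply']
      exact hu.mul (f.isPathClass_iterate 1 hv)
    · rw [pow_succ', MulAut.mul_apply, hΦ, hg, Function.iterate_succ_apply', map_mul, map_mul,
        map_inv]
      group

theorem onClass_hom_ne_one (hΦ : ∀ g, α.hom (Φ g) = u * f.onClass (α.hom g) * u⁻¹)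
    {g : FreeGroup (Fin N)} (hg : g ≠ 1) : f.onClass (α.hom g) ≠ 1 := by
  intro h
  have := hΦ g
  rw [h, mul_one, mul_inv_cancel] at this
  have h1 : Φ g = 1 := α.injective (by rw [this, map_one])
  exact hg (by simpa using h1)

/-- If all edges are mapped to single edges then some power of the outer automorphism is trivial. -/
theorem exists_fixesElementClass [Fintype E] (hN : 1 ≤ N)
    (hu : Γ.IsPathClass α.base u (f.onV α.base))
    (hΦ : ∀ g, α.hom (Φ g) = u * f.onClass (α.hom g) * u⁻¹)
    (hreach : ∀ e e', ∃ k, 1 ≤ k ∧ e' ∈ f.edges k e) (h1 : ∀ e, (f.onE e).length = 1) :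
    ∃ k, 1 ≤ k ∧ ∃ g : FreeGroup (Fin N), g ≠ 1 ∧ IsConj ((Φ ^ k) g) g := by
  classical
  have hlen : ∀ d, ∃ d', f.onOriented d = [d'] := by
    rintro ⟨e, b⟩
    apply List.length_eq_one_iff.1
    cases b
    · rw [onOriented, if_neg (by simp), FreeGroup.invRev_length, h1]
    · exact h1 e
  choose p hp using hlen
  have hiter : ∀ n d, f.iter n d = [p^[n] d] := by
    intro n d
    induction n with
    | zero => rfl
    | succ n ih => rw [iter_succ_eq_flatMap, ih, Function.iterate_succ_apply']; simp [hp]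
  have hflip : ∀ n d, p^[n] (flipLetter d) = flipLetter (p^[n] d) := by
    intro n d
    have := f.iter_flipLetter n d
    rw [hiter, hiter] at this
    simpa [FreeGroup.invRev, flipLetter] using this
  -- Some iterate of `p` returns to the edge of `d`, possibly reversed; in that case one starts with
  -- the opposite orientation.
  have hsurj : Function.Surjective p := by
    intro d
    obtain ⟨k, hk, hm⟩ := hreach d.1 d.1
    obtain ⟨n, rfl⟩ := Nat.exists_eq_add_of_le' hk
    rw [edges, hiter] at hm
    simp only [List.map_cons, List.map_nil, List.mem_singleton] at hm
    by_cases hd : p^[n + 1] (d.1, true) = d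
    · exact ⟨p^[n] (d.1, true), by rw [← Function.iterate_succ_apply' p, hd]⟩
    · refine ⟨p^[n] (flipLetter (d.1, true)), ?_⟩
      rw [← Function.iterate_succ_apply' p, hflip]
      generalize p^[n + 1] (d.1, true) = d' at hm hd
      rcases d with ⟨e, b⟩
      rcases d' with ⟨e', b'⟩
      simp only at hm
      subst hm
      cases b <;> cases b' <;> simp_all [flipLetter]
  obtain ⟨j, hj, hpj⟩ := isOfFinOrder_iff_pow_eq_one.1
    (isOfFinOrder_of_finite (Equiv.ofBijective p (Finite.surjective_iff_bijective.1 hsurj)))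
  have hpj' : ∀ d, p^[j] d = d := by
    intro d
    have := Equiv.congr_fun hpj d
    rw [Equiv.Perm.coe_pow] at this
    exact this
  have hid : ∀ d, f.iter j d = [d] := fun d => by rw [hiter, hpj']
  have hpath : ∀ w, f.onPath^[j] w = w := by
    intro w
    rw [iterate_onPath_eq_flatMap]
    simp [funext hid]
  have hclass : ∀ c, f.onClass^[j] c = c := by
    intro c
    rw [← FreeGroup.mk_toWord (x := c), iterate_onClass_mk, hpath]
  let g : FreeGroup (Fin N) := FreeGroup.of ⟨0, hN⟩
  have hg : g ≠ 1 := FreeGroup.of_ne_one _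
  -- A nontrivial loop at the base vertex is a nonempty word that the `j`-th iterate of `f` leaves
  -- unchanged, so its initial vertex is fixed.
  have hbase : f.onV^[j] α.base = α.base := by
    obtain ⟨w, hw, hwg⟩ := α.isPathClass_hom g
    have hwn : w ≠ [] := by
      rintro rfl
      exact hg (α.injective (by rw [← hwg, map_one]; rfl))
    have h2 := f.isPath_onPath_iterate j hw
    rw [hpath] at h2
    exact h2.unique_start hw hwn
  obtain ⟨v, hv, hvg⟩ := exists_conjugator_pow hu hΦ j
  rw [hbase] at hv
  obtain ⟨a, ha⟩ := α.exists_hom_eq hv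
  refine ⟨j, hj, g, hg, isConj_iff.2 ⟨a⁻¹, α.injective ?_⟩⟩
  rw [inv_inv, map_mul, map_mul, hvg, hclass, map_inv, ha]
  group

end Determines

end GraphMap

/-! ### Edge sets invariant under a power of the graph map -/

namespace GraphMap

variable {V E : Type*} {Γ : EdgeGraph V E} {f : GraphMap Γ}

/-- The edge set `S` is invariant under `f^k`. -/
def IsInvariant (f : GraphMap Γ) (k : ℕ) (S : Set E) : Prop := ∀ e ∈ S, ∀ e' ∈ f.edges k e, e' ∈ S

theorem IsInvariant.mul {k : ℕ} {S : Set E} (h : f.IsInvariant k S) (n : ℕ) :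
    f.IsInvariant (k * n) S := by
  induction n with
  | zero =>
    intro e he e' he'
    simp only [mul_zero, edges, iter, Function.iterate_zero, id_eq, List.map_cons, List.map_nil,
      List.mem_singleton] at he'
    exact he' ▸ he
  | succ n ih =>
    intro e he e' he'
    rw [Nat.mul_succ] at he'
    obtain ⟨e₁, h1, h2⟩ := f.mem_edges_add.1 he'
    exact ih e₁ (h e he e₁ h1) e' h2

theorem mem_edges_mul {k : ℕ} {e : E} (h : e ∈ f.edges k e) (n : ℕ) : e ∈ f.edges (k * n) e := by
  induction n with
  | zero => exact f.mem_edges_zero e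
  | succ n ih => rw [Nat.mul_succ]; exact f.mem_edges_trans h ih

/-- Because `e` recurs after `k` steps, its supports at the multiples of `k` increase. There are
finitely many edges, so the supports become stationary, and a stationary support is invariant. -/
theorem exists_stable_edges [Finite E] {k : ℕ} {e : E} (h : e ∈ f.edges k e) :
    ∃ J, 1 ≤ J ∧ f.IsInvariant k {e' | e' ∈ f.edges (k * J) e} := by
  have hmono : ∀ i j, i ≤ j → ∀ e', e' ∈ f.edges (k * i) e → e' ∈ f.edges (k * j) e := by
    intro i j hij e' he'
    obtain ⟨m, rfl⟩ := Nat.exists_eq_add_of_le hij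
    rw [Nat.mul_add]
    exact f.mem_edges_trans (mem_edges_mul h m) he'
  have h1 : ∀ e' : E, ∃ n, (∃ j, e' ∈ f.edges (k * j) e) → e' ∈ f.edges (k * n) e := by
    intro e'
    by_cases hj : ∃ j, e' ∈ f.edges (k * j) e
    · obtain ⟨j, hj⟩ := hj
      exact ⟨j, fun _ => hj⟩
    · exact ⟨0, fun h => absurd h hj⟩
  choose n hn using h1
  obtain ⟨M, hM⟩ := (Set.finite_range n).bddAbove
  refine ⟨M + 1, by omega, fun e₁ he₁ e₂ he₂ => ?_⟩
  have h2 : e₂ ∈ f.edges (k * (M + 1 + 1)) e := by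
    rw [Nat.mul_succ, add_comm]
    exact f.mem_edges_trans he₁ he₂
  exact hmono _ _ (le_trans (hM ⟨e₂, rfl⟩) (Nat.le_succ M)) _ (hn e₂ ⟨_, h2⟩)

theorem forall_mem_iterate_onPath {n : ℕ} {S T : Set E}
    (h : ∀ e ∈ S, ∀ e' ∈ f.edges n e, e' ∈ T) {w : List (E × Bool)} (hw : ∀ d ∈ w, d.1 ∈ S) :
    ∀ d ∈ f.onPath^[n] w, d.1 ∈ T := by
  rw [iterate_onPath_eq_flatMap]
  intro d hd
  obtain ⟨d', hd', hdd⟩ := List.mem_flatMap.1 hd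
  exact h _ (hw d' hd') _ ((f.map_fst_iter n d' d.1).1 (List.mem_map_of_mem hdd))

theorem isClassIn_iterate_onClass {n : ℕ} {S T : Set E}
    (h : ∀ e ∈ S, ∀ e' ∈ f.edges n e, e' ∈ T) {x y : V} {c : FreeGroup E}
    (hc : Γ.IsClassIn S x c y) : Γ.IsClassIn T (f.onV^[n] x) (f.onClass^[n] c) (f.onV^[n] y) := by
  obtain ⟨w, hw, hS, rfl⟩ := hc
  exact ⟨_, f.isPath_onPath_iterate n hw, forall_mem_iterate_onPath h hS,
    (f.iterate_onClass_mk n w).symm⟩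

end GraphMap

namespace EdgeGraph

variable {V E : Type*} {Γ : EdgeGraph V E} {S : Set E}

theorem IsPath.exists_isClassIn_of_mem {x y : V} {w : List (E × Bool)} (h : Γ.IsPath x w y)
    (hS : ∀ d ∈ w, d.1 ∈ S) {d : E × Bool} (hd : d ∈ w) :
    ∃ c, Γ.IsClassIn S x c (Γ.src d.1) := by
  obtain ⟨p, q, rfl⟩ := List.append_of_mem hd
  obtain ⟨z, hp, hq⟩ := isPath_append_iff.1 h
  have hz : Γ.init d = z := hq.1
  have h1 : Γ.IsClassIn S x (FreeGroup.mk p) (Γ.init d) :=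
    ⟨p, hz ▸ hp, fun d' hd' => hS d' (List.mem_append_left _ hd'), rfl⟩
  rcases d with ⟨e, b⟩
  cases b
  · exact ⟨_, h1.mul (isClassIn_letter (S := S) (hS _ hd))⟩
  · exact ⟨_, h1⟩

/-- A long path in a finite graph contains a closed path. -/
theorem IsPath.exists_closed_infix [Finite V] {x y : V} {w : List (E × Bool)}
    (h : Γ.IsPath x w y) (hw : Nat.card V ≤ w.length) :
    ∃ p v q z, w = p ++ (v ++ q) ∧ v ≠ [] ∧ Γ.IsPath x p z ∧ Γ.IsPath z v z := by
  have hex : ∀ i : Fin (w.length + 1), ∃ z, Γ.IsPath x (w.take i) z ∧ Γ.IsPath z (w.drop i) y := by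
    intro i
    rw [← List.take_append_drop i w] at h
    exact isPath_append_iff.1 h
  choose z hz using hex
  have hni : ¬ Function.Injective z := by
    intro hi
    have := Nat.card_le_card_of_injective z hi
    rw [Nat.card_eq_fintype_card, Fintype.card_fin] at this
    omega
  have hlt : ∃ i j : Fin (w.length + 1), i < j ∧ z i = z j := by
    rw [Function.Injective] at hni
    push Not at hni
    obtain ⟨i, j, he, hne⟩ := hni
    rcases lt_or_gt_of_ne hne with h | h
    · exact ⟨i, j, h, he⟩
    · exact ⟨j, i, h, he.symm⟩
  obtain ⟨i, j, hij, he⟩ := hlt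
  have hij' : (i : ℕ) < j := hij
  have hj : (j : ℕ) ≤ w.length := by omega
  have hdecomp : w.take j = w.take i ++ (w.take j).drop i := by
    conv_lhs => rw [← List.take_append_drop i (w.take j)]
    rw [List.take_take, min_eq_left hij'.le]
  refine ⟨w.take i, (w.take j).drop i, w.drop j, z i, ?_, ?_, (hz i).1, ?_⟩
  · rw [← List.append_assoc, ← hdecomp, List.take_append_drop]
  · rw [← List.length_pos_iff, List.length_drop, List.length_take]
    omega
  · have h1 := (hz j).1
    rw [hdecomp] at h1
    obtain ⟨z', h2, h3⟩ := isPath_append_iff.1 h1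
    have h4 : z i = z' := (hz i).1.unique_end h2
    rw [← h4, ← he] at h3
    exact h3

end EdgeGraph

/-! ### From an invariant edge set to an invariant free factor -/

namespace GraphMap

variable {V E : Type*} {Γ : EdgeGraph V E} {f : GraphMap Γ} {N : ℕ} {α : Marking N Γ}
  {Φ : MulAut (FreeGroup (Fin N))} {u : FreeGroup E}

/-- An invariant connected proper edge set which is disjoint from its image produces a free factor
that is fixed up to conjugacy by a power of the automorphism. -/
theorem exists_fixesSubgroupClass [Finite V] (hΓ : Γ.IsConnected)
    (hred : ∀ k d, FreeGroup.IsReduced (f.iter k d)) (he : f.IsExpanding)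
    (hu : Γ.IsPathClass α.base u (f.onV α.base))
    (hΦ : ∀ g, α.hom (Φ g) = u * f.onClass (α.hom g) * u⁻¹) {S : Set E} {K : ℕ} {e : E}
    (heS : e ∈ S) (hSe : S = {e' | e' ∈ f.edges K e}) (hinv : f.IsInvariant K S) (hK : 1 ≤ K)
    (hdisj : ∀ a ∈ S, ∀ a' ∈ f.edges 1 a, a' ∉ S) :
    ∃ H : Subgroup (FreeGroup (Fin N)), IsFreeFactor H ∧ H ≠ ⊥ ∧ H ≠ ⊤ ∧
      ∃ g, H.map (Φ ^ K).toMonoidHom = H.map (MulAut.conj g).toMonoidHom := by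
  classical
  set x := Γ.src e with hx
  set y₀ := f.onV^[K] x with hy₀
  -- All of `S` lies on one path, the `K`-th iterate of `e`; so `S` is connected and each of its
  -- edges is reached from `y₀` inside `S`.
  have hW : Γ.IsPath y₀ (f.iter K (e, true)) (f.onV^[K] (Γ.tgt e)) :=
    f.isPath_onPath_iterate K (EdgeGraph.isPath_singleton (e, true))
  have hWS : ∀ d ∈ f.iter K (e, true), d.1 ∈ S := by
    intro d hd
    rw [hSe]
    exact List.mem_map_of_mem hd
  have hy : ∀ e' ∈ S, ∃ c, Γ.IsClassIn S y₀ c (Γ.src e') := by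
    intro e' he'
    rw [hSe] at he'
    obtain ⟨d, hd, rfl⟩ := List.mem_map.1 he'
    exact hW.exists_isClassIn_of_mem hWS hd
  obtain ⟨r, hr⟩ := hy e heS
  have hxS : ∀ e' ∈ S, ∃ c, Γ.IsClassIn S x c (Γ.src e') := by
    intro e' he'
    obtain ⟨c, hc⟩ := hy e' he'
    exact ⟨_, hr.inv.mul hc⟩
  obtain ⟨bw, hbw⟩ := hΓ α.base x
  set b := FreeGroup.mk bw with hbdef
  have hb : Γ.IsPathClass α.base b x := ⟨bw, hbw, rfl⟩
  have hff := α.isFreeFactor_subgraphGroup hΓ hb hxS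
  set H := α.subgraphGroup S x b with hH
  have hfind : ∀ c, Γ.IsPathClass x c x → ∃ g, b⁻¹ * α.hom g * b = c := by
    intro c hc
    obtain ⟨g, hg⟩ := α.exists_hom_eq ((hb.mul hc).mul hb.inv)
    exact ⟨g, by rw [hg]; group⟩
  -- By expansion some iterate of `e` inside `S` is long enough to contain a closed subpath. It is
  -- reduced, as iterates of edges are, and therefore homotopically nontrivial.
  obtain ⟨g₀, hg₀H, hg₀⟩ : ∃ g ∈ H, g ≠ 1 := by
    have hlong : ∃ j, Nat.card V ≤ (f.iter (K * j) (e, true)).length := by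
      obtain ⟨n, hn⟩ := ((he (e, true)).comp
        (tendsto_id.const_mul_atTop' (show 0 < K by omega))).eventually_ge_atTop (Nat.card V) |>.exists
      exact ⟨n, hn⟩
    obtain ⟨j, hj⟩ := hlong
    have hP : Γ.IsPath (f.onV^[K * j] x) (f.iter (K * j) (e, true)) (f.onV^[K * j] (Γ.tgt e)) :=
      f.isPath_onPath_iterate (K * j) (EdgeGraph.isPath_singleton (e, true))
    have hPS : ∀ d ∈ f.iter (K * j) (e, true), d.1 ∈ S :=
      forall_mem_iterate_onPath (hinv.mul j) (by simpa using heS)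
    obtain ⟨p, v, q, z, hpvq, hv, -, hvz⟩ := hP.exists_closed_infix hj
    have hvS : ∀ d ∈ v, d.1 ∈ S := fun d hd => hPS d (by rw [hpvq]; simp [hd])
    have hvred : FreeGroup.IsReduced v :=
      (hred (K * j) (e, true)).infix ⟨p, q, by rw [hpvq, List.append_assoc]⟩
    obtain ⟨d, v', rfl⟩ := List.exists_cons_of_ne_nil hv
    have hzS : ∃ c, Γ.IsClassIn S x c z := by
      have hz : Γ.init d = z := hvz.1
      have hdS := hvS d List.mem_cons_self
      obtain ⟨c, hc⟩ := hxS _ hdS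
      rcases d with ⟨e', b'⟩
      cases b'
      · have h1 := hc.mul (EdgeGraph.isClassIn_letter (Γ := Γ) (d := (e', true)) hdS)
        rw [← hz]
        exact ⟨_, h1⟩
      · exact ⟨c, hz ▸ hc⟩
    obtain ⟨c, hc⟩ := hzS
    have hloop : Γ.IsClassIn S x (c * FreeGroup.mk (d :: v') * c⁻¹) x :=
      (hc.mul ⟨_, hvz, hvS, rfl⟩).mul hc.inv
    obtain ⟨g, hg⟩ := hfind _ hloop.isPathClass
    refine ⟨g, by rw [hH, α.mem_subgraphGroup, hg]; exact hloop, ?_⟩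
    rintro rfl
    rw [map_one, mul_one, inv_mul_cancel] at hg
    have h1 : FreeGroup.mk (d :: v') = 1 := by
      have := congrArg (fun t => c⁻¹ * t * c) hg
      simpa [mul_assoc] using this.symm
    have h2 := FreeGroup.toWord_one (α := E)
    rw [← h1, FreeGroup.toWord_mk, hvred.reduce_eq] at h2
    simp at h2
  refine ⟨H, hff, fun h => ?_, fun h => ?_, ?_⟩
  · rw [h, Subgroup.mem_bot] at hg₀H
    exact hg₀ hg₀H
  -- If `H` were everything, the image under `f` of a loop in `S`, which avoids `S`, would be
  -- conjugate to a loop in `S`. Deleting the letters of `S` (the map `π`) kills the latter and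
  -- fixes the former, so the image would be trivial, against the injectivity of `f` on loops.
  · set c₀ := b⁻¹ * α.hom g₀ * b with hc₀
    have hc₀S : Γ.IsClassIn S x c₀ x := hg₀H
    have hF : Γ.IsClassIn Sᶜ (f.onV x) (f.onClass c₀) (f.onV x) :=
      isClassIn_iterate_onClass (n := 1) hdisj hc₀S
    obtain ⟨ρ, hρ⟩ : ∃ ρ, Γ.IsPathClass x ρ (f.onV x) := by
      obtain ⟨w, hw⟩ := hΓ x (f.onV x)
      exact ⟨_, w, hw, rfl⟩
    obtain ⟨g₁, hg₁⟩ := hfind _ ((hρ.mul hF.isPathClass).mul hρ.inv)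
    have hg₁H : g₁ ∈ H := h ▸ Subgroup.mem_top g₁
    rw [hH, α.mem_subgraphGroup, hg₁] at hg₁H
    let π : FreeGroup E →* FreeGroup E :=
      FreeGroup.lift fun a => if a ∈ S then 1 else FreeGroup.of a
    have hπS : ∀ c y z, Γ.IsClassIn S y c z → π c = 1 := by
      rintro _ y z ⟨w, -, hw, rfl⟩
      induction w with
      | nil => rw [← FreeGroup.one_eq_mk, map_one]
      | cons d w ih =>
        have e1 : FreeGroup.mk (d :: w) = FreeGroup.mk [d] * FreeGroup.mk w := by
          rw [FreeGroup.mul_mk]; rfl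
        rw [e1, map_mul, ih fun d' hd' => hw d' (List.mem_cons_of_mem _ hd'), mul_one]
        have hd := hw d List.mem_cons_self
        rcases d with ⟨a, b'⟩
        have ha : a ∈ S := hd
        cases b'
        · have : FreeGroup.mk [(a, false)] = (FreeGroup.of a)⁻¹ := rfl
          rw [this, map_inv]
          simp [π, ha]
        · have : FreeGroup.mk [(a, true)] = FreeGroup.of a := rfl
          rw [this]
          simp [π, ha]
    have hπc : ∀ c y z, Γ.IsClassIn Sᶜ y c z → π c = c := by
      rintro _ y z ⟨w, -, hw, rfl⟩
      induction w with
      | nil => rw [← FreeGroup.one_eq_mk, map_one]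
      | cons d w ih =>
        have e1 : FreeGroup.mk (d :: w) = FreeGroup.mk [d] * FreeGroup.mk w := by
          rw [FreeGroup.mul_mk]; rfl
        rw [e1, map_mul, ih fun d' hd' => hw d' (List.mem_cons_of_mem _ hd')]
        congr 1
        have hd := hw d List.mem_cons_self
        rcases d with ⟨a, b'⟩
        have ha : a ∉ S := hd
        cases b'
        · have : FreeGroup.mk [(a, false)] = (FreeGroup.of a)⁻¹ := rfl
          rw [this, map_inv]
          simp [π, ha]
        · have : FreeGroup.mk [(a, true)] = FreeGroup.of a := rfl
          rw [this]
          simp [π, ha]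
    have h1 := hπS _ _ _ hg₁H
    rw [map_mul, map_mul, map_inv, hπc _ _ _ hF] at h1
    have h2 : f.onClass c₀ = 1 := by
      have := congrArg (fun t => (π ρ)⁻¹ * t * π ρ) h1
      simpa [mul_assoc] using this
    have h3 : f.onClass (α.hom g₀) = 1 := by
      rw [hc₀, map_mul, map_mul, map_inv] at h2
      have := congrArg (fun t => f.onClass b * t * (f.onClass b)⁻¹) h2
      simpa [mul_assoc] using this
    exact onClass_hom_ne_one hΦ hg₀ h3
  -- The element `a` corrects for the displacement of the base point, with the return from `y₀` to
  -- `x` made inside `S`. After this correction the power of `Φ` maps `H` into itself, hence onto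
  -- itself.
  · obtain ⟨v, hv, hvg⟩ := exists_conjugator_pow hu hΦ K
    have hwp : Γ.IsPathClass α.base (v * f.onClass^[K] b * r * b⁻¹) α.base :=
      ((hv.mul (f.isPathClass_iterate K hb)).mul hr.isPathClass).mul hb.inv
    obtain ⟨a, ha⟩ := α.exists_hom_eq hwp
    set Ψ : MulAut (FreeGroup (Fin N)) := MulAut.conj a⁻¹ * Φ ^ K with hΨ
    have hle : H.map Ψ.toMonoidHom ≤ H := by
      rintro _ ⟨g, hg, rfl⟩
      have hgS : Γ.IsClassIn S x (b⁻¹ * α.hom g * b) x := hg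
      have h1 := isClassIn_iterate_onClass (n := K) hinv hgS
      have h2 := (hr.inv.mul h1).mul hr
      rw [hH, α.mem_subgraphGroup]
      convert h2 using 1
      have h3 : Ψ.toMonoidHom g = a⁻¹ * (Φ ^ K) g * a := by simp [hΨ]
      rw [h3, map_mul, map_mul, map_inv, ha, hvg, iterate_onClass_mul, iterate_onClass_mul,
        iterate_onClass_inv]
      group
    have heq := hff.map_eq_of_map_le
      (fun g hg => FreeGroup.exists_finite_hom_ne_one hg) Ψ hle
    refine ⟨a, ?_⟩
    conv_rhs => rw [← heq]
    rw [Subgroup.map_map]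
    congr 1
    ext g
    simp [hΨ, mul_assoc]

/-- An iterate that covers all edges goes on doing so, because every edge lies in the image of some
edge. The maximum of the individual times then works for all edges. -/
theorem isMixing_of_forall_exists [Finite E] (hreach : ∀ e e', ∃ k, 1 ≤ k ∧ e' ∈ f.edges k e)
    (h : ∀ e, ∃ K, ∀ e', e' ∈ f.edges K e) : f.IsMixing := by
  choose K hK using h
  obtain ⟨M, hM⟩ := (Set.finite_range K).bddAbove
  have hstep : ∀ n e, K e ≤ n → ∀ e', e' ∈ f.edges n e := by
    intro n e hn
    obtain ⟨m, rfl⟩ := Nat.exists_eq_add_of_le hn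
    clear hn
    induction m with
    | zero => exact hK e
    | succ m ih =>
      intro e'
      obtain ⟨k, hk, hm⟩ := hreach e e'
      obtain ⟨l, rfl⟩ := Nat.exists_eq_add_of_le hk
      obtain ⟨a, -, ha⟩ := f.mem_edges_add.1 hm
      have := f.mem_edges_trans (ih a) ha
      rwa [add_comm] at this
  exact ⟨M, fun e e' => hstep M e (hM ⟨e, rfl⟩) e'⟩

end GraphMap

/-! ### Train tracks of hyperbolic iwips expand and mix -/

namespace GraphMap

variable {V E : Type*} {Γ : EdgeGraph V E} {f : GraphMap Γ} {N : ℕ} {α : Marking N Γ}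
  {φ : OutAut (FreeGroup (Fin N))}

theorem IsTrainTrackFor.isExpanding [Fintype E] [DecidableEq E] (hN : 1 ≤ N)
    (hφ : φ.IsAtoroidal) (hf : f.IsTrainTrackFor α φ) : f.IsExpanding := by
  have hreach := exists_mem_edges hf.irreducible
  by_cases h : ∃ e, 2 ≤ (f.onE e).length
  · obtain ⟨e, he⟩ := h
    exact isExpanding_of_exists hf.nondegenerate hreach he
  · exfalso
    push Not at h
    obtain ⟨Φ, hΦφ, u, hu, hΦ⟩ := hf.determines
    have h1 : ∀ e, (f.onE e).length = 1 := fun e => by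
      have := List.length_pos_iff.2 (hf.nondegenerate e)
      have := h e
      omega
    obtain ⟨k, hk, g, hg, hc⟩ := exists_fixesElementClass hN hu hΦ hreach h1
    exact hφ k hk g hg ⟨Φ ^ k, by rw [QuotientGroup.mk_pow, hΦφ], hc⟩

/-- If mixing fails, consider a smallest nonempty edge set `S` invariant under a positive power of
`f`. It is proper, it is the support of a single iterate of an edge, and it has no edge in common
with its image. Then `exists_fixesSubgroupClass` contradicts full irreducibility. -/
theorem IsTrainTrackFor.isMixing [Finite V] [Fintype E] [DecidableEq E] (hN : 1 ≤ N)
    (hφ : φ.IsHyperbolicIwip) (hf : f.IsTrainTrackFor α φ) : f.IsMixing := by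
  have hreach := exists_mem_edges hf.irreducible
  have he := hf.isExpanding hN hφ.2
  have hred := f.isReduced_iter hf.noBacktracking
  obtain ⟨Φ, hΦφ, u, hu, hΦ⟩ := hf.determines
  apply isMixing_of_forall_exists hreach
  by_contra hcon
  push Not at hcon
  obtain ⟨e₀, he₀⟩ := hcon
  let 𝒮 : Set (Set E) := {S | S.Nonempty ∧ ∃ k, 1 ≤ k ∧ f.IsInvariant k S}
  have hne : 𝒮.Nonempty := ⟨Set.univ, ⟨e₀, trivial⟩, 1, le_rfl, fun _ _ _ _ => trivial⟩
  obtain ⟨S, hS⟩ := (Set.toFinite 𝒮).exists_minimalFor Set.ncard 𝒮 hne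
  obtain ⟨⟨hSne, k, hk, hSk⟩, hmin⟩ := hS
  have hmin : ∀ T, T ∈ 𝒮 → S.ncard ≤ T.ncard := fun T hT => by
    by_contra hlt
    exact hlt (hmin hT (not_le.1 hlt).le)
  have hsub : ∀ T, T ∈ 𝒮 → T ⊆ S → T = S := fun T hT hTS =>
    Set.eq_of_subset_of_ncard_le hTS (hmin T hT) (Set.toFinite S)
  have hSuniv : S ≠ Set.univ := by
    -- If `S` were everything, then by minimality so would be the stationary support of `e₀`, but no
    -- iterate of `e₀` covers all edges.
    rintro rfl
    obtain ⟨k', hk', hk'e⟩ := hreach e₀ e₀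
    obtain ⟨J, hJ, hinv⟩ := exists_stable_edges hk'e
    have hT := hsub _ ⟨⟨e₀, mem_edges_mul hk'e J⟩, k', hk', hinv⟩ (Set.subset_univ _)
    obtain ⟨e', he'⟩ := he₀ (k' * J)
    have : e' ∈ {e' | e' ∈ f.edges (k' * J) e₀} := hT ▸ Set.mem_univ e'
    exact he' this
  obtain ⟨e, heS⟩ := hSne
  obtain ⟨k', hk', hk'e⟩ := hreach e e
  have hk0 : e ∈ f.edges (k * k') e := by
    rw [mul_comm]
    exact mem_edges_mul hk'e k
  obtain ⟨J, hJ, hinv⟩ := exists_stable_edges hk0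
  have hpos : 1 ≤ k * k' := Nat.mul_pos hk hk'
  have hT : {e' | e' ∈ f.edges (k * k' * J) e} = S := by
    refine hsub _ ⟨⟨e, mem_edges_mul hk0 J⟩, k * k', hpos, hinv⟩ fun e' he' => ?_
    rw [mul_assoc] at he'
    exact hSk.mul _ e heS e' he'
  have hdisj : ∀ a ∈ S, ∀ a' ∈ f.edges 1 a, a' ∉ S := by
    by_contra hcon
    push Not at hcon
    obtain ⟨a, haS, a', ha', ha'S⟩ := hcon
    -- The part of `S` covered by the image of `S` is invariant under the same power and nonempty,
    -- hence all of `S`. So edges of `S` have predecessors of every order in `S`.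
    have h1 : S ∩ {e' | ∃ b ∈ S, e' ∈ f.edges 1 b} = S := by
      refine hsub _ ⟨⟨a', ha'S, a, haS, ha'⟩, k, hk, ?_⟩ Set.inter_subset_left
      rintro b ⟨hbS, c, hcS, hbc⟩ b' hb'
      refine ⟨hSk b hbS b' hb', ?_⟩
      have := f.mem_edges_trans hbc hb'
      rw [add_comm] at this
      obtain ⟨c', hc', hb'c⟩ := f.mem_edges_add.1 this
      exact ⟨c', hSk c hcS c' hc', hb'c⟩
    have h2 : ∀ n, ∀ b ∈ S, ∃ c ∈ S, b ∈ f.edges n c := by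
      intro n
      induction n with
      | zero => exact fun b hb => ⟨b, hb, f.mem_edges_zero b⟩
      | succ n ih =>
        intro b hb
        obtain ⟨c, hc, hbc⟩ := ih b hb
        rw [← h1] at hc
        obtain ⟨-, c', hc', hcc'⟩ := hc
        exact ⟨c', hc', f.mem_edges_trans hcc' hbc⟩
    have h3 : f.IsInvariant 1 S := by
      intro b hb b' hb'
      -- After `k - 1` steps back inside `S`, one step forward completes `k` steps. Hence `f` itself
      -- preserves `S`, and irreducibility makes `S` everything.
      obtain ⟨c, hc, hbc⟩ := h2 (k - 1) b hb
      have := f.mem_edges_trans hbc hb'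
      rw [Nat.add_sub_cancel' hk] at this
      exact hSk c hc b' this
    refine hSuniv (Set.eq_univ_of_forall fun b => ?_)
    obtain ⟨n, -, hn⟩ := hreach e b
    rw [← one_mul n] at hn
    exact h3.mul n e heS b hn
  have hinvK : f.IsInvariant (k * k' * J) S := by
    rw [mul_assoc]
    exact hSk.mul _
  have hKpos : 1 ≤ k * k' * J := Nat.mul_pos hpos hJ
  obtain ⟨H, hff, hbot, htop, g, hg⟩ := exists_fixesSubgroupClass hf.connected hred he hu hΦ heS
    hT.symm hinvK hKpos hdisj
  exact hφ.1 _ hKpos H hff hbot htop ⟨Φ ^ (k * k' * J), by rw [QuotientGroup.mk_pow, hΦφ], g, hg⟩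

end GraphMap

/-! ## The boundary of a free group -/

theorem ne_flipLetter_iff {A : Type*} {a b : A × Bool} :
    b ≠ flipLetter a ↔ (a.1 = b.1 → a.2 = b.2) := by
  rcases a with ⟨a, s⟩
  rcases b with ⟨b, t⟩
  cases s <;> cases t <;> simp [flipLetter, eq_comm]

theorem isReduced_cons_cons_iff {A : Type*} {a b : A × Bool} {w : List (A × Bool)} :
    FreeGroup.IsReduced (a :: b :: w) ↔ b ≠ flipLetter a ∧ FreeGroup.IsReduced (b :: w) := by
  rw [FreeGroup.isReduced_cons_cons, ne_flipLetter_iff]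

theorem isReduced_concat_concat_iff {A : Type*} {a b : A × Bool} {w : List (A × Bool)} :
    FreeGroup.IsReduced (w ++ [a] ++ [b]) ↔
      FreeGroup.IsReduced (w ++ [a]) ∧ b ≠ flipLetter a := by
  rw [ne_flipLetter_iff, FreeGroup.IsReduced, List.isChain_append]
  simp [FreeGroup.IsReduced]

theorem FreeGroup.mk_cons {A : Type*} (d : A × Bool) (w : List (A × Bool)) :
    FreeGroup.mk (d :: w) = FreeGroup.mk [d] * FreeGroup.mk w := by
  rw [FreeGroup.mul_mk]; rfl

theorem FreeGroup.mk_flipLetter {A : Type*} (d : A × Bool) :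
    FreeGroup.mk [flipLetter d] = (FreeGroup.mk [d])⁻¹ := by
  rw [FreeGroup.inv_mk]; rfl

namespace FreeGroup

variable {A : Type*} [DecidableEq A]

theorem toWord_mk_of_isReduced {w : List (A × Bool)} (h : IsReduced w) : (mk w).toWord = w := by
  rw [toWord_mk, h.reduce_eq]

theorem toWord_mul_letter (g : FreeGroup A) (d : A × Bool) :
    (g * mk [d]).toWord = g.toWord ++ [d] ∨ g.toWord = (g * mk [d]).toWord ++ [flipLetter d] := by
  have hg : IsReduced g.toWord := isReduced_toWord
  have hmul : g * mk [d] = mk (g.toWord ++ [d]) := by rw [← mul_mk, mk_toWord]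
  rcases List.eq_nil_or_concat g.toWord with h | ⟨w, a, h⟩
  · left
    rw [hmul, h, List.nil_append, toWord_mk_of_isReduced IsReduced.singleton]
  · rw [List.concat_eq_append] at h
    rw [h] at hg
    by_cases hd : d = flipLetter a
    · right
      have : g * mk [d] = mk w := by
        rw [← mk_toWord (x := g), h, hd, mk_flipLetter, ← mul_mk, mul_assoc, mul_inv_cancel,
          mul_one]
      rw [this, toWord_mk_of_isReduced (hg.infix ⟨[], [a], by simp⟩), h, hd, flipLetter_flipLetter]
    · left
      rw [hmul, h, toWord_mk_of_isReduced (isReduced_concat_concat_iff.2 ⟨hg, hd⟩)]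

/-- Right multiplication by a letter changes only the end of the reduced word, by one letter, so the
first `k` letters stay out of reach. -/
theorem take_toWord_mul_mk {k : ℕ} (u : List (A × Bool)) (g : FreeGroup A)
    (h : k + u.length ≤ g.norm) : (g * mk u).toWord.take k = g.toWord.take k := by
  induction u generalizing g with
  | nil => rw [← one_eq_mk, mul_one]
  | cons d u ih =>
    simp only [List.length_cons, norm] at h ih
    rw [mk_cons, ← mul_assoc]
    rcases toWord_mul_letter g d with h1 | h1
    · rw [ih _ (by rw [h1]; simp; omega), h1, List.take_append_of_le_length (by omega)]
    · have h2 := congrArg List.length h1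
      simp only [List.length_append, List.length_cons, List.length_nil] at h2
      rw [ih _ (by omega), h1, List.take_append_of_le_length (by omega)]

theorem take_toWord_eq {k K : ℕ} {g h : FreeGroup A} (hd : norm (g⁻¹ * h) ≤ K)
    (hg : k + K ≤ norm g) : h.toWord.take k = g.toWord.take k := by
  have := take_toWord_mul_mk (k := k) (g⁻¹ * h).toWord g (le_trans (by gcongr; exact hd) hg)
  rwa [mk_toWord, mul_inv_cancel_left] at this

theorem norm_le_norm_add (g h : FreeGroup A) : norm g ≤ norm h + norm (g⁻¹ * h) := by
  have h1 := norm_mul_le h (g⁻¹ * h)⁻¹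
  rw [norm_inv_eq] at h1
  have : h * (g⁻¹ * h)⁻¹ = g := by group
  rwa [this] at h1

theorem finite_norm_le [Finite A] (R : ℕ) : {g : FreeGroup A | norm g ≤ R}.Finite := by
  have : {g : FreeGroup A | norm g ≤ R} ⊆ mk '' {l : List (A × Bool) | l.length ≤ R} :=
    fun g hg => ⟨g.toWord, hg, mk_toWord⟩
  exact ((List.finite_length_le (A × Bool) R).image _).subset this

end FreeGroup

namespace FreeBoundary

variable {A : Type*}

theorem ext {x y : FreeBoundary A} (h : ∀ n, x.1 n = y.1 n) : x = y := Subtype.ext (funext h)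

@[simp] theorem length_initialWord (x : FreeBoundary A) (n : ℕ) : (x.initialWord n).length = n := by
  simp [initialWord]

@[simp] theorem initialWord_zero (x : FreeBoundary A) : x.initialWord 0 = [] := rfl

theorem initialWord_succ (x : FreeBoundary A) (n : ℕ) :
    x.initialWord (n + 1) = x.1 0 :: x.tail.initialWord n := by
  simp [initialWord, List.ofFn_succ, tail]

theorem initialWord_succ' (x : FreeBoundary A) (n : ℕ) :
    x.initialWord (n + 1) = x.initialWord n ++ [x.1 n] := by
  rw [initialWord, List.ofFn_succ_last]
  rfl

theorem getElem_initialWord (x : FreeBoundary A) {n i : ℕ} (h : i < (x.initialWord n).length) :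
    (x.initialWord n)[i] = x.1 i := by
  simp [initialWord]

theorem getElem?_initialWord (x : FreeBoundary A) {n i : ℕ} (h : i < n) :
    (x.initialWord n)[i]? = some (x.1 i) := by
  rw [List.getElem?_eq_getElem (by simpa using h), getElem_initialWord]

theorem take_initialWord (x : FreeBoundary A) {m n : ℕ} (h : m ≤ n) :
    (x.initialWord n).take m = x.initialWord m := by
  apply List.ext_getElem
  · simpa using h
  · intro i h1 h2
    simp [getElem_initialWord]

theorem isReduced_initialWord (x : FreeBoundary A) (n : ℕ) :
    FreeGroup.IsReduced (x.initialWord n) := by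
  rw [FreeGroup.IsReduced, List.isChain_iff_getElem]
  intro i hi
  rw [getElem_initialWord, getElem_initialWord, ← ne_flipLetter_iff]
  exact x.2 i

theorem toWord_mk_initialWord [DecidableEq A] (x : FreeBoundary A) (n : ℕ) :
    (FreeGroup.mk (x.initialWord n)).toWord = x.initialWord n :=
  FreeGroup.toWord_mk_of_isReduced (x.isReduced_initialWord n)

theorem norm_mk_initialWord [DecidableEq A] (x : FreeBoundary A) (n : ℕ) :
    (FreeGroup.mk (x.initialWord n)).norm = n := by
  rw [FreeGroup.norm, toWord_mk_initialWord, length_initialWord]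

/-- The infinite words that start with `w`. -/
def prefixSet (w : List (A × Bool)) : Set (FreeBoundary A) := {x | x.initialWord w.length = w}

theorem mem_prefixSet {w : List (A × Bool)} {x : FreeBoundary A} :
    x ∈ prefixSet w ↔ x.initialWord w.length = w := Iff.rfl

theorem mem_prefixSet_iff_getElem {w : List (A × Bool)} {x : FreeBoundary A} :
    x ∈ prefixSet w ↔ ∀ (i : ℕ) (h : i < w.length), w[i] = x.1 i := by
  rw [mem_prefixSet]
  constructor
  · intro h i hi
    rw [← x.getElem_initialWord (n := w.length) (by simpa using hi)]
    simp only [h]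
  · intro h
    apply List.ext_getElem
    · simp
    · intro i h1 h2
      rw [getElem_initialWord, h i h2]

theorem mem_prefixSet_initialWord (x : FreeBoundary A) (n : ℕ) :
    x ∈ prefixSet (x.initialWord n) := by
  simp [mem_prefixSet]

theorem mem_prefixSet_cons {d : A × Bool} {w : List (A × Bool)} {x : FreeBoundary A} :
    x ∈ prefixSet (d :: w) ↔ x.1 0 = d ∧ x.tail ∈ prefixSet w := by
  rw [mem_prefixSet, List.length_cons, initialWord_succ, List.cons.injEq]
  rfl

theorem mem_prefixSet_singleton {d : A × Bool} {x : FreeBoundary A} :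
    x ∈ prefixSet [d] ↔ x.1 0 = d := by
  rw [mem_prefixSet_cons]
  exact and_iff_left rfl

theorem mem_prefixSet_append {v w : List (A × Bool)} {x : FreeBoundary A}
    (h : x ∈ prefixSet (v ++ w)) : x ∈ prefixSet v := by
  rw [mem_prefixSet_iff_getElem] at *
  intro i hi
  rw [← h i (by simp; omega), List.getElem_append_left]

theorem mem_prefixSet_concat {v : List (A × Bool)} {d : A × Bool} {x : FreeBoundary A} :
    x ∈ prefixSet (v ++ [d]) ↔ x ∈ prefixSet v ∧ x.1 v.length = d := by
  rw [mem_prefixSet, mem_prefixSet, List.length_append, List.length_singleton, initialWord_succ',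
    List.append_eq_append_iff_of_size_eq_left (by simp)]
  simp

theorem isReduced_of_mem_prefixSet {w : List (A × Bool)} {x : FreeBoundary A}
    (h : x ∈ prefixSet w) : FreeGroup.IsReduced w := by
  rw [← mem_prefixSet.1 h]
  exact x.isReduced_initialWord _

theorem prefixSet_initialWord_eq {x : FreeBoundary A} {w : List (A × Bool)} {n : ℕ}
    (h : x ∈ prefixSet w) (hn : n ≤ w.length) : x.initialWord n = w.take n := by
  rw [← mem_prefixSet.1 h, take_initialWord _ hn]

theorem prefix_total_of_mem {x : FreeBoundary A} {v w : List (A × Bool)} (hv : x ∈ prefixSet v)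
    (hw : x ∈ prefixSet w) (hl : v.length ≤ w.length) : v <+: w := by
  rw [← mem_prefixSet.1 hv, prefixSet_initialWord_eq hw hl]
  exact List.take_prefix _ _

theorem mem_prefixSet_of_prefix {x : FreeBoundary A} {v w : List (A × Bool)} (hw : x ∈ prefixSet w)
    (h : v <+: w) : x ∈ prefixSet v := by
  obtain ⟨t, rfl⟩ := h
  exact mem_prefixSet_append hw

section Action

variable [DecidableEq A]

theorem mk_singleton_smul (d : A × Bool) (x : FreeBoundary A) :
    FreeGroup.mk [d] • x = mulLetter d x := by
  rcases d with ⟨a, b⟩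
  cases b
  · have : FreeGroup.mk [(a, false)] = (FreeGroup.of a)⁻¹ := rfl
    rw [this, inv_smul_eq_iff]
    change x = FreeGroup.lift generatorPerm (FreeGroup.of a) _
    rw [FreeGroup.lift_apply_of]
    exact (mulLetter_flip (a, false) x).symm
  · change FreeGroup.lift generatorPerm (FreeGroup.of a) _ = _
    rw [FreeGroup.lift_apply_of]
    rfl

theorem mulLetter_apply_zero {d : A × Bool} {x : FreeBoundary A} (h : x.1 0 ≠ flipLetter d) :
    (mulLetter d x).1 0 = d := by
  simp [mulLetter, h, cons]

theorem mulLetter_apply_succ {d : A × Bool} {x : FreeBoundary A} (h : x.1 0 ≠ flipLetter d)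
    (n : ℕ) : (mulLetter d x).1 (n + 1) = x.1 n := by
  simp [mulLetter, h, cons]

theorem mulLetter_of_eq {d : A × Bool} {x : FreeBoundary A} (h : x.1 0 = flipLetter d) :
    mulLetter d x = x.tail := by
  simp [mulLetter, h]

theorem tail_mulLetter {d : A × Bool} {x : FreeBoundary A} (h : x.1 0 ≠ flipLetter d) :
    (mulLetter d x).tail = x := FreeBoundary.ext fun n => mulLetter_apply_succ h n

theorem inv_mk_singleton_smul {d : A × Bool} {x : FreeBoundary A} (h : x.1 0 = d) :
    (FreeGroup.mk [d])⁻¹ • x = x.tail := by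
  rw [← FreeGroup.mk_flipLetter, mk_singleton_smul, mulLetter_of_eq]
  rw [h, flipLetter_flipLetter]

theorem inv_mk_smul_apply {w : List (A × Bool)} {x : FreeBoundary A} (h : x ∈ prefixSet w)
    (n : ℕ) : ((FreeGroup.mk w)⁻¹ • x).1 n = x.1 (n + w.length) := by
  induction w generalizing x with
  | nil => rw [← FreeGroup.one_eq_mk, inv_one, one_smul]; rfl
  | cons d w ih =>
    rw [mem_prefixSet_cons] at h
    rw [FreeGroup.mk_cons, mul_inv_rev, mul_smul, inv_mk_singleton_smul h.1, ih h.2]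
    rfl

theorem mk_smul_mem_prefixSet {w : List (A × Bool)} (hw : FreeGroup.IsReduced w) (hne : w ≠ [])
    {x : FreeBoundary A} (h : x.1 0 ≠ flipLetter (w.getLast hne)) :
    FreeGroup.mk w • x ∈ prefixSet w := by
  induction w with
  | nil => exact absurd rfl hne
  | cons d w ih =>
    rw [FreeGroup.mk_cons, mul_smul, mk_singleton_smul, mem_prefixSet_cons]
    cases w with
    | nil =>
      rw [← FreeGroup.one_eq_mk, one_smul]
      exact ⟨mulLetter_apply_zero h, rfl⟩
    | cons d' w =>
      rw [isReduced_cons_cons_iff] at hw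
      have h1 := ih hw.2 (by simp) (by simpa using h)
      have h2 : (FreeGroup.mk (d' :: w) • x).1 0 ≠ flipLetter d := by
        rw [(mem_prefixSet_cons.1 h1).1]
        exact hw.1
      exact ⟨mulLetter_apply_zero h2, by rwa [tail_mulLetter h2]⟩

/-- An infinite word starts with `w` iff `w⁻¹` cancels completely against it. -/
theorem mem_prefixSet_iff {w : List (A × Bool)} (hw : FreeGroup.IsReduced w) (hne : w ≠ [])
    {x : FreeBoundary A} :
    x ∈ prefixSet w ↔ ((FreeGroup.mk w)⁻¹ • x).1 0 ≠ flipLetter (w.getLast hne) := by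
  constructor
  · intro h
    rw [inv_mk_smul_apply h, zero_add]
    have hl : 0 < w.length := List.length_pos_iff.2 hne
    have h1 := x.2 (w.length - 1)
    rw [Nat.sub_add_cancel hl] at h1
    rwa [List.getLast_eq_getElem, mem_prefixSet_iff_getElem.1 h]
  · intro h
    have := mk_smul_mem_prefixSet hw hne h
    rwa [smul_inv_smul] at this

end Action

end FreeBoundary

/-! ### Topology of the boundary -/

namespace FreeBoundary

variable {A : Type*}

theorem isOpen_setOf_apply_eq (n : ℕ) (d : A × Bool) :
    IsOpen {x : FreeBoundary A | x.1 n = d} := by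
  let _ : TopologicalSpace (A × Bool) := ⊥
  have : DiscreteTopology (A × Bool) := ⟨rfl⟩
  have h1 : Continuous fun x : FreeBoundary A => x.1 := continuous_induced_dom
  have h2 : Continuous fun x : FreeBoundary A => x.1 n := (continuous_apply n).comp h1
  exact (isOpen_discrete {d}).preimage h2

theorem isOpen_prefixSet (w : List (A × Bool)) : IsOpen (prefixSet w) := by
  have : prefixSet w = ⋂ i : Fin w.length, {x : FreeBoundary A | x.1 i = w[i]} := by
    ext x
    rw [mem_prefixSet_iff_getElem, Set.mem_iInter]
    exact ⟨fun h i => (h i i.2).symm, fun h i hi => (h ⟨i, hi⟩).symm⟩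
  rw [this]
  exact isOpen_iInter_of_finite fun i => isOpen_setOf_apply_eq _ _

theorem exists_prefixSet_subset {U : Set (FreeBoundary A)} (hU : IsOpen U) {x : FreeBoundary A}
    (hx : x ∈ U) : ∃ n, prefixSet (x.initialWord n) ⊆ U := by
  let _ : TopologicalSpace (A × Bool) := ⊥
  obtain ⟨W, hW, rfl⟩ := isOpen_induced_iff.1 hU
  obtain ⟨I, u, h1, h2⟩ := isOpen_pi_iff.1 hW x.1 hx
  refine ⟨I.sup id + 1, fun y hy => h2 fun i hi => ?_⟩
  have hlt : i < I.sup id + 1 := Nat.lt_succ_of_le (Finset.le_sup (f := id) hi)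
  have := mem_prefixSet_iff_getElem.1 hy i (by simpa using hlt)
  rw [getElem_initialWord] at this
  have h3 := (h1 i hi).2
  rw [this] at h3
  exact h3

/-- Reducedness constrains only neighbouring letters, so the reduced words are closed in a product
of finite discrete spaces. -/
instance [Finite A] : CompactSpace (FreeBoundary A) := by
  let _ : TopologicalSpace (A × Bool) := ⊥
  have : DiscreteTopology (A × Bool) := ⟨rfl⟩
  have hind : IsInducing fun x : FreeBoundary A => x.1 := ⟨rfl⟩
  have hr : Set.range (fun x : FreeBoundary A => x.1) =
      ⋂ n, {s : ℕ → A × Bool | s (n + 1) ≠ flipLetter (s n)} := by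
    ext s
    simp only [Set.mem_range, Set.mem_iInter]
    exact ⟨fun ⟨x, hx⟩ n => hx ▸ x.2 n, fun h => ⟨⟨s, h⟩, rfl⟩⟩
  have hcl : IsClosed (Set.range fun x : FreeBoundary A => x.1) := by
    rw [hr]
    refine isClosed_iInter fun n => ?_
    have hc : Continuous fun s : ℕ → A × Bool => (s n, s (n + 1)) :=
      (continuous_apply n).prodMk (continuous_apply (n + 1))
    exact (isClosed_discrete {p : (A × Bool) × (A × Bool) | p.2 ≠ flipLetter p.1}).preimage hc
  exact (IsClosedEmbedding.mk ⟨hind, fun x y h => Subtype.ext h⟩ hcl).compactSpace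

instance : T2Space (FreeBoundary A) := by
  refine ⟨fun x y hxy => ?_⟩
  have : ∃ n, x.1 n ≠ y.1 n := by
    by_contra h
    push Not at h
    exact hxy (FreeBoundary.ext h)
  obtain ⟨n, hn⟩ := this
  refine ⟨_, _, isOpen_setOf_apply_eq n (x.1 n), isOpen_setOf_apply_eq n (y.1 n), rfl, rfl, ?_⟩
  rw [Set.disjoint_left]
  intro z hz hz'
  exact hn (hz.symm.trans hz')

instance [Countable A] : SecondCountableTopology (FreeBoundary A) := by
  let _ : TopologicalSpace (A × Bool) := ⊥
  have : DiscreteTopology (A × Bool) := ⟨rfl⟩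
  have hind : IsInducing fun x : FreeBoundary A => x.1 := ⟨rfl⟩
  exact hind.secondCountableTopology

theorem isClosed_prefixSet (w : List (A × Bool)) : IsClosed (prefixSet w) := by
  rw [← isOpen_compl_iff, isOpen_iff_forall_mem_open]
  intro x hx
  refine ⟨prefixSet (x.initialWord w.length), fun y hy hyw => hx ?_, isOpen_prefixSet _,
    mem_prefixSet_initialWord _ _⟩
  have h1 : y.initialWord w.length = w := hyw
  have h2 : y.initialWord w.length = x.initialWord w.length := by
    have := mem_prefixSet.1 hy
    rwa [length_initialWord] at this
  exact h2.symm.trans h1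

theorem continuous_of_initialWord {X : Type*} [TopologicalSpace X] {g : X → FreeBoundary A}
    (h : ∀ x n, ∃ U, IsOpen U ∧ x ∈ U ∧ ∀ y ∈ U, (g y).initialWord n = (g x).initialWord n) :
    Continuous g := by
  rw [continuous_iff_continuousAt]
  intro x U hU
  obtain ⟨W, hWU, hW, hx⟩ := mem_nhds_iff.1 hU
  obtain ⟨n, hn⟩ := exists_prefixSet_subset hW hx
  obtain ⟨O, hO, hxO, hOn⟩ := h x n
  refine mem_map.2 (mem_of_superset (hO.mem_nhds hxO) fun y hy => hWU (hn ?_))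
  rw [mem_prefixSet, length_initialWord]
  exact hOn y hy

theorem continuous_mulLetter [DecidableEq A] (d : A × Bool) :
    Continuous (mulLetter d : FreeBoundary A → FreeBoundary A) := by
  refine continuous_of_initialWord fun x n => ⟨_, isOpen_prefixSet (x.initialWord (n + 1)),
    mem_prefixSet_initialWord _ _, fun y hy => ?_⟩
  have hy' : ∀ i < n + 1, y.1 i = x.1 i := by
    intro i hi
    have := mem_prefixSet_iff_getElem.1 hy i (by simpa using hi)
    rw [getElem_initialWord] at this
    exact this.symm
  have h0 := hy' 0 (Nat.succ_pos n)
  apply List.ext_getElem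
  · simp
  · intro i h1 h2
    rw [length_initialWord] at h1
    rw [getElem_initialWord, getElem_initialWord]
    by_cases hx : x.1 0 = flipLetter d
    · rw [mulLetter_of_eq hx, mulLetter_of_eq (h0.trans hx)]
      exact hy' (i + 1) (by omega)
    · have hyd : y.1 0 ≠ flipLetter d := h0 ▸ hx
      cases i with
      | zero => rw [mulLetter_apply_zero hx, mulLetter_apply_zero hyd]
      | succ i =>
        rw [mulLetter_apply_succ hx, mulLetter_apply_succ hyd]
        exact hy' i (by omega)

theorem continuous_smul [DecidableEq A] (g : FreeGroup A) :
    Continuous fun x : FreeBoundary A => g • x := by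
  rw [← FreeGroup.mk_toWord (x := g)]
  induction g.toWord with
  | nil =>
    simp only [← FreeGroup.one_eq_mk, one_smul]
    exact continuous_id
  | cons d w ih =>
    have : (fun x : FreeBoundary A => FreeGroup.mk (d :: w) • x) =
        mulLetter d ∘ fun x => FreeGroup.mk w • x := by
      funext x
      rw [FreeGroup.mk_cons, mul_smul, mk_singleton_smul]
      rfl
    rw [this]
    exact (continuous_mulLetter d).comp ih

end FreeBoundary

/-! ## Convergence to boundary points -/

section Convergence

variable {A : Type*}

theorem prefix_iff_take_eq {x : FreeBoundary A} {k : ℕ} {w : List (A × Bool)} :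
    x.initialWord k <+: w ↔ w.take k = x.initialWord k := by
  rw [List.prefix_iff_eq_take, FreeBoundary.length_initialWord, eq_comm]

variable [DecidableEq A]

theorem ConvergesTo.unique {ι : Type*} {l : Filter ι} [NeBot l] {g : ι → FreeGroup A}
    {x y : FreeBoundary A} (hx : ConvergesTo g l x) (hy : ConvergesTo g l y) : x = y := by
  refine FreeBoundary.ext fun n => ?_
  obtain ⟨i, h1, h2⟩ := ((hx (n + 1)).and (hy (n + 1))).exists
  rw [prefix_iff_take_eq] at h1 h2
  have h3 := h1.symm.trans h2
  have h4 := x.getElem?_initialWord (Nat.lt_succ_self n)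
  rw [h3, y.getElem?_initialWord (Nat.lt_succ_self n)] at h4
  exact (Option.some.inj h4).symm

theorem convergesTo_initialWord (x : FreeBoundary A) :
    ConvergesTo (fun n => FreeGroup.mk (x.initialWord n)) atTop x := by
  intro k
  filter_upwards [eventually_ge_atTop k] with n hn
  rw [x.toWord_mk_initialWord, prefix_iff_take_eq, x.take_initialWord hn]

theorem ConvergesTo.comp {ι κ : Type*} {l : Filter ι} {l' : Filter κ} {g : ι → FreeGroup A}
    {x : FreeBoundary A} (h : ConvergesTo g l x) {u : κ → ι} (hu : Tendsto u l' l) :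
    ConvergesTo (g ∘ u) l' x := fun k => hu.eventually (h k)

theorem ConvergesTo.mk_singleton_mul {ι : Type*} {l : Filter ι} {g : ι → FreeGroup A}
    {x : FreeBoundary A} (h : ConvergesTo g l x) (d : A × Bool) :
    ConvergesTo (fun i => FreeGroup.mk [d] * g i) l (FreeBoundary.mulLetter d x) := by
  intro k
  filter_upwards [h (k + 1)] with i hi
  obtain ⟨t, ht⟩ := hi
  rw [FreeBoundary.initialWord_succ, List.cons_append] at ht
  have hred : FreeGroup.IsReduced (g i).toWord := FreeGroup.isReduced_toWord
  have hg : g i = FreeGroup.mk (x.1 0 :: (x.tail.initialWord k ++ t)) := by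
    rw [ht, FreeGroup.mk_toWord]
  rw [← ht] at hred
  by_cases hx : x.1 0 = flipLetter d
  · have : FreeGroup.mk [d] * g i = FreeGroup.mk (x.tail.initialWord k ++ t) := by
      rw [hg, hx, FreeGroup.mk_cons (flipLetter d), FreeGroup.mk_flipLetter, mul_inv_cancel_left]
    rw [this, FreeBoundary.mulLetter_of_eq hx, FreeGroup.toWord_mk_of_isReduced
      (hred.infix (List.suffix_cons _ _).isInfix)]
    exact List.prefix_append _ _
  · have : FreeGroup.mk [d] * g i =
        FreeGroup.mk (d :: x.1 0 :: (x.tail.initialWord k ++ t)) := by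
      rw [hg, FreeGroup.mk_cons d (x.1 0 :: _)]
    rw [this, FreeGroup.toWord_mk_of_isReduced (isReduced_cons_cons_iff.2 ⟨hx, hred⟩)]
    cases k with
    | zero => exact List.nil_prefix
    | succ k =>
      rw [FreeBoundary.initialWord_succ, FreeBoundary.mulLetter_apply_zero hx,
        FreeBoundary.tail_mulLetter hx, List.cons_prefix_cons]
      refine ⟨rfl, ?_⟩
      have e : x.1 0 :: (x.tail.initialWord (k + 1) ++ t) = x.initialWord (k + 2) ++ t := by
        rw [FreeBoundary.initialWord_succ x (k + 1)]; rfl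
      rw [e]
      refine List.IsPrefix.trans ?_ (List.prefix_append _ _)
      rw [prefix_iff_take_eq, x.take_initialWord (by omega)]

theorem ConvergesTo.smul {ι : Type*} {l : Filter ι} {g : ι → FreeGroup A}
    {x : FreeBoundary A} (h : ConvergesTo g l x) (c : FreeGroup A) :
    ConvergesTo (fun i => c * g i) l (c • x) := by
  rw [← FreeGroup.mk_toWord (x := c)]
  induction c.toWord with
  | nil => simpa [← FreeGroup.one_eq_mk] using h
  | cons d w ih =>
    have := ih.mk_singleton_mul d
    rw [FreeGroup.mk_cons, mul_smul, FreeBoundary.mk_singleton_smul]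
    simpa only [mul_assoc] using this

theorem ConvergesTo.of_norm_le {ι : Type*} {l : Filter ι} {g h : ι → FreeGroup A}
    {x : FreeBoundary A} (hg : ConvergesTo g l x) {K : ℕ}
    (hK : ∀ᶠ i in l, ((g i)⁻¹ * h i).norm ≤ K) : ConvergesTo h l x := by
  intro k
  filter_upwards [hg (k + K), hK] with i h1 h2
  have h3 : k + K ≤ (g i).norm := by
    have := h1.length_le
    rwa [FreeBoundary.length_initialWord] at this
  rw [prefix_iff_take_eq, FreeGroup.take_toWord_eq h2 h3]
  rw [prefix_iff_take_eq] at h1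
  rw [← x.take_initialWord (Nat.le_add_right k K), ← h1, List.take_take, min_eq_left (by omega)]

/-- A sequence whose words have eventually constant prefixes converges. -/
theorem exists_convergesTo {g : ℕ → FreeGroup A}
    (h : ∀ k, ∃ w : List (A × Bool), w.length = k ∧ ∀ᶠ n in atTop, (g n).toWord.take k = w) :
    ∃ x, ConvergesTo g atTop x := by
  choose w hwl hw using h
  have hcomp : ∀ j k, j ≤ k → (w k).take j = w j := by
    intro j k hjk
    obtain ⟨n, h1, h2⟩ := ((hw j).and (hw k)).exists
    rw [← h1, ← h2, List.take_take, min_eq_left hjk]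
  have hlt : ∀ k, k < (w (k + 1)).length := fun k => by rw [hwl]; omega
  have hget : ∀ i k, (h : i < (w k).length) → (w k)[i] = (w (i + 1))[i]'(hlt i) := by
    intro i k h
    rw [hwl] at h
    have := hcomp (i + 1) k h
    simp only [← this]
    rw [List.getElem_take]
  have hred : ∀ k, FreeGroup.IsReduced (w k) := by
    intro k
    obtain ⟨n, hn⟩ := (hw k).exists
    rw [← hn]
    exact FreeGroup.isReduced_toWord.infix (List.take_prefix _ _).isInfix
  let x : FreeBoundary A := ⟨fun k => (w (k + 1))[k]'(hlt k), fun k => by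
    have h1 := List.isChain_iff_getElem.1 (hred (k + 2)) k (by rw [hwl]; omega)
    rw [← ne_flipLetter_iff] at h1
    rw [hget k (k + 2) (by rw [hwl]; omega)] at h1
    exact h1⟩
  have hx : ∀ k, x.initialWord k = w k := by
    intro k
    apply List.ext_getElem
    · simp [hwl]
    · intro i h1 h2
      rw [FreeBoundary.getElem_initialWord, hget i k h2]
  refine ⟨x, fun k => ?_⟩
  filter_upwards [hw k] with n hn
  rw [prefix_iff_take_eq, hn, hx]

end Convergence

/-! ## The boundary map of an injective homomorphism -/

section BoundaryMap

variable {A B : Type*} [DecidableEq B]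

theorem exists_norm_map_letter_le [Finite A] (h : FreeGroup A →* FreeGroup B) :
    ∃ K : ℕ, ∀ d : A × Bool, (h (FreeGroup.mk [d])).norm ≤ K := by
  obtain ⟨K, hK⟩ := (Set.finite_range fun d : A × Bool => (h (FreeGroup.mk [d])).norm).bddAbove
  exact ⟨K, fun d => hK ⟨d, rfl⟩⟩

variable [DecidableEq A] {h : FreeGroup A →* FreeGroup B}

/-- Balls in a finitely generated free group are finite, so an injective homomorphism pulls them
back to finite sets. -/
theorem exists_norm_le_of_map [Finite B] (hi : Function.Injective h) (R : ℕ) :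
    ∃ n : ℕ, ∀ g, (h g).norm ≤ R → g.norm ≤ n := by
  have hf : {g | (h g).norm ≤ R}.Finite :=
    (FreeGroup.finite_norm_le (A := B) R).preimage hi.injOn
  obtain ⟨n, hn⟩ := (hf.image FreeGroup.norm).bddAbove
  exact ⟨n, fun g hg => hn ⟨g, hg, rfl⟩⟩

/-- Once the image of a prefix has norm at least `k + K`, a further letter multiplies it by an
element of norm at most `K` and cannot touch the first `k` letters. Properness makes the threshold
the same for all reduced words. -/
theorem exists_take_map_eq [Finite A] [Finite B] (hi : Function.Injective h) (k : ℕ) :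
    ∃ n₀, ∀ (w : List (A × Bool)), FreeGroup.IsReduced w → ∀ n, n₀ ≤ n → n ≤ w.length →
      (h (FreeGroup.mk w)).toWord.take k = (h (FreeGroup.mk (w.take n))).toWord.take k ∧
        k ≤ (h (FreeGroup.mk w)).norm := by
  obtain ⟨K, hK⟩ := exists_norm_map_letter_le h
  obtain ⟨n₁, hn₁⟩ := exists_norm_le_of_map hi (k + K)
  have hbig : ∀ w : List (A × Bool), FreeGroup.IsReduced w → n₁ < w.length →
      k + K ≤ (h (FreeGroup.mk w)).norm := by
    intro w hw hl
    by_contra hlt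
    have := hn₁ _ (not_le.1 hlt).le
    rw [FreeGroup.norm, FreeGroup.toWord_mk_of_isReduced hw] at this
    omega
  refine ⟨n₁ + 1, fun w hw n hn hnw => ⟨?_, (Nat.le_add_right k K).trans (hbig w hw (by omega))⟩⟩
  have key : ∀ m, n + m ≤ w.length → (h (FreeGroup.mk (w.take (n + m)))).toWord.take k =
      (h (FreeGroup.mk (w.take n))).toWord.take k := by
    intro m
    induction m with
    | zero => intro _; rfl
    | succ m ih =>
      intro hm
      rw [← ih (by omega)]
      have hred : FreeGroup.IsReduced (w.take (n + m)) := hw.infix (List.take_prefix _ _).isInfix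
      have hlen : n₁ < (w.take (n + m)).length := by rw [List.length_take]; omega
      refine FreeGroup.take_toWord_eq (K := K) ?_ (hbig _ hred hlen)
      have hm' : n + m < w.length := by omega
      rw [← add_assoc, List.take_succ_eq_append_getElem hm', ← FreeGroup.mul_mk, map_mul,
        inv_mul_cancel_left]
      exact hK _
  have := key (w.length - n) (by omega)
  rwa [Nat.add_sub_cancel' hnw, List.take_length] at this

theorem FreeGroup.norm_map_le {K : ℕ} (hK : ∀ d : A × Bool, (h (FreeGroup.mk [d])).norm ≤ K)
    (g : FreeGroup A) : (h g).norm ≤ K * g.norm := by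
  have key : ∀ w : List (A × Bool), (h (FreeGroup.mk w)).norm ≤ K * w.length := by
    intro w
    induction w with
    | nil => rw [← FreeGroup.one_eq_mk, _root_.map_one, FreeGroup.norm_one]; exact Nat.zero_le _
    | cons d w ih =>
      rw [FreeGroup.mk_cons, _root_.map_mul, List.length_cons, Nat.mul_succ]
      exact (FreeGroup.norm_mul_le _ _).trans (by have := hK d; omega)
  have := key g.toWord
  rwa [FreeGroup.mk_toWord] at this

/-- The map of boundaries that is induced by an injective homomorphism. -/
theorem exists_boundaryMap [Finite A] [Finite B] (hi : Function.Injective h) :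
    ∃ D : FreeBoundary A → FreeBoundary B, Continuous D ∧ Function.Injective D ∧
      (∀ (g : ℕ → FreeGroup A) (x : FreeBoundary A), ConvergesTo g atTop x →
        ConvergesTo (fun n => h (g n)) atTop (D x)) ∧
      ∀ y : FreeBoundary B, (∃ R : ℕ, ∀ k, ∃ g,
        ((h g)⁻¹ * FreeGroup.mk (y.initialWord k)).norm ≤ R) → ∃ x, D x = y := by
  obtain ⟨K, hK⟩ := exists_norm_map_letter_le h
  choose n₀ hn₀ using exists_take_map_eq hi
  have hstab : ∀ (x : FreeBoundary A) k n, n₀ k ≤ n →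
      (h (FreeGroup.mk (x.initialWord n))).toWord.take k =
        (h (FreeGroup.mk (x.initialWord (n₀ k)))).toWord.take k := by
    intro x k n hn
    have := (hn₀ k (x.initialWord n) (x.isReduced_initialWord n) (n₀ k) le_rfl (by simpa)).1
    rwa [x.take_initialWord hn] at this
  have hlim : ∀ x : FreeBoundary A, ∃ y, ConvergesTo (fun n => h (FreeGroup.mk (x.initialWord n)))
      atTop y := by
    intro x
    refine exists_convergesTo fun k =>
      ⟨(h (FreeGroup.mk (x.initialWord (n₀ k)))).toWord.take k, ?_, ?_⟩
    · rw [List.length_take, min_eq_left]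
      exact (hn₀ k (x.initialWord (n₀ k)) (x.isReduced_initialWord _) (n₀ k) le_rfl (by simp)).2
    · filter_upwards [eventually_ge_atTop (n₀ k)] with n hn
      exact hstab x k n hn
  choose D hD using hlim
  have hDk : ∀ x k n, n₀ k ≤ n →
      (h (FreeGroup.mk (x.initialWord n))).toWord.take k = (D x).initialWord k := by
    intro x k n hn
    obtain ⟨m, h1, h2⟩ := ((hD x k).and (eventually_ge_atTop (n₀ k))).exists
    rw [prefix_iff_take_eq] at h1
    rw [hstab x k n hn, ← hstab x k m h2, h1]
  have hconv : ∀ (g : ℕ → FreeGroup A) (x : FreeBoundary A), ConvergesTo g atTop x →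
      ConvergesTo (fun n => h (g n)) atTop (D x) := by
    intro g x hg k
    filter_upwards [hg (n₀ k)] with n hn
    have hlen : n₀ k ≤ (g n).toWord.length := by simpa using hn.length_le
    have := (hn₀ k (g n).toWord FreeGroup.isReduced_toWord (n₀ k) le_rfl hlen).1
    rw [FreeGroup.mk_toWord, prefix_iff_take_eq.1 hn, hDk x k _ le_rfl] at this
    rwa [prefix_iff_take_eq]
  -- The images of the prefixes of `x` pass within `K` of every point of the ray `D x`: at the first
  -- `n` where the image starts with the first `k` letters of the ray, it cannot exceed them by more
  -- than `K`.
  have hnear : ∀ x k, ∃ n, k ≤ K * n ∧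
      ((FreeGroup.mk ((D x).initialWord k))⁻¹ * h (FreeGroup.mk (x.initialWord n))).norm ≤ K := by
    intro x k
    have hex : ∃ n, (D x).initialWord k <+: (h (FreeGroup.mk (x.initialWord n))).toWord :=
      (hD x k).exists
    classical
    let n := Nat.find hex
    have hn : (D x).initialWord k <+: (h (FreeGroup.mk (x.initialWord n))).toWord :=
      Nat.find_spec hex
    have hkn : k ≤ (h (FreeGroup.mk (x.initialWord n))).norm := by
      have := hn.length_le
      rwa [FreeBoundary.length_initialWord] at this
    refine ⟨n, ?_, ?_⟩
    · refine hkn.trans ((FreeGroup.norm_map_le hK _).trans ?_)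
      rw [x.norm_mk_initialWord]
    · have hle : (h (FreeGroup.mk (x.initialWord n))).norm ≤ k + K := by
        by_contra hlt
        cases hn0 : n with
        | zero =>
          rw [hn0, x.initialWord_zero, ← FreeGroup.one_eq_mk, map_one, FreeGroup.norm_one] at hlt
          omega
        | succ m =>
          rw [hn0] at hlt hn
          have hmin : ¬ (D x).initialWord k <+: (h (FreeGroup.mk (x.initialWord m))).toWord :=
            Nat.find_min hex (show m < n by omega)
          refine hmin ?_
          rw [prefix_iff_take_eq] at hn ⊢
          rw [← hn]
          refine FreeGroup.take_toWord_eq (K := K) ?_ (by omega)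
          rw [x.initialWord_succ', ← FreeGroup.mul_mk, map_mul, mul_inv_rev, inv_mul_cancel_right,
            FreeGroup.norm_inv_eq]
          exact hK _
      obtain ⟨t, ht⟩ := hn
      have h1 : (FreeGroup.mk ((D x).initialWord k))⁻¹ * h (FreeGroup.mk (x.initialWord n)) =
          FreeGroup.mk t := by
        rw [inv_mul_eq_iff_eq_mul, FreeGroup.mul_mk, ht, FreeGroup.mk_toWord]
      have h2 := congrArg List.length ht
      rw [List.length_append, FreeBoundary.length_initialWord] at h2
      rw [h1]
      refine FreeGroup.norm_mk_le.trans ?_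
      rw [FreeGroup.norm] at hle
      omega
  refine ⟨D, ?_, ?_, hconv, ?_⟩
  · refine FreeBoundary.continuous_of_initialWord fun x k =>
      ⟨_, FreeBoundary.isOpen_prefixSet (x.initialWord (n₀ k)),
        FreeBoundary.mem_prefixSet_initialWord _ _, fun y hy => ?_⟩
    rw [FreeBoundary.mem_prefixSet, FreeBoundary.length_initialWord] at hy
    rw [← hDk y k _ le_rfl, hy, hDk x k _ le_rfl]
  · intro x y hxy
    refine FreeBoundary.ext fun p => ?_
    obtain ⟨R, hR⟩ := exists_norm_le_of_map hi (K + K)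
    -- At this depth both `n` and `m` are at least `p + 1 + R`, so prefixes at distance at most `R`
    -- agree in the letter at position `p`.
    obtain ⟨n, hkn, hn⟩ := hnear x (K * (p + 1 + R) + 1)
    obtain ⟨m, hkm, hm⟩ := hnear y (K * (p + 1 + R) + 1)
    rw [hxy] at hn
    have hn' : p + 1 + R ≤ n := by
      by_contra hlt
      have := Nat.mul_le_mul_left K (not_le.1 hlt).le
      omega
    have hm' : p + 1 + R ≤ m := by
      by_contra hlt
      have := Nat.mul_le_mul_left K (not_le.1 hlt).le
      omega
    have hdist :
        ((FreeGroup.mk (x.initialWord n))⁻¹ * FreeGroup.mk (y.initialWord m)).norm ≤ R := by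
      apply hR
      rw [map_mul, map_inv]
      set c := FreeGroup.mk ((D y).initialWord (K * (p + 1 + R) + 1))
      have e : (h (FreeGroup.mk (x.initialWord n)))⁻¹ * h (FreeGroup.mk (y.initialWord m)) =
          (c⁻¹ * h (FreeGroup.mk (x.initialWord n)))⁻¹ *
            (c⁻¹ * h (FreeGroup.mk (y.initialWord m))) := by group
      rw [e]
      refine (FreeGroup.norm_mul_le _ _).trans ?_
      rw [FreeGroup.norm_inv_eq]
      omega
    have htake := FreeGroup.take_toWord_eq (k := p + 1) hdist
      (by rw [x.norm_mk_initialWord]; exact hn')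
    rw [x.toWord_mk_initialWord, y.toWord_mk_initialWord, x.take_initialWord (by omega),
      y.take_initialWord (by omega)] at htake
    have h1 := x.getElem?_initialWord (Nat.lt_succ_self p)
    rw [← htake, y.getElem?_initialWord (Nat.lt_succ_self p)] at h1
    exact (Option.some.inj h1).symm
  · rintro y ⟨R, hR⟩
    choose g hg using hR
    obtain ⟨R', hR'⟩ := exists_norm_le_of_map hi (2 * R + 1)
    -- The images of consecutive `g k` follow the ray and are close together, hence by properness so
    -- are the `g k`. As their norms tend to infinity, they converge.
    have hstep : ∀ k, ((g k)⁻¹ * g (k + 1)).norm ≤ R' := by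
      intro k
      apply hR'
      rw [map_mul, map_inv]
      have e : (h (g k))⁻¹ * h (g (k + 1)) = ((h (g k))⁻¹ * FreeGroup.mk (y.initialWord k)) *
          (FreeGroup.mk [y.1 k] *
            ((h (g (k + 1)))⁻¹ * FreeGroup.mk (y.initialWord (k + 1)))⁻¹) := by
        rw [y.initialWord_succ', ← FreeGroup.mul_mk]
        group
      rw [e]
      refine (FreeGroup.norm_mul_le _ _).trans
        ((add_le_add_right (FreeGroup.norm_mul_le _ _) _).trans ?_)
      rw [FreeGroup.norm_inv_eq]
      have h1 := hg k
      have h2 := hg (k + 1)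
      have h3 : (FreeGroup.mk [y.1 k]).norm ≤ 1 := FreeGroup.norm_mk_le
      omega
    have hbig : ∀ M, ∃ k₀, ∀ k, k₀ ≤ k → M ≤ (g k).norm := by
      intro M
      refine ⟨K * M + R + 1, fun k hk => ?_⟩
      by_contra hlt
      have h1 := FreeGroup.norm_map_le hK (g k)
      have h2 := Nat.mul_le_mul_left K (not_le.1 hlt).le
      have h3 := FreeGroup.norm_le_norm_add (FreeGroup.mk (y.initialWord k)) (h (g k))
      have h4 := hg k
      rw [← FreeGroup.norm_inv_eq, mul_inv_rev, inv_inv] at h4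
      rw [y.norm_mk_initialWord] at h3
      omega
    obtain ⟨x, hx⟩ : ∃ x, ConvergesTo g atTop x := by
      refine exists_convergesTo fun k => ?_
      obtain ⟨k₀, hk₀⟩ := hbig (k + R')
      refine ⟨(g k₀).toWord.take k, ?_, ?_⟩
      · rw [List.length_take, min_eq_left]
        exact (Nat.le_add_right k R').trans (hk₀ k₀ le_rfl)
      · filter_upwards [eventually_ge_atTop k₀] with n hn
        induction n, hn using Nat.le_induction with
        | base => rfl
        | succ n hn ih => rw [FreeGroup.take_toWord_eq (hstep n) (hk₀ n hn), ih]
    refine ⟨x, (hconv g x hx).unique ?_⟩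
    refine (convergesTo_initialWord y).of_norm_le (K := R) (Eventually.of_forall fun k => ?_)
    rw [← FreeGroup.norm_inv_eq, mul_inv_rev, inv_inv]
    exact hg k

end BoundaryMap

/-! ## Rays and geodesics of a marked graph -/

namespace EdgeGraph

variable {V E : Type*} {Γ : EdgeGraph V E}

theorem IsPath.of_red {x y : V} {v w : List (E × Bool)} (h : FreeGroup.Red v w)
    (hv : Γ.IsPath x v y) : Γ.IsPath x w y := by
  induction h with
  | refl => exact hv
  | tail _ hs ih =>
    cases hs with
    | @not L₁ L₂ a b =>
      obtain ⟨z, h1, h2, h3, h4⟩ := isPath_append_iff.1 ih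
      refine isPath_append_iff.2 ⟨z, h1, ?_⟩
      have : Γ.term (a, !b) = Γ.init (a, b) := term_flipLetter (Γ := Γ) (a, b)
      rwa [this, h2] at h4

theorem IsPathClass.isPath_toWord [DecidableEq E] {x y : V} {c : FreeGroup E}
    (h : Γ.IsPathClass x c y) : Γ.IsPath x c.toWord y := by
  obtain ⟨w, hw, rfl⟩ := h
  rw [FreeGroup.toWord_mk]
  exact hw.of_red FreeGroup.reduce.red

/-- An infinite reduced word is the edge-word of an infinite path starting at `x`. -/
def IsRay (Γ : EdgeGraph V E) (x : V) (ξ : FreeBoundary E) : Prop :=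
  Γ.init (ξ.1 0) = x ∧ ∀ n, Γ.term (ξ.1 n) = Γ.init (ξ.1 (n + 1))

theorem IsRay.isPath {x : V} {ξ : FreeBoundary E} (h : Γ.IsRay x ξ) (n : ℕ) :
    Γ.IsPath x (ξ.initialWord n) (Γ.init (ξ.1 n)) := by
  induction n with
  | zero => exact h.1.symm
  | succ n ih =>
    rw [FreeBoundary.initialWord_succ']
    exact isPath_append_iff.2 ⟨_, ih, rfl, h.2 n⟩

theorem isRay_of_forall_isPath {x : V} {ξ : FreeBoundary E}
    (h : ∀ n, ∃ y, Γ.IsPath x (ξ.initialWord n) y) : Γ.IsRay x ξ := by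
  constructor
  · obtain ⟨y, hy⟩ := h 1
    exact hy.1
  · intro n
    obtain ⟨y, hy⟩ := h (n + 2)
    rw [FreeBoundary.initialWord_succ', FreeBoundary.initialWord_succ', List.append_assoc,
      isPath_append_iff] at hy
    obtain ⟨z, -, h1, h2, -⟩ := hy
    exact h2.symm

theorem IsRay.isPath_of_mem {x : V} {ξ : FreeBoundary E} (h : Γ.IsRay x ξ)
    {w : List (E × Bool)} (hw : ξ ∈ FreeBoundary.prefixSet w) :
    Γ.IsPath x w (Γ.init (ξ.1 w.length)) := by
  have := h.isPath w.length
  rwa [FreeBoundary.mem_prefixSet.1 hw] at this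

theorem IsRay.mk_singleton_smul [DecidableEq E] {ξ : FreeBoundary E} {d : E × Bool}
    (h : Γ.IsRay (Γ.term d) ξ) : Γ.IsRay (Γ.init d) (FreeGroup.mk [d] • ξ) := by
  rw [FreeBoundary.mk_singleton_smul]
  by_cases hd : ξ.1 0 = flipLetter d
  · rw [FreeBoundary.mulLetter_of_eq hd]
    refine ⟨?_, fun n => h.2 (n + 1)⟩
    have := h.2 0
    rw [hd, term_flipLetter] at this
    exact this.symm
  · refine ⟨by rw [FreeBoundary.mulLetter_apply_zero hd], fun n => ?_⟩
    rw [FreeBoundary.mulLetter_apply_succ hd]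
    cases n with
    | zero => rw [FreeBoundary.mulLetter_apply_zero hd, h.1]
    | succ n => rw [FreeBoundary.mulLetter_apply_succ hd]; exact h.2 n

theorem IsRay.smul [DecidableEq E] {x y : V} {ξ : FreeBoundary E} {c : FreeGroup E}
    (hc : Γ.IsPathClass x c y) (h : Γ.IsRay y ξ) : Γ.IsRay x (c • ξ) := by
  obtain ⟨w, hw, rfl⟩ := hc
  induction w generalizing x with
  | nil => cases hw; rwa [← FreeGroup.one_eq_mk, one_smul]
  | cons d w ih =>
    rw [FreeGroup.mk_cons, mul_smul, ← hw.1]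
    exact (ih hw.2).mk_singleton_smul

end EdgeGraph

namespace Marking

open FreeBoundary

variable {N : ℕ} {V E : Type*} [DecidableEq E] [Finite E] {Γ : EdgeGraph V E} (α : Marking N Γ)

/-- The map of boundaries induced by a marking. -/
noncomputable def boundaryMap : FreeBoundary (Fin N) → FreeBoundary E :=
  Classical.choose (exists_boundaryMap α.injective)

theorem continuous_boundaryMap : Continuous α.boundaryMap :=
  (Classical.choose_spec (exists_boundaryMap α.injective)).1

theorem boundaryMap_injective : Function.Injective α.boundaryMap :=
  (Classical.choose_spec (exists_boundaryMap α.injective)).2.1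

theorem convergesTo_boundaryMap {g : ℕ → FreeGroup (Fin N)} {X : FreeBoundary (Fin N)}
    (h : ConvergesTo g atTop X) : ConvergesTo (fun n => α.hom (g n)) atTop (α.boundaryMap X) :=
  (Classical.choose_spec (exists_boundaryMap α.injective)).2.2.1 g X h

theorem exists_boundaryMap_eq {ξ : FreeBoundary E} (h : ∃ R : ℕ, ∀ k, ∃ g,
    ((α.hom g)⁻¹ * FreeGroup.mk (ξ.initialWord k)).norm ≤ R) : ∃ X, α.boundaryMap X = ξ :=
  (Classical.choose_spec (exists_boundaryMap α.injective)).2.2.2 ξ h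

theorem mapsBoundary_boundaryMap (X : FreeBoundary (Fin N)) :
    α.MapsBoundary X (α.boundaryMap X) :=
  α.convergesTo_boundaryMap (convergesTo_initialWord X)

theorem mapsBoundary_iff {X : FreeBoundary (Fin N)} {ξ : FreeBoundary E} :
    α.MapsBoundary X ξ ↔ α.boundaryMap X = ξ :=
  ⟨fun h => (α.mapsBoundary_boundaryMap X).unique h, fun h => h ▸ α.mapsBoundary_boundaryMap X⟩

theorem boundaryMap_smul (g : FreeGroup (Fin N)) (X : FreeBoundary (Fin N)) :
    α.boundaryMap (g • X) = α.hom g • α.boundaryMap X := by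
  have h1 := α.convergesTo_boundaryMap ((convergesTo_initialWord X).smul g)
  simp only [map_mul] at h1
  exact h1.unique ((α.mapsBoundary_boundaryMap X).smul (α.hom g))

theorem isRay_boundaryMap (X : FreeBoundary (Fin N)) : Γ.IsRay α.base (α.boundaryMap X) := by
  refine EdgeGraph.isRay_of_forall_isPath fun n => ?_
  obtain ⟨k, t, ht⟩ := (α.mapsBoundary_boundaryMap X n).exists
  have := (α.isPathClass_hom (FreeGroup.mk (X.initialWord k))).isPath_toWord
  rw [← ht] at this
  obtain ⟨z, hz, -⟩ := EdgeGraph.isPath_append_iff.1 this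
  exact ⟨z, hz⟩

/-- Every initial piece of the ray is closed up by one of finitely many paths to the base vertex, so
images of group elements stay within bounded distance of the ray. -/
theorem exists_boundaryMap_eq_of_isRay [Finite V] (hΓ : Γ.IsConnected) {ξ : FreeBoundary E}
    (h : Γ.IsRay α.base ξ) : ∃ X, α.boundaryMap X = ξ := by
  apply α.exists_boundaryMap_eq
  choose w hw using fun x => hΓ x α.base
  obtain ⟨R, hR⟩ := (Set.finite_range fun x => (w x).length).bddAbove
  refine ⟨R, fun k => ?_⟩
  obtain ⟨g, hg⟩ := α.exists_hom_eq (c := FreeGroup.mk (ξ.initialWord k) *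
    FreeGroup.mk (w (Γ.init (ξ.1 k))))
    (EdgeGraph.IsPathClass.mul ⟨_, h.isPath k, rfl⟩ ⟨_, hw _, rfl⟩)
  refine ⟨g, ?_⟩
  rw [hg, mul_inv_rev, inv_mul_cancel_right, FreeGroup.norm_inv_eq]
  exact FreeGroup.norm_mk_le.trans (hR ⟨_, rfl⟩)

/-- The backward endpoint of the geodesic of `q`, as seen from the vertex `c`. -/
noncomputable def leftEnd (c : FreeGroup E) (q : DoubleBoundary (Fin N)) : FreeBoundary E :=
  c⁻¹ • α.boundaryMap q.1.1

/-- The forward endpoint of the geodesic of `q`, as seen from the vertex `c`. -/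
noncomputable def rightEnd (c : FreeGroup E) (q : DoubleBoundary (Fin N)) : FreeBoundary E :=
  c⁻¹ • α.boundaryMap q.1.2

theorem leftEnd_mul (c g : FreeGroup E) (q : DoubleBoundary (Fin N)) :
    α.leftEnd (c * g) q = g⁻¹ • α.leftEnd c q := by
  rw [leftEnd, leftEnd, mul_inv_rev, mul_smul]

theorem rightEnd_mul (c g : FreeGroup E) (q : DoubleBoundary (Fin N)) :
    α.rightEnd (c * g) q = g⁻¹ • α.rightEnd c q := by
  rw [rightEnd, rightEnd, mul_inv_rev, mul_smul]

theorem leftEnd_ne_rightEnd (c : FreeGroup E) (q : DoubleBoundary (Fin N)) :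
    α.leftEnd c q ≠ α.rightEnd c q := fun h =>
  q.2 (α.boundaryMap_injective (MulAction.injective _ h))

theorem leftEnd_flip (c : FreeGroup E) (q : DoubleBoundary (Fin N)) :
    α.leftEnd c q.flip = α.rightEnd c q := rfl

theorem rightEnd_flip (c : FreeGroup E) (q : DoubleBoundary (Fin N)) :
    α.rightEnd c q.flip = α.leftEnd c q := rfl

theorem leftEnd_translate (c : FreeGroup E) (g : FreeGroup (Fin N)) (q : DoubleBoundary (Fin N)) :
    α.leftEnd (α.hom g * c) (q.translate g) = α.leftEnd c q := by
  rw [leftEnd, DoubleBoundary.translate, boundaryMap_smul, mul_inv_rev, mul_smul, inv_smul_smul]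
  rfl

theorem rightEnd_translate (c : FreeGroup E) (g : FreeGroup (Fin N)) (q : DoubleBoundary (Fin N)) :
    α.rightEnd (α.hom g * c) (q.translate g) = α.rightEnd c q := by
  rw [rightEnd, DoubleBoundary.translate, boundaryMap_smul, mul_inv_rev, mul_smul, inv_smul_smul]
  rfl

variable {α}

theorem isRay_leftEnd {c : FreeGroup E} {x : V} (hc : Γ.IsPathClass α.base c x)
    (q : DoubleBoundary (Fin N)) : Γ.IsRay x (α.leftEnd c q) :=
  (α.isRay_boundaryMap _).smul hc.inv

theorem isRay_rightEnd {c : FreeGroup E} {x : V} (hc : Γ.IsPathClass α.base c x)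
    (q : DoubleBoundary (Fin N)) : Γ.IsRay x (α.rightEnd c q) :=
  (α.isRay_boundaryMap _).smul hc.inv

/-- The letters of a geodesic line from a given position on. -/
def IsGeodesicLine.forward {vert : ℤ → FreeGroup E} {γ : ℤ → E × Bool}
    (h : α.IsGeodesicLine vert γ) (n : ℤ) : FreeBoundary E :=
  ⟨fun k => γ (n + k), fun k => by
    have := h.reduced (n + k)
    rwa [add_assoc] at this⟩

/-- The letters of a geodesic line read backwards from a given position on. -/
def IsGeodesicLine.backward {vert : ℤ → FreeGroup E} {γ : ℤ → E × Bool}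
    (h : α.IsGeodesicLine vert γ) (n : ℤ) : FreeBoundary E :=
  ⟨fun k => flipLetter (γ (n - 1 - k)), fun k hk => by
    have := h.reduced (n - 1 - (k + 1 : ℕ))
    rw [flipLetter_flipLetter] at hk
    change flipLetter (γ (n - 1 - (k + 1 : ℕ))) = _ at hk
    rw [hk, show n - 1 - ((k + 1 : ℕ) : ℤ) + 1 = n - 1 - k by push_cast; ring] at this
    exact this rfl⟩

omit [DecidableEq E] [Finite E] in
theorem IsGeodesicLine.vert_add {vert : ℤ → FreeGroup E} {γ : ℤ → E × Bool}
    (h : α.IsGeodesicLine vert γ) (n : ℤ) (k : ℕ) :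
    vert (n + k) = vert n * FreeGroup.mk ((h.forward n).initialWord k) := by
  induction k with
  | zero => rw [initialWord_zero, ← FreeGroup.one_eq_mk, mul_one, Nat.cast_zero, add_zero]
  | succ k ih =>
    rw [initialWord_succ', ← FreeGroup.mul_mk, ← mul_assoc, ← ih, Nat.cast_succ, ← add_assoc,
      h.step]
    rfl

omit [DecidableEq E] [Finite E] in
theorem IsGeodesicLine.vert_sub {vert : ℤ → FreeGroup E} {γ : ℤ → E × Bool}
    (h : α.IsGeodesicLine vert γ) (n : ℤ) (k : ℕ) :
    vert (n - k) = vert n * FreeGroup.mk ((h.backward n).initialWord k) := by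
  induction k with
  | zero => rw [initialWord_zero, ← FreeGroup.one_eq_mk, mul_one, Nat.cast_zero, sub_zero]
  | succ k ih =>
    have hs := h.step (n - (k + 1 : ℕ))
    rw [show n - ((k + 1 : ℕ) : ℤ) + 1 = n - k by push_cast; ring, ih] at hs
    rw [initialWord_succ', ← FreeGroup.mul_mk, ← mul_assoc, hs]
    have : (h.backward n).1 k = flipLetter (γ (n - (k + 1 : ℕ))) := by
      change flipLetter (γ (n - 1 - k)) = _
      congr 2
      push_cast
      ring
    rw [this, FreeGroup.mk_flipLetter, mul_inv_cancel_right]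

theorem IsGeodesicFor.rightEnd_eq {q : DoubleBoundary (Fin N)} {vert : ℤ → FreeGroup E}
    {γ : ℤ → E × Bool} (h : α.IsGeodesicFor q vert γ) (n : ℤ) :
    α.rightEnd (vert n) q = h.line.forward n := by
  obtain ⟨η, h1, h2⟩ := h.right
  rw [mapsBoundary_iff] at h1
  have ht : Tendsto (fun k : ℕ => n + (k : ℤ)) atTop atTop :=
    tendsto_atTop_add_const_left _ _ tendsto_natCast_atTop_atTop
  have h3 := (h2.comp ht).smul (vert n)⁻¹
  simp only [Function.comp_apply, h.line.vert_add, inv_mul_cancel_left] at h3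
  rw [rightEnd, h1]
  exact h3.unique (convergesTo_initialWord _)

theorem IsGeodesicFor.leftEnd_eq {q : DoubleBoundary (Fin N)} {vert : ℤ → FreeGroup E}
    {γ : ℤ → E × Bool} (h : α.IsGeodesicFor q vert γ) (n : ℤ) :
    α.leftEnd (vert n) q = h.line.backward n := by
  obtain ⟨ξ, h1, h2⟩ := h.left
  rw [mapsBoundary_iff] at h1
  have ht : Tendsto (fun k : ℕ => n - (k : ℤ)) atTop atBot := by
    simp only [sub_eq_add_neg]
    exact tendsto_atBot_add_const_left _ _
      (tendsto_neg_atTop_atBot.comp tendsto_natCast_atTop_atTop)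
  have h3 := (h2.comp ht).smul (vert n)⁻¹
  simp only [Function.comp_apply, h.line.vert_sub, inv_mul_cancel_left] at h3
  rw [leftEnd, h1]
  exact h3.unique (convergesTo_initialWord _)

theorem IsGeodesicFor.ends_ne {q : DoubleBoundary (Fin N)} {vert : ℤ → FreeGroup E}
    {γ : ℤ → E × Bool} (h : α.IsGeodesicFor q vert γ) (n : ℤ) :
    (α.leftEnd (vert n) q).1 0 ≠ (α.rightEnd (vert n) q).1 0 := by
  rw [h.rightEnd_eq, h.leftEnd_eq]
  intro he
  have he' : flipLetter (γ (n - 1)) = γ n := by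
    simpa [IsGeodesicLine.forward, IsGeodesicLine.backward] using he
  have := h.line.reduced (n - 1)
  rw [sub_add_cancel, he'] at this
  exact this rfl

/-- A vertex from which the endpoints of a geodesic lie in different directions is on the
geodesic. -/
theorem IsGeodesicFor.exists_vert_eq {q : DoubleBoundary (Fin N)} {vert : ℤ → FreeGroup E}
    {γ : ℤ → E × Bool} (h : α.IsGeodesicFor q vert γ) {c : FreeGroup E}
    (hc : (α.leftEnd c q).1 0 ≠ (α.rightEnd c q).1 0) : ∃ n, vert n = c := by
  set g := (vert 0)⁻¹ * c with hg
  have hcg : c = vert 0 * FreeGroup.mk g.toWord := by rw [FreeGroup.mk_toWord, hg]; group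
  by_cases hne : g.toWord = []
  · exact ⟨0, by rw [hcg, hne, ← FreeGroup.one_eq_mk, mul_one]⟩
  have hred : FreeGroup.IsReduced g.toWord := FreeGroup.isReduced_toWord
  rw [hcg, leftEnd_mul, rightEnd_mul] at hc
  -- If neither endpoint, seen from `vert 0`, lies beyond `c`, then from `c` both lie in the
  -- direction back to `vert 0`, which `hc` excludes.
  by_cases hr : α.rightEnd (vert 0) q ∈ prefixSet g.toWord
  · rw [mem_prefixSet, h.rightEnd_eq] at hr
    refine ⟨0 + (g.toWord.length : ℕ), ?_⟩
    rw [h.line.vert_add, hr, hcg]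
  by_cases hl : α.leftEnd (vert 0) q ∈ prefixSet g.toWord
  · rw [mem_prefixSet, h.leftEnd_eq] at hl
    refine ⟨0 - (g.toWord.length : ℕ), ?_⟩
    rw [h.line.vert_sub, hl, hcg]
  rw [mem_prefixSet_iff hred hne, not_not] at hr hl
  exact absurd (hl.trans hr.symm) hc

section Construction

variable (α) (c : FreeGroup E) (q : DoubleBoundary (Fin N))

/-- The vertices of the geodesic of `q`, starting from a vertex `c` on it. -/
noncomputable def geodesicVertex : ℤ → FreeGroup E
  | Int.ofNat n => c * FreeGroup.mk ((α.rightEnd c q).initialWord n)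
  | Int.negSucc n => c * FreeGroup.mk ((α.leftEnd c q).initialWord (n + 1))

/-- The letters of the geodesic of `q`, starting from a vertex `c` on it. -/
noncomputable def geodesicLetter : ℤ → E × Bool
  | Int.ofNat n => (α.rightEnd c q).1 n
  | Int.negSucc n => flipLetter ((α.leftEnd c q).1 n)

variable {α c q}

theorem geodesicVertex_zero : α.geodesicVertex c q 0 = c := by
  change c * FreeGroup.mk ((α.rightEnd c q).initialWord 0) = c
  rw [initialWord_zero, ← FreeGroup.one_eq_mk, mul_one]

theorem isGeodesicFor_geodesicVertex {x : V} (hc : Γ.IsPathClass α.base c x)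
    (h : (α.leftEnd c q).1 0 ≠ (α.rightEnd c q).1 0) :
    α.IsGeodesicFor q (α.geodesicVertex c q) (α.geodesicLetter c q) := by
  have hl := isRay_leftEnd hc q
  have hr := isRay_rightEnd hc q
  have hneg : ∀ n : ℕ, Int.negSucc (n + 1) + 1 = Int.negSucc n := fun n => by omega
  have hneg0 : Int.negSucc 0 + 1 = Int.ofNat 0 := rfl
  refine ⟨⟨?_, ?_, ?_, ?_⟩, ⟨_, α.mapsBoundary_boundaryMap _, ?_⟩,
    ⟨_, α.mapsBoundary_boundaryMap _, ?_⟩⟩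
  · rintro (n | n)
    · exact hc.mul ⟨_, hr.isPath n, rfl⟩
    · change Γ.IsPathClass _ _ (Γ.init (flipLetter ((α.leftEnd c q).1 n)))
      rw [EdgeGraph.init_flipLetter, hl.2]
      exact hc.mul ⟨_, hl.isPath (n + 1), rfl⟩
  · rintro (n | n)
    · exact hr.2 n
    · change Γ.term (flipLetter ((α.leftEnd c q).1 n)) = _
      rw [EdgeGraph.term_flipLetter]
      cases n with
      | zero => rw [hneg0]; exact hl.1.trans hr.1.symm
      | succ n =>
        rw [hneg]
        change _ = Γ.init (flipLetter ((α.leftEnd c q).1 n))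
        rw [EdgeGraph.init_flipLetter, hl.2]
  · rintro (n | n)
    · change c * FreeGroup.mk ((α.rightEnd c q).initialWord (n + 1)) =
        c * FreeGroup.mk ((α.rightEnd c q).initialWord n) * FreeGroup.mk [(α.rightEnd c q).1 n]
      rw [initialWord_succ', mul_assoc, FreeGroup.mul_mk]
    · change _ = c * FreeGroup.mk ((α.leftEnd c q).initialWord (n + 1)) *
        FreeGroup.mk [flipLetter ((α.leftEnd c q).1 n)]
      rw [initialWord_succ', FreeGroup.mk_flipLetter, mul_assoc, ← FreeGroup.mul_mk,
        mul_inv_cancel_right]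
      cases n with
      | zero => rw [hneg0]; rfl
      | succ n => rw [hneg]; rfl
  · rintro (n | n)
    · exact (α.rightEnd c q).2 n
    · cases n with
      | zero =>
        rw [hneg0]
        change (α.rightEnd c q).1 0 ≠ flipLetter (flipLetter _)
        rw [flipLetter_flipLetter]
        exact h.symm
      | succ n =>
        rw [hneg]
        intro he
        change flipLetter ((α.leftEnd c q).1 n) = flipLetter (flipLetter _) at he
        rw [flipLetter_flipLetter] at he
        exact (α.leftEnd c q).2 n he.symm
  · have h1 := (convergesTo_initialWord (α.leftEnd c q)).smul c
    rw [leftEnd, smul_inv_smul] at h1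
    intro k
    obtain ⟨n₀, hn₀⟩ := eventually_atTop.1 (h1 k)
    filter_upwards [eventually_le_atBot (-(n₀ : ℤ) - 1)] with m hm
    obtain (m | m) := m
    · exfalso
      have : (0 : ℤ) ≤ Int.ofNat m := Int.natCast_nonneg m
      omega
    · exact hn₀ (m + 1) (by omega)
  · have h1 := (convergesTo_initialWord (α.rightEnd c q)).smul c
    rw [rightEnd, smul_inv_smul] at h1
    intro k
    obtain ⟨n₀, hn₀⟩ := eventually_atTop.1 (h1 k)
    filter_upwards [eventually_ge_atTop (n₀ : ℤ)] with m hm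
    obtain (m | m) := m
    · exact hn₀ m (by simpa using hm)
    · exfalso; omega

end Construction

/-- Every pair of distinct boundary points is joined by a geodesic. -/
theorem exists_isGeodesicFor (α : Marking N Γ) (q : DoubleBoundary (Fin N)) :
    ∃ vert γ, α.IsGeodesicFor q vert γ := by
  -- The rays from the base vertex to the two endpoints separate at some vertex; that vertex lies on
  -- the geodesic.
  have hex : ∃ n, (α.leftEnd 1 q).1 n ≠ (α.rightEnd 1 q).1 n := by
    by_contra! hcon
    exact α.leftEnd_ne_rightEnd 1 q (FreeBoundary.ext hcon)
  classical
  let n := Nat.find hex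
  have hn : (α.leftEnd 1 q).1 n ≠ (α.rightEnd 1 q).1 n := Nat.find_spec hex
  have heq : ∀ m < n, (α.leftEnd 1 q).1 m = (α.rightEnd 1 q).1 m := fun m hm =>
    not_not.1 (Nat.find_min hex hm)
  have hmem : α.leftEnd 1 q ∈ prefixSet ((α.rightEnd 1 q).initialWord n) := by
    rw [mem_prefixSet_iff_getElem]
    intro i hi
    rw [getElem_initialWord]
    exact (heq i (by simpa using hi)).symm
  have hray := isRay_rightEnd (EdgeGraph.IsPathClass.refl (Γ := Γ) α.base) q
  refine ⟨_, _, isGeodesicFor_geodesicVertex (c := FreeGroup.mk ((α.rightEnd 1 q).initialWord n))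
    ⟨_, hray.isPath n, rfl⟩ ?_⟩
  rw [← one_mul (FreeGroup.mk _), leftEnd_mul, rightEnd_mul, inv_mk_smul_apply hmem,
    inv_mk_smul_apply (mem_prefixSet_initialWord _ _), length_initialWord, zero_add]
  exact hn

/-- The existential over geodesics reduces to the two endpoints as seen from `c`: the forward one
reads `v`, and the backward one leaves in another direction. In this form cylinders are visibly
clopen. -/
theorem mem_cylinder_iff {c : FreeGroup E} {x : V} (hc : Γ.IsPathClass α.base c x)
    {q : DoubleBoundary (Fin N)} {v : List (E × Bool)} (hv : v ≠ []) :
    q ∈ α.cylinder c v ↔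
      α.rightEnd c q ∈ prefixSet v ∧ (α.leftEnd c q).1 0 ≠ v.head hv := by
  have hseg : ∀ {ζ : FreeBoundary E} {γ : ℤ → E × Bool} {n : ℤ}, (∀ k : ℕ, ζ.1 k = γ (n + k)) →
      ∀ k, segment_of_line γ n k = ζ.initialWord k := by
    intro ζ γ n h k
    simp only [segment_of_line, initialWord, h]
  have hhead : α.rightEnd c q ∈ prefixSet v → (α.rightEnd c q).1 0 = v.head hv := by
    intro h
    rw [mem_prefixSet_iff_getElem] at h
    rw [List.head_eq_getElem, h 0 (List.length_pos_iff.2 hv)]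
  constructor
  · rintro ⟨vert, γ, h, n, rfl, hn⟩
    have hp : α.rightEnd (vert n) q ∈ prefixSet v := by
      rw [mem_prefixSet, ← hseg (fun k => ?_) v.length, hn]
      rw [h.rightEnd_eq]
      rfl
    refine ⟨hp, ?_⟩
    rw [← hhead hp]
    exact h.ends_ne n
  · rintro ⟨h1, h2⟩
    rw [← hhead h1] at h2
    refine ⟨_, _, isGeodesicFor_geodesicVertex hc h2, 0, geodesicVertex_zero, ?_⟩
    rw [hseg (ζ := α.rightEnd c q) (fun k => ?_), mem_prefixSet.1 h1]
    rw [zero_add]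
    rfl

end Marking

/-! ## Cylinders -/

namespace EdgeGraph

variable {V E : Type*} {Γ : EdgeGraph V E}

theorem IsPathClass.unique_end [DecidableEq E] {x y y' : V} {c : FreeGroup E}
    (h : Γ.IsPathClass x c y) (h' : Γ.IsPathClass x c y') : y = y' :=
  h.isPath_toWord.unique_end h'.isPath_toWord

theorem IsPath.init_head {x y : V} {v : List (E × Bool)} (h : Γ.IsPath x v y) (hv : v ≠ []) :
    Γ.init (v.head hv) = x := by
  cases v with
  | nil => exact absurd rfl hv
  | cons d v => exact h.1

end EdgeGraph

theorem FreeGroup.isReduced_invRev {A : Type*} [DecidableEq A] {w : List (A × Bool)}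
    (h : FreeGroup.IsReduced w) : FreeGroup.IsReduced (FreeGroup.invRev w) := by
  rw [FreeGroup.isReduced_iff_reduce_eq, FreeGroup.reduce_invRev, h.reduce_eq]

theorem head_invRev {A : Type*} {v : List (A × Bool)} (hv : v ≠ []) :
    (FreeGroup.invRev v).head (invRev_ne_nil hv) = flipLetter (v.getLast hv) := by
  obtain ⟨w, d, rfl⟩ := List.eq_nil_or_concat' v |>.resolve_left hv
  simp [FreeGroup.invRev, flipLetter]

theorem getLast_invRev {A : Type*} {v : List (A × Bool)} (hv : v ≠ []) :
    (FreeGroup.invRev v).getLast (invRev_ne_nil hv) = flipLetter (v.head hv) := by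
  cases v with
  | nil => exact absurd rfl hv
  | cons d w => simp [FreeGroup.invRev, flipLetter]

namespace Marking

open FreeBoundary

variable {N : ℕ} {V E : Type*} [DecidableEq E] [Finite E] {Γ : EdgeGraph V E} {α : Marking N Γ}
  {c : FreeGroup E} {x : V} {q : DoubleBoundary (Fin N)} {v : List (E × Bool)}

omit [Finite E] in
theorem isPathClass_of_mem_cylinder (h : q ∈ α.cylinder c v) (hv : v ≠ []) :
    Γ.IsPathClass α.base c (Γ.init (v.head hv)) := by
  obtain ⟨vert, γ, hγ, n, rfl, hn⟩ := h
  have : v.head hv = γ n := by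
    cases v with
    | nil => exact absurd rfl hv
    | cons d v =>
      simp only [segment_of_line, List.length_cons, List.ofFn_succ, List.cons.injEq] at hn
      simpa using hn.1.symm
  rw [this]
  exact hγ.line.is_vertex n

theorem isReduced_of_mem_cylinder (h : q ∈ α.cylinder c v) (hv : v ≠ []) :
    FreeGroup.IsReduced v :=
  isReduced_of_mem_prefixSet ((mem_cylinder_iff (isPathClass_of_mem_cylinder h hv) hv).1 h).1

theorem isPath_of_mem_cylinder (hc : Γ.IsPathClass α.base c x) (h : q ∈ α.cylinder c v)
    (hv : v ≠ []) : ∃ y, Γ.IsPath x v y :=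
  ⟨_, (isRay_rightEnd hc q).isPath_of_mem ((mem_cylinder_iff hc hv).1 h).1⟩

/-- This form is symmetric under reversal, with one direction excluded at each end of the segment;
flips and pairs of cones are compared through it. -/
theorem mem_cylinder_iff_ends (hc : Γ.IsPathClass α.base c x) (hr : FreeGroup.IsReduced v)
    (hv : v ≠ []) : q ∈ α.cylinder c v ↔ (α.leftEnd c q).1 0 ≠ v.head hv ∧
      (α.rightEnd (c * FreeGroup.mk v) q).1 0 ≠ flipLetter (v.getLast hv) := by
  rw [mem_cylinder_iff hc hv, and_comm, rightEnd_mul, mem_prefixSet_iff hr hv]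

theorem mem_cylinder_concat_iff (hc : Γ.IsPathClass α.base c x) (hv : v ≠ []) (d : E × Bool) :
    q ∈ α.cylinder c (v ++ [d]) ↔ q ∈ α.cylinder c v ∧ (α.rightEnd c q).1 v.length = d := by
  rw [mem_cylinder_iff hc (by simp), mem_cylinder_iff hc hv, mem_prefixSet_concat,
    List.head_append_of_ne_nil hv]
  tauto

/-- No compatibility of `d` with `v` is assumed: if `d` does not end at `x`, both sides are false.
Sums over all letters thus need no side condition. -/
theorem mem_cylinder_cons_iff (hc : Γ.IsPathClass α.base c x) (hv : v ≠ []) (d : E × Bool) :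
    q ∈ α.cylinder (c * (FreeGroup.mk [d])⁻¹) (d :: v) ↔
      q ∈ α.cylinder c v ∧ (α.leftEnd c q).1 0 = flipLetter d := by
  by_cases hd : Γ.term d = x
  · have hc' : Γ.IsPathClass α.base (c * (FreeGroup.mk [d])⁻¹) (Γ.init d) :=
      hc.mul (hd ▸ (EdgeGraph.isPathClass_letter d).inv)
    rw [mem_cylinder_iff hc' (by simp), mem_cylinder_iff hc hv, leftEnd_mul, rightEnd_mul, inv_inv,
      mk_singleton_smul, mk_singleton_smul, List.head_cons]
    by_cases hl : (α.leftEnd c q).1 0 = flipLetter d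
    · rw [mulLetter_of_eq hl, hl]
      have h1 : (α.leftEnd c q).tail.1 0 ≠ d := by
        have := (α.leftEnd c q).2 0
        rwa [hl, flipLetter_flipLetter] at this
      have h2 : α.rightEnd c q ∈ prefixSet v → (α.rightEnd c q).1 0 = v.head hv := by
        intro h
        rw [mem_prefixSet_iff_getElem] at h
        rw [List.head_eq_getElem, h 0 (List.length_pos_iff.2 hv)]
      by_cases hr : (α.rightEnd c q).1 0 = flipLetter d
      · rw [mulLetter_of_eq hr, mem_prefixSet_cons]
        have h3 : (α.rightEnd c q).tail.1 0 ≠ d := by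
          have := (α.rightEnd c q).2 0
          rwa [hr, flipLetter_flipLetter] at this
        constructor
        · exact fun h => absurd h.1.1 h3
        · exact fun h => absurd ((h2 h.1.1).symm.trans hr) h.1.2.symm
      · rw [mem_prefixSet_cons, mulLetter_apply_zero hr, tail_mulLetter hr]
        constructor
        · exact fun h => ⟨⟨h.1.2, fun h4 => hr ((h2 h.1.2).trans h4.symm)⟩, rfl⟩
        · exact fun h => ⟨⟨rfl, h.1.1⟩, h1⟩
    · rw [mulLetter_apply_zero hl]
      exact ⟨fun h => absurd rfl h.2, fun h => absurd h.2 hl⟩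
  · constructor
    · intro h
      have h1 := (isPathClass_of_mem_cylinder h (by simp)).mul (EdgeGraph.isPathClass_letter d)
      rw [inv_mul_cancel_right] at h1
      exact absurd (h1.unique_end hc) hd
    · rintro ⟨-, h⟩
      have := (isRay_leftEnd hc q).1
      rw [h, EdgeGraph.init_flipLetter] at this
      exact absurd this hd

theorem preimage_flip_cylinder {y : V} (hc : Γ.IsPathClass α.base c x) (hp : Γ.IsPath x v y)
    (hr : FreeGroup.IsReduced v) (hv : v ≠ []) :
    DoubleBoundary.flip ⁻¹' α.cylinder c v =
      α.cylinder (c * FreeGroup.mk v) (FreeGroup.invRev v) := by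
  ext q
  rw [Set.mem_preimage, mem_cylinder_iff_ends hc hr hv,
    mem_cylinder_iff_ends (hc.mul ⟨v, hp, rfl⟩) (FreeGroup.isReduced_invRev hr) (invRev_ne_nil hv),
    leftEnd_flip, rightEnd_flip, head_invRev, getLast_invRev, flipLetter_flipLetter,
    ← FreeGroup.inv_mk, mul_inv_cancel_right, and_comm]

theorem preimage_translate_cylinder (hc : Γ.IsPathClass α.base c x) (hv : v ≠ [])
    (g : FreeGroup (Fin N)) :
    DoubleBoundary.translate g ⁻¹' α.cylinder (α.hom g * c) v = α.cylinder c v := by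
  ext q
  rw [Set.mem_preimage, mem_cylinder_iff hc hv,
    mem_cylinder_iff ((α.isPathClass_hom g).mul hc) hv, leftEnd_translate, rightEnd_translate]

/-! ### Topology of the double boundary -/

section Topology

theorem _root_.DoubleBoundary.continuous_fst {A : Type*} :
    Continuous fun q : DoubleBoundary A => q.1.1 :=
  _root_.continuous_fst.comp continuous_subtype_val

theorem _root_.DoubleBoundary.continuous_snd {A : Type*} :
    Continuous fun q : DoubleBoundary A => q.1.2 :=
  _root_.continuous_snd.comp continuous_subtype_val

instance {A : Type*} : T2Space (DoubleBoundary A) :=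
  inferInstanceAs (T2Space {q : FreeBoundary A × FreeBoundary A // q.1 ≠ q.2})

instance {A : Type*} [Finite A] : LocallyCompactSpace (DoubleBoundary A) := by
  have h : IsOpen {q : FreeBoundary A × FreeBoundary A | q.1 ≠ q.2} :=
    isOpen_ne_fun continuous_fst continuous_snd
  exact h.locallyCompactSpace

theorem _root_.DoubleBoundary.isCompact_of_isClosed {A : Type*} [Finite A]
    {S : Set (FreeBoundary A × FreeBoundary A)} (hS : IsClosed S) (h : ∀ p ∈ S, p.1 ≠ p.2) :
    IsCompact {q : DoubleBoundary A | q.1 ∈ S} := by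
  have hi : IsInducing (Subtype.val : DoubleBoundary A → FreeBoundary A × FreeBoundary A) := ⟨rfl⟩
  refine (hi.isCompact_preimage_iff ?_).2 hS.isCompact
  intro p hp
  exact ⟨⟨p, h p hp⟩, rfl⟩

theorem _root_.DoubleBoundary.continuous_flip {A : Type*} :
    Continuous (DoubleBoundary.flip : DoubleBoundary A → DoubleBoundary A) :=
  Continuous.subtype_mk (DoubleBoundary.continuous_snd.prodMk DoubleBoundary.continuous_fst) _

theorem _root_.DoubleBoundary.continuous_translate {A : Type*} [DecidableEq A] (g : FreeGroup A) :
    Continuous (DoubleBoundary.translate g : DoubleBoundary A → DoubleBoundary A) :=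
  Continuous.subtype_mk (((continuous_smul g).comp DoubleBoundary.continuous_fst).prodMk
    ((continuous_smul g).comp DoubleBoundary.continuous_snd)) _

theorem isClopen_prefixSet {A : Type*} (w : List (A × Bool)) :
    IsClopen (prefixSet w : Set (FreeBoundary A)) :=
  ⟨isClosed_prefixSet w, isOpen_prefixSet w⟩

theorem isClopen_cylinder (hc : Γ.IsPathClass α.base c x) (hv : v ≠ []) :
    IsClopen (α.cylinder c v) := by
  have : α.cylinder c v = (α.rightEnd c) ⁻¹' prefixSet v ∩
      ((α.leftEnd c) ⁻¹' prefixSet [v.head hv])ᶜ := by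
    ext q
    rw [mem_cylinder_iff hc hv, Set.mem_inter_iff, Set.mem_compl_iff, Set.mem_preimage,
      Set.mem_preimage, mem_prefixSet_singleton]
  rw [this]
  exact ((isClopen_prefixSet v).preimage ((continuous_smul _).comp
    (α.continuous_boundaryMap.comp DoubleBoundary.continuous_snd))).inter
    ((isClopen_prefixSet _).preimage ((continuous_smul _).comp
    (α.continuous_boundaryMap.comp DoubleBoundary.continuous_fst))).compl

theorem measurableSet_cylinder (hc : Γ.IsPathClass α.base c x) (hv : v ≠ []) :
    MeasurableSet (α.cylinder c v) := (isClopen_cylinder hc hv).1.measurableSet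

/-- Both conditions are closed in the compact square of the boundary, and they exclude the diagonal,
because the first letter of `v` separates the two endpoints. -/
theorem isCompact_cylinder (hc : Γ.IsPathClass α.base c x) (hv : v ≠ []) :
    IsCompact (α.cylinder c v) := by
  set S : Set (FreeBoundary (Fin N) × FreeBoundary (Fin N)) :=
    {p | c⁻¹ • α.boundaryMap p.2 ∈ prefixSet v ∧
      c⁻¹ • α.boundaryMap p.1 ∈ (prefixSet [v.head hv])ᶜ} with hS
  have : α.cylinder c v = {q | q.1 ∈ S} := by
    ext q
    rw [mem_cylinder_iff hc hv, Set.mem_ofPred_eq, hS, Set.mem_ofPred_eq, Set.mem_compl_iff,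
      mem_prefixSet_singleton]
    rfl
  rw [this]
  refine DoubleBoundary.isCompact_of_isClosed ?_ ?_
  · exact ((isClosed_prefixSet v).preimage ((continuous_smul _).comp
      (α.continuous_boundaryMap.comp continuous_snd))).inter
      ((isClopen_prefixSet _).compl.1.preimage ((continuous_smul _).comp
      (α.continuous_boundaryMap.comp continuous_fst)))
  · rintro ⟨X, Y⟩ ⟨h1, h2⟩ (rfl : X = Y)
    refine h2 (mem_prefixSet_of_prefix h1 ?_)
    cases v with
    | nil => exact absurd rfl hv
    | cons d v => exact ⟨v, rfl⟩

end Topology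

/-! ### Pairs of cones -/

variable (α) in
/-- The pairs of points whose images lie in two given cones based at the base vertex. -/
def pairSet (u w : List (E × Bool)) : Set (DoubleBoundary (Fin N)) :=
  {q | α.boundaryMap q.1.1 ∈ prefixSet u ∧ α.boundaryMap q.1.2 ∈ prefixSet w}

theorem isClopen_pairSet (u w : List (E × Bool)) : IsClopen (α.pairSet u w) :=
  ((isClopen_prefixSet u).preimage
    (α.continuous_boundaryMap.comp DoubleBoundary.continuous_fst)).inter
  ((isClopen_prefixSet w).preimage (α.continuous_boundaryMap.comp DoubleBoundary.continuous_snd))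

theorem exists_append_of_not_prefix {B : Type*} {u w : List B} (h1 : ¬ u <+: w) (h2 : ¬ w <+: u) :
    ∃ p a b u' w', a ≠ b ∧ u = p ++ a :: u' ∧ w = p ++ b :: w' := by
  induction u generalizing w with
  | nil => exact absurd List.nil_prefix h1
  | cons a u ih =>
    cases w with
    | nil => exact absurd List.nil_prefix h2
    | cons b w =>
      by_cases hab : a = b
      · subst hab
        rw [List.cons_prefix_cons] at h1 h2
        obtain ⟨p, a', b', u', w', h, rfl, rfl⟩ := ih (fun h => h1 ⟨rfl, h⟩) (fun h => h2 ⟨rfl, h⟩)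
        exact ⟨a :: p, a', b', u', w', h, rfl, rfl⟩
      · exact ⟨[], a, b, u, w, hab, rfl, rfl⟩

omit [Finite E] in
theorem toWord_inv_mk_mul_mk {p u' w' : List (E × Bool)} {a b : E × Bool} (hab : a ≠ b)
    (hu : FreeGroup.IsReduced (p ++ a :: u')) (hw : FreeGroup.IsReduced (p ++ b :: w')) :
    ((FreeGroup.mk (p ++ a :: u'))⁻¹ * FreeGroup.mk (p ++ b :: w')).toWord =
      FreeGroup.invRev (a :: u') ++ b :: w' := by
  have h1 : (FreeGroup.mk (p ++ a :: u'))⁻¹ * FreeGroup.mk (p ++ b :: w') =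
      FreeGroup.mk (FreeGroup.invRev (a :: u') ++ b :: w') := by
    rw [← FreeGroup.mul_mk, ← FreeGroup.mul_mk, ← FreeGroup.mul_mk, ← FreeGroup.inv_mk]
    group
  rw [h1]
  apply FreeGroup.toWord_mk_of_isReduced
  have h2 : FreeGroup.IsReduced (FreeGroup.invRev (a :: u')) :=
    FreeGroup.isReduced_invRev (hu.infix (List.suffix_append _ _).isInfix)
  have h3 : FreeGroup.IsReduced (b :: w') := hw.infix (List.suffix_append _ _).isInfix
  rw [FreeGroup.IsReduced, List.isChain_append]
  refine ⟨h2, h3, fun y hy z hz => ?_⟩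
  rw [List.getLast?_eq_getLast_of_ne_nil (invRev_ne_nil (by simp)), getLast_invRev (by simp),
    Option.mem_some_iff, List.head_cons] at hy
  rw [List.head?_cons, Option.mem_some_iff] at hz
  subst hy hz
  rw [← ne_flipLetter_iff, flipLetter_flipLetter]
  exact hab.symm

/-- A geodesic joins two disjoint cones of the tree exactly when it runs along the segment between
their apexes. -/
theorem pairSet_eq_cylinder {u w : List (E × Bool)} (h1 : ¬ u <+: w) (h2 : ¬ w <+: u)
    (hu : FreeGroup.IsReduced u) (hw : FreeGroup.IsReduced w) (hp : Γ.IsPath α.base u x) :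
    α.pairSet u w =
      α.cylinder (FreeGroup.mk u) ((FreeGroup.mk u)⁻¹ * FreeGroup.mk w).toWord := by
  obtain ⟨p, a, b, u', w', hab, rfl, rfl⟩ := exists_append_of_not_prefix h1 h2
  ext q
  have hne : ((FreeGroup.mk (p ++ a :: u'))⁻¹ * FreeGroup.mk (p ++ b :: w')).toWord ≠ [] := by
    rw [toWord_inv_mk_mul_mk hab hu hw]; simp
  rw [mem_cylinder_iff_ends ⟨_, hp, rfl⟩ FreeGroup.isReduced_toWord hne, FreeGroup.mk_toWord,
    mul_inv_cancel_left, pairSet, Set.mem_ofPred_eq, mem_prefixSet_iff hu (by simp),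
    mem_prefixSet_iff hw (by simp)]
  have e1 : List.head _ hne = flipLetter ((p ++ a :: u').getLast (by simp)) := by
    rw [List.head_eq_iff_head?_eq_some, toWord_inv_mk_mul_mk hab hu hw,
      List.head?_append_of_ne_nil _ (invRev_ne_nil (by simp)),
      List.head?_eq_some_head (invRev_ne_nil (by simp)), head_invRev (by simp),
      List.getLast_append_of_ne_nil _ (by simp)]
  have e2 : List.getLast _ hne = (p ++ b :: w').getLast (by simp) := by
    rw [List.getLast_eq_iff_getLast?_eq_some, toWord_inv_mk_mul_mk hab hu hw,
      List.getLast?_append_of_ne_nil _ (by simp), List.getLast?_eq_getLast_of_ne_nil (by simp),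
      List.getLast_append_of_ne_nil _ (by simp)]
  rw [e1, e2]
  rfl

/-- A cylinder whose segment turns away from the base vertex at both of its ends is a pair of
cones. -/
theorem cylinder_eq_pairSet (hc : Γ.IsPathClass α.base c x) (hr : FreeGroup.IsReduced v)
    (hv : v ≠ []) {u w : List (E × Bool)} (hu : c.toWord = u ++ [flipLetter (v.head hv)])
    (hw : (c * FreeGroup.mk v).toWord = w ++ [v.getLast hv]) :
    α.cylinder c v = α.pairSet c.toWord (c * FreeGroup.mk v).toWord ∧
      ¬ c.toWord <+: (c * FreeGroup.mk v).toWord ∧ ¬ (c * FreeGroup.mk v).toWord <+: c.toWord := by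
  refine ⟨?_, ?_, ?_⟩
  · ext q
    have hu' : c.toWord ≠ [] := by rw [hu]; simp
    have hw' : (c * FreeGroup.mk v).toWord ≠ [] := by rw [hw]; simp
    have e1 : c.toWord.getLast hu' = flipLetter (v.head hv) := by simp [hu]
    have e2 : (c * FreeGroup.mk v).toWord.getLast hw' = v.getLast hv := by simp [hw]
    rw [mem_cylinder_iff_ends hc hr hv, pairSet, Set.mem_ofPred_eq,
      mem_prefixSet_iff FreeGroup.isReduced_toWord hu', e1,
      mem_prefixSet_iff FreeGroup.isReduced_toWord hw', e2, FreeGroup.mk_toWord,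
      FreeGroup.mk_toWord, flipLetter_flipLetter]
    rfl
  · rintro ⟨t, ht⟩
    have h1 : FreeGroup.IsReduced (c.toWord ++ t) := ht ▸ FreeGroup.isReduced_toWord
    have h2 : FreeGroup.mk t = FreeGroup.mk v := by
      have := congrArg FreeGroup.mk ht
      rwa [← FreeGroup.mul_mk, FreeGroup.mk_toWord, FreeGroup.mk_toWord, mul_right_inj] at this
    have h3 : t = v := by
      rw [← FreeGroup.toWord_mk_of_isReduced hr, ← h2, FreeGroup.toWord_mk_of_isReduced
        (h1.infix (List.suffix_append _ _).isInfix)]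
    subst h3
    cases t with
    | nil => exact hv rfl
    | cons d t =>
      rw [hu, List.append_assoc] at h1
      have := h1.infix (List.suffix_append _ _).isInfix
      rw [List.singleton_append, isReduced_cons_cons_iff, List.head_cons, flipLetter_flipLetter]
        at this
      exact this.1 rfl
  · rintro ⟨t, ht⟩
    have h1 : FreeGroup.IsReduced ((c * FreeGroup.mk v).toWord ++ t) :=
      ht ▸ FreeGroup.isReduced_toWord
    have h2 : FreeGroup.mk (FreeGroup.invRev t) = FreeGroup.mk v := by
      have := congrArg FreeGroup.mk ht
      rw [← FreeGroup.mul_mk, FreeGroup.mk_toWord, FreeGroup.mk_toWord, mul_assoc,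
        mul_eq_left] at this
      rw [← FreeGroup.inv_mk, eq_comm]
      exact eq_inv_of_mul_eq_one_left this
    have h3 : FreeGroup.invRev t = v := by
      rw [← FreeGroup.toWord_mk_of_isReduced hr, ← h2, FreeGroup.toWord_mk_of_isReduced
        (FreeGroup.isReduced_invRev (h1.infix (List.suffix_append _ _).isInfix))]
    subst h3
    cases t with
    | nil => exact hv rfl
    | cons d t =>
      rw [hw, List.append_assoc] at h1
      have := h1.infix (List.suffix_append _ _).isInfix
      rw [List.singleton_append, isReduced_cons_cons_iff, getLast_invRev (by simp),
        List.head_cons, flipLetter_flipLetter] at this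
      exact this.1 rfl

end Marking

/-! ## Measures on the double boundary and their values on cylinders -/

theorem sum_measure_fiber {X ι : Type*} [MeasurableSpace X] [Fintype ι] (ν : Measure X) {S : Set X}
    {T : ι → Set X} (φ : X → ι) (h : ∀ i q, q ∈ T i ↔ q ∈ S ∧ φ q = i)
    (hm : ∀ i, MeasurableSet (T i)) : ∑ i, ν (T i) = ν S := by
  have hS : S = ⋃ i, T i := by
    ext q
    simp [h]
  rw [hS, measure_iUnion _ hm, tsum_fintype]
  intro i j hij
  rw [Function.onFun, Set.disjoint_left]
  intro q hi hj
  exact hij (((h i q).1 hi).2.symm.trans ((h j q).1 hj).2)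

namespace Marking

open FreeBoundary

variable {N : ℕ} {V E : Type*} [DecidableEq E] [Fintype E] {Γ : EdgeGraph V E} {α : Marking N Γ}
  {c : FreeGroup E} {x : V} {q : DoubleBoundary (Fin N)} {v : List (E × Bool)}

theorem sum_measure_cylinder_concat (ν : Measure (DoubleBoundary (Fin N)))
    (hc : Γ.IsPathClass α.base c x) (hv : v ≠ []) :
    ∑ d : E × Bool, ν (α.cylinder c (v ++ [d])) = ν (α.cylinder c v) :=
  sum_measure_fiber ν (fun q => (α.rightEnd c q).1 v.length)
    (fun d _ => mem_cylinder_concat_iff hc hv d) fun _ => measurableSet_cylinder hc (by simp)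

theorem sum_measure_cylinder_cons (ν : Measure (DoubleBoundary (Fin N)))
    (hc : Γ.IsPathClass α.base c x) (hv : v ≠ []) :
    ∑ d : E × Bool, ν (α.cylinder (c * (FreeGroup.mk [d])⁻¹) (d :: v)) = ν (α.cylinder c v) := by
  refine sum_measure_fiber ν (fun q => flipLetter ((α.leftEnd c q).1 0)) (fun d q => ?_) fun d => ?_
  · rw [mem_cylinder_cons_iff hc hv]
    refine and_congr_right fun _ => ⟨fun h => by rw [h, flipLetter_flipLetter],
      fun h => by rw [← h, flipLetter_flipLetter]⟩
  · by_cases hne : (α.cylinder (c * (FreeGroup.mk [d])⁻¹) (d :: v)).Nonempty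
    · obtain ⟨q, hq⟩ := hne
      exact measurableSet_cylinder (isPathClass_of_mem_cylinder hq (by simp)) (by simp)
    · rw [Set.not_nonempty_iff_eq_empty.1 hne]
      exact MeasurableSet.empty

theorem isCompact_pairSet {u w : List (E × Bool)} (h1 : ¬ u <+: w) (h2 : ¬ w <+: u) :
    IsCompact (α.pairSet u w) := by
  refine DoubleBoundary.isCompact_of_isClosed (S := {p | α.boundaryMap p.1 ∈ prefixSet u ∧
    α.boundaryMap p.2 ∈ prefixSet w}) ?_ ?_
  · exact ((isClosed_prefixSet u).preimage (α.continuous_boundaryMap.comp continuous_fst)).inter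
      ((isClosed_prefixSet w).preimage (α.continuous_boundaryMap.comp continuous_snd))
  · rintro ⟨X, Y⟩ ⟨hX, hY⟩ (rfl : X = Y)
    rcases le_total u.length w.length with h | h
    · exact h1 (prefix_total_of_mem hX hY h)
    · exact h2 (prefix_total_of_mem hY hX h)

variable (α) in
/-- The pairs of incomparable cones. -/
def pairSets : Set (Set (DoubleBoundary (Fin N))) :=
  {S | ∃ u w : List (E × Bool), ¬ u <+: w ∧ ¬ w <+: u ∧ α.pairSet u w = S}

theorem exists_mem_pairSets {U : Set (DoubleBoundary (Fin N))} (hU : IsOpen U) (hq : q ∈ U) :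
    ∃ S ∈ α.pairSets, q ∈ S ∧ S ⊆ U := by
  have hemb : IsInducing α.boundaryMap :=
    (α.continuous_boundaryMap.isClosedEmbedding α.boundaryMap_injective).isInducing
  obtain ⟨W, hW, rfl⟩ := isOpen_induced_iff.1 hU
  obtain ⟨A, B, hA, hB, hqA, hqB, hAB⟩ := isOpen_prod_iff.1 hW q.1.1 q.1.2 hq
  obtain ⟨A, hA', rfl⟩ := hemb.isOpen_iff.1 hA
  obtain ⟨B, hB', rfl⟩ := hemb.isOpen_iff.1 hB
  obtain ⟨k, hk⟩ := exists_prefixSet_subset hA' hqA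
  obtain ⟨l, hl⟩ := exists_prefixSet_subset hB' hqB
  obtain ⟨m, hm⟩ : ∃ m, (α.boundaryMap q.1.1).1 m ≠ (α.boundaryMap q.1.2).1 m := by
    by_contra! hcon
    exact q.2 (α.boundaryMap_injective (FreeBoundary.ext hcon))
  -- Long enough for both neighbourhoods, and beyond the letter `m`, so that the two prefixes are
  -- incomparable.
  set n := max (max k l) (m + 1)
  have hne : (α.boundaryMap q.1.1).initialWord n ≠ (α.boundaryMap q.1.2).initialWord n := by
    intro h
    apply hm
    have h1 := getElem?_initialWord (α.boundaryMap q.1.1) (show m < n by omega)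
    rw [h, getElem?_initialWord _ (show m < n by omega)] at h1
    exact (Option.some.inj h1).symm
  refine ⟨_, ⟨(α.boundaryMap q.1.1).initialWord n, (α.boundaryMap q.1.2).initialWord n, ?_, ?_,
    rfl⟩, ⟨mem_prefixSet_initialWord _ _, mem_prefixSet_initialWord _ _⟩, fun p hp => hAB ?_⟩
  · exact fun h => hne (h.eq_of_length (by simp))
  · exact fun h => hne (h.eq_of_length (by simp)).symm
  · refine ⟨hk (mem_prefixSet_of_prefix hp.1 ?_),
      hl (mem_prefixSet_of_prefix hp.2 ?_)⟩
    · rw [prefix_iff_take_eq, take_initialWord _ (by omega)]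
    · rw [prefix_iff_take_eq, take_initialWord _ (by omega)]

theorem countable_pairSets : (α.pairSets).Countable := by
  refine (Set.countable_range fun p : List (E × Bool) × List (E × Bool) =>
    α.pairSet p.1 p.2).mono ?_
  rintro S ⟨u, w, -, -, rfl⟩
  exact ⟨(u, w), rfl⟩

theorem isTopologicalBasis_pairSets : TopologicalSpace.IsTopologicalBasis α.pairSets := by
  refine TopologicalSpace.isTopologicalBasis_of_isOpen_of_nhds ?_ fun q U hq hU => ?_
  · rintro S ⟨u, w, -, -, rfl⟩
    exact (isClopen_pairSet u w).2
  · obtain ⟨S, hS, h⟩ := exists_mem_pairSets (α := α) hU hq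
    exact ⟨S, hS, h⟩

theorem inter_pairSet {u w u' w' : List (E × Bool)}
    (h : (α.pairSet u w ∩ α.pairSet u' w').Nonempty) :
    ∃ u'' w'', (u'' = u ∨ u'' = u') ∧ (w'' = w ∨ w'' = w') ∧ u <+: u'' ∧ u' <+: u'' ∧ w <+: w'' ∧
      w' <+: w'' ∧ α.pairSet u w ∩ α.pairSet u' w' = α.pairSet u'' w'' := by
  obtain ⟨q, hq, hq'⟩ := h
  have key : ∀ {ξ : FreeBoundary E} {a b : List (E × Bool)}, ξ ∈ prefixSet a → ξ ∈ prefixSet b →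
      ∃ e, (e = a ∨ e = b) ∧ a <+: e ∧ b <+: e := by
    intro ξ a b ha hb
    rcases le_total a.length b.length with h | h
    · exact ⟨b, Or.inr rfl, prefix_total_of_mem ha hb h, List.prefix_rfl⟩
    · exact ⟨a, Or.inl rfl, List.prefix_rfl, prefix_total_of_mem hb ha h⟩
  obtain ⟨u'', hu, hu1, hu2⟩ := key hq.1 hq'.1
  obtain ⟨w'', hw, hw1, hw2⟩ := key hq.2 hq'.2
  refine ⟨u'', w'', hu, hw, hu1, hu2, hw1, hw2, Set.ext fun p => ⟨fun hp => ?_, fun hp => ?_⟩⟩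
  · constructor
    · rcases hu with rfl | rfl
      exacts [hp.1.1, hp.2.1]
    · rcases hw with rfl | rfl
      exacts [hp.1.2, hp.2.2]
  · exact ⟨⟨mem_prefixSet_of_prefix hp.1 hu1, mem_prefixSet_of_prefix hp.2 hw1⟩,
      ⟨mem_prefixSet_of_prefix hp.1 hu2, mem_prefixSet_of_prefix hp.2 hw2⟩⟩

/-- Cones are nested or disjoint, and extensions of incomparable words remain incomparable. -/
theorem isPiSystem_pairSets : IsPiSystem α.pairSets := by
  rintro _ ⟨u, w, h1, h2, rfl⟩ _ ⟨u', w', -, -, rfl⟩ hne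
  obtain ⟨u'', w'', -, -, hu, -, hw, -, he⟩ := inter_pairSet hne
  refine ⟨u'', w'', fun h => ?_, fun h => ?_, he.symm⟩
  · rcases List.prefix_or_prefix_of_prefix (hu.trans h) hw with h' | h'
    exacts [h1 h', h2 h']
  · rcases List.prefix_or_prefix_of_prefix hu (hw.trans h) with h' | h'
    exacts [h1 h', h2 h']

theorem ext_of_pairSet {ν₁ ν₂ : Measure (DoubleBoundary (Fin N))} [IsFiniteMeasureOnCompacts ν₁]
    (h : ∀ u w : List (E × Bool), ¬ u <+: w → ¬ w <+: u → (α.pairSet u w).Nonempty →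
      ν₁ (α.pairSet u w) = ν₂ (α.pairSet u w)) : ν₁ = ν₂ := by
  have : SecondCountableTopology (DoubleBoundary (Fin N)) :=
    (isTopologicalBasis_pairSets (α := α)).secondCountableTopology countable_pairSets
  refine Measure.ext_of_generateFrom_of_cover_subset
    (isTopologicalBasis_pairSets (α := α)).borel_eq_generateFrom isPiSystem_pairSets subset_rfl
    countable_pairSets ?_ ?_ ?_
  · exact (isTopologicalBasis_pairSets (α := α)).sUnion_eq
  · rintro _ ⟨u, w, h1, h2, rfl⟩
    exact (isCompact_pairSet h1 h2).measure_lt_top.ne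
  · rintro _ ⟨u, w, h1, h2, rfl⟩
    by_cases hne : (α.pairSet u w).Nonempty
    · exact h u w h1 h2 hne
    · rw [Set.not_nonempty_iff_eq_empty.1 hne, measure_empty, measure_empty]

/-- The words of a nonempty pair of cones are edge-paths from the base vertex. -/
theorem isPath_of_mem_pairSet {u w : List (E × Bool)} (hq : q ∈ α.pairSet u w) :
    ∃ x y, Γ.IsPath α.base u x ∧ Γ.IsPath α.base w y ∧ FreeGroup.IsReduced u ∧
      FreeGroup.IsReduced w :=
  ⟨_, _, (α.isRay_boundaryMap _).isPath_of_mem hq.1, (α.isRay_boundaryMap _).isPath_of_mem hq.2,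
    isReduced_of_mem_prefixSet hq.1, isReduced_of_mem_prefixSet hq.2⟩

/-- A measure which is finite on compact sets is determined by its values on cylinders. -/
theorem ext_of_cylinder {ν₁ ν₂ : Measure (DoubleBoundary (Fin N))} [IsFiniteMeasureOnCompacts ν₁]
    (h : ∀ c x v y, Γ.IsPathClass α.base c x → Γ.IsPath x v y → FreeGroup.IsReduced v → v ≠ [] →
      ν₁ (α.cylinder c v) = ν₂ (α.cylinder c v)) : ν₁ = ν₂ := by
  refine ext_of_pairSet (α := α) fun u w h1 h2 ⟨q, hq⟩ => ?_
  obtain ⟨x, y, hx, hy, hu, hw⟩ := isPath_of_mem_pairSet hq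
  rw [pairSet_eq_cylinder h1 h2 hu hw hx]
  have hu' : Γ.IsPathClass α.base (FreeGroup.mk u) x := ⟨u, hx, rfl⟩
  have hw' : Γ.IsPathClass α.base (FreeGroup.mk w) y := ⟨w, hy, rfl⟩
  refine h _ _ _ _ hu' (hu'.inv.mul hw').isPath_toWord FreeGroup.isReduced_toWord fun hnil => h1 ?_
  rw [FreeGroup.toWord_eq_nil_iff, inv_mul_eq_one] at hnil
  rw [← FreeGroup.toWord_mk_of_isReduced hu, hnil, FreeGroup.toWord_mk_of_isReduced hw]

/-- The values of a measure on cylinders are given by a function on edge-paths that satisfies the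
Kirchhoff rules, if this is so for the pairs of cones. -/
theorem measure_cylinder_eq_of_pairSet {ν : Measure (DoubleBoundary (Fin N))}
    {m : List (E × Bool) → ℝ≥0∞} (hr : ∀ v, v ≠ [] → ∑ d, m (v ++ [d]) = m v)
    (hl : ∀ v, v ≠ [] → ∑ d, m (d :: v) = m v)
    (h0 : ∀ v, v ≠ [] → m v ≠ 0 → FreeGroup.IsReduced v ∧ Γ.IsEdgePath v)
    (hP : ∀ u w x y, ¬ u <+: w → ¬ w <+: u → FreeGroup.IsReduced u → FreeGroup.IsReduced w →
      Γ.IsPath α.base u x → Γ.IsPath α.base w y →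
      ν (α.pairSet u w) = m ((FreeGroup.mk u)⁻¹ * FreeGroup.mk w).toWord)
    (hc : Γ.IsPathClass α.base c x) {y : V} (hp : Γ.IsPath x v y) (hv : v ≠ []) :
    ν (α.cylinder c v) = m v := by
  have hbad : ∀ {c x v}, Γ.IsPathClass α.base c x → v ≠ [] →
      ¬ (FreeGroup.IsReduced v ∧ Γ.IsEdgePath v) → ν (α.cylinder c v) = m v := by
    intro c x v hc hv hb
    have hm : m v = 0 := by
      by_contra h
      exact hb (h0 v hv h)
    rw [hm]
    by_contra h
    obtain ⟨q, hq⟩ := nonempty_of_measure_ne_zero h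
    exact hb ⟨isReduced_of_mem_cylinder hq hv, x, isPath_of_mem_cylinder hc hq hv⟩
  -- Here the near end already turns away from the base vertex. Appending a letter either makes the
  -- far end do so too, and the cylinder is a pair of cones, or brings the far end nearer to the
  -- base vertex, which the induction covers.
  have hright : ∀ n, ∀ c x v y u, (c * FreeGroup.mk v).norm = n → Γ.IsPathClass α.base c x →
      Γ.IsPath x v y → ∀ hv : v ≠ [], c.toWord = u ++ [flipLetter (v.head hv)] →
      ν (α.cylinder c v) = m v := by
    intro n
    induction n using Nat.strong_induction_on with
    | _ n ih =>
      intro c x v y u hn hc hp hv hu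
      by_cases hred : FreeGroup.IsReduced v
      swap
      · exact hbad hc hv fun h => hred h.1
      rw [← sum_measure_cylinder_concat ν hc hv, ← hr v hv]
      refine Finset.sum_congr rfl fun d _ => ?_
      by_cases hgood : FreeGroup.IsReduced (v ++ [d]) ∧ Γ.IsEdgePath (v ++ [d])
      swap
      · exact hbad hc (by simp) hgood
      obtain ⟨hred', x', y', hp'⟩ := hgood
      have hp'' : Γ.IsPath x (v ++ [d]) y' := by
        obtain ⟨z, h1, -⟩ := EdgeGraph.isPath_append_iff.1 hp'
        rwa [h1.unique_start hp hv] at hp'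
      have hhead : (v ++ [d]).head (by simp) = v.head hv := List.head_append_of_ne_nil hv
      have hu' : c.toWord = u ++ [flipLetter ((v ++ [d]).head (by simp))] := by rw [hhead, hu]
      have hmul : c * FreeGroup.mk (v ++ [d]) = c * FreeGroup.mk v * FreeGroup.mk [d] := by
        rw [← FreeGroup.mul_mk, mul_assoc]
      rcases FreeGroup.toWord_mul_letter (c * FreeGroup.mk v) d with h | h
      · rw [← hmul] at h
        obtain ⟨e1, h1, h2⟩ := cylinder_eq_pairSet hc hred' (by simp) hu'
          (w := (c * FreeGroup.mk v).toWord) (by simp [h])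
        have hc' : Γ.IsPathClass α.base (c * FreeGroup.mk (v ++ [d])) y' := hc.mul ⟨_, hp'', rfl⟩
        rw [e1, hP _ _ _ _ h1 h2 FreeGroup.isReduced_toWord FreeGroup.isReduced_toWord
          hc.isPath_toWord hc'.isPath_toWord, FreeGroup.mk_toWord, FreeGroup.mk_toWord,
          inv_mul_cancel_left, FreeGroup.toWord_mk_of_isReduced hred']
      · refine ih _ ?_ c x _ y' u rfl hc hp'' (by simp) hu'
        rw [← hmul] at h
        have := congrArg List.length h
        rw [List.length_append, List.length_singleton] at this
        rw [← hn, FreeGroup.norm, FreeGroup.norm]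
        omega
  -- The same at the near end: a letter put in front either turns away from the base vertex, so that
  -- `hright` applies, or brings the near end closer to it.
  have hleft : ∀ n, ∀ c x v y, c.norm = n → Γ.IsPathClass α.base c x →
      Γ.IsPath x v y → v ≠ [] → ν (α.cylinder c v) = m v := by
    intro n
    induction n using Nat.strong_induction_on with
    | _ n ih =>
      intro c x v y hn hc hp hv
      rw [← sum_measure_cylinder_cons ν hc hv, ← hl v hv]
      refine Finset.sum_congr rfl fun d _ => ?_
      by_cases hgood : FreeGroup.IsReduced (d :: v) ∧ Γ.IsEdgePath (d :: v)
      swap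
      · have hm : m (d :: v) = 0 := by
          by_contra h
          exact hgood (h0 _ (by simp) h)
        rw [hm]
        by_contra h
        obtain ⟨q, hq⟩ := nonempty_of_measure_ne_zero h
        exact hgood ⟨isReduced_of_mem_cylinder hq (by simp), _, isPath_of_mem_cylinder
          (isPathClass_of_mem_cylinder hq (by simp)) hq (by simp)⟩
      obtain ⟨hred', x', y', hx', hp'⟩ := hgood
      have hdx : Γ.term d = x := hp'.unique_start hp hv
      have hc' : Γ.IsPathClass α.base (c * (FreeGroup.mk [d])⁻¹) (Γ.init d) :=
        hc.mul (hdx ▸ (EdgeGraph.isPathClass_letter d).inv)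
      rw [← FreeGroup.mk_flipLetter] at hc' ⊢
      rcases FreeGroup.toWord_mul_letter c (flipLetter d) with h | h
      · exact hright _ _ _ _ y' _ rfl hc' ⟨rfl, hp'⟩ (by simp) h
      · refine ih _ ?_ _ _ _ y' rfl hc' ⟨rfl, hp'⟩ (by simp)
        have := congrArg List.length h
        rw [List.length_append, List.length_singleton] at this
        rw [← hn, FreeGroup.norm, FreeGroup.norm]
        omega
  exact hleft _ c x v y rfl hc hp hv

end Marking

/-! ## Existence of a measure with given values on pairs of cones -/

/-- A limit of finitely additive set functions which are eventually constant on a cover by compact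
open sets is realized by a regular measure. -/
theorem exists_regular_measure_of_eventually_eq {X : Type*} [TopologicalSpace X] [T2Space X]
    [LocallyCompactSpace X] [MeasurableSpace X] [BorelSpace X] {Λ : ℕ → Set X → ℝ≥0}
    (hmono : ∀ k S T, S ⊆ T → Λ k S ≤ Λ k T)
    (hadd : ∀ k S T, Disjoint S T → Λ k (S ∪ T) = Λ k S + Λ k T) {B : Set (Set X)}
    (hB : ∀ q, ∃ P ∈ B, q ∈ P) (hBo : ∀ P ∈ B, IsOpen P) (hBc : ∀ P ∈ B, IsCompact P)
    {a : Set X → ℝ≥0} (ha : ∀ P ∈ B, ∀ᶠ k in atTop, Λ k P = a P) :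
    ∃ ν : Measure X, ν.Regular ∧ ∀ P ∈ B, ν P = a P := by
  have hunion : ∀ k S T, Λ k (S ∪ T) ≤ Λ k S + Λ k T := by
    intro k S T
    rw [← Set.union_sdiff_self, hadd k S _ Set.disjoint_sdiff_right]
    exact add_le_add_right (hmono k _ _ Set.sdiff_subset) _
  have hbdd : ∀ K, IsCompact K → ∃ C, ∀ᶠ k in atTop, Λ k K ≤ C := by
    intro K hK
    refine hK.induction_on (p := fun S => ∃ C, ∀ᶠ k in atTop, Λ k S ≤ C) ?_ ?_ ?_ ?_
    · refine ⟨0, Eventually.of_forall fun k => le_of_eq ?_⟩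
      have := hadd k ∅ ∅ (Set.disjoint_empty _)
      rwa [Set.union_empty, left_eq_add] at this
    · rintro S T hST ⟨C, hC⟩
      exact ⟨C, hC.mono fun k hk => (hmono k _ _ hST).trans hk⟩
    · rintro S T ⟨C, hC⟩ ⟨D, hD⟩
      exact ⟨C + D, (hC.and hD).mono fun k hk => (hunion k S T).trans (add_le_add hk.1 hk.2)⟩
    · intro q _
      obtain ⟨P, hP, hq⟩ := hB q
      exact ⟨P, mem_nhdsWithin_of_mem_nhds ((hBo P hP).mem_nhds hq), a P,
        (ha P hP).mono fun k hk => hk.le⟩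
  -- On general compact sets nothing is known to converge, so a limit along an ultrafilter is taken;
  -- it exists by boundedness. These limits inherit finite additivity and form a content.
  have hlim : ∀ K : TopologicalSpace.Compacts X,
      ∃ L, Tendsto (fun k => Λ k K) (hyperfilter ℕ : Filter ℕ) (𝓝 L) := by
    intro K
    obtain ⟨C, hC⟩ := hbdd K K.isCompact
    obtain ⟨L, -, hL⟩ := (isCompact_Icc (a := (0 : ℝ≥0)) (b := C)).ultrafilter_le_nhds
      ((hyperfilter ℕ).map fun k => Λ k K) (by
        rw [le_principal_iff]
        exact (hC.filter_mono Nat.hyperfilter_le_atTop).mono fun k hk => ⟨zero_le, hk⟩)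
    exact ⟨L, hL⟩
  choose L hL using hlim
  let cont : Content X :=
    { toFun := L
      mono' := fun K₁ K₂ h => le_of_tendsto_of_tendsto' (hL K₁) (hL K₂) fun k => hmono k _ _ h
      sup_disjoint' := fun K₁ K₂ h _ _ => by
        refine tendsto_nhds_unique (hL (K₁ ⊔ K₂)) (((hL K₁).add (hL K₂)).congr fun k => ?_)
        rw [TopologicalSpace.Compacts.coe_sup, hadd k _ _ h]
      sup_le' := fun K₁ K₂ => le_of_tendsto_of_tendsto' (hL (K₁ ⊔ K₂)) ((hL K₁).add (hL K₂))
        fun k => by rw [TopologicalSpace.Compacts.coe_sup]; exact hunion k _ _ }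
  -- On compact open sets the measure agrees with the content, and for members of `B` the
  -- ultrafilter limit is the eventual value.
  refine ⟨cont.measure, inferInstance, fun P hP => ?_⟩
  rw [cont.measure_apply (hBo P hP).measurableSet, cont.outerMeasure_of_isOpen P (hBo P hP),
    cont.innerContent_of_isCompact (hBc P hP) (hBo P hP)]
  have : L ⟨P, hBc P hP⟩ = a P := by
    refine tendsto_nhds_unique (hL ⟨P, hBc P hP⟩) (tendsto_const_nhds.congr' ?_)
    exact ((ha P hP).filter_mono Nat.hyperfilter_le_atTop).mono fun k hk => hk.symm
  rw [← this]
  rfl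

namespace Marking

open FreeBoundary

variable {N : ℕ} {V E : Type*} [DecidableEq E] [Fintype E] {Γ : EdgeGraph V E} {α : Marking N Γ}

/-- A consistent system of weights on incomparable pairs of nonempty cones comes from a regular
measure. -/
theorem exists_measure_pairSet {A : List (E × Bool) → List (E × Bool) → ℝ≥0}
    (hr : ∀ u w, ¬ u <+: w → ¬ w <+: u → ∑ d, A u (w ++ [d]) = A u w)
    (hl : ∀ u w, ¬ u <+: w → ¬ w <+: u → ∑ d, A (u ++ [d]) w = A u w)
    (h0 : ∀ u w, A u w ≠ 0 → (α.pairSet u w).Nonempty) :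
    ∃ ν : Measure (DoubleBoundary (Fin N)), ν.Regular ∧
      ∀ u w, ¬ u <+: w → ¬ w <+: u → ν (α.pairSet u w) = A u w := by
  classical
  -- A point mass `A u w` is placed at a chosen point of each nonempty pair of cones; `Λ k` is the
  -- sum of these masses over words of length `k`.
  let F : Set (DoubleBoundary (Fin N)) → List (E × Bool) → List (E × Bool) → ℝ≥0 := fun S u w =>
    if ∃ h : (α.pairSet u w).Nonempty, h.some ∈ S then A u w else 0
  let Λ : ℕ → Set (DoubleBoundary (Fin N)) → ℝ≥0 := fun k S =>
    wordSum k fun u => wordSum k fun w => F S u w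
  -- For large `k` a chosen point lies in the two cones exactly when its words extend `u` and `w`,
  -- and the Kirchhoff rules add up the masses.
  have key : ∀ u w, ¬ u <+: w → ¬ w <+: u → ∀ᶠ k in atTop, Λ k (α.pairSet u w) = A u w := by
    intro u w h1 h2
    filter_upwards [eventually_ge_atTop u.length, eventually_ge_atTop w.length] with k hk1 hk2
    have hF : ∀ u' w', u'.length = k → w'.length = k →
        F (α.pairSet u w) u' w' = if u <+: u' then if w <+: w' then A u' w' else 0 else 0 := by
      intro u' w' hu' hw'
      by_cases hA : A u' w' = 0
      · simp [F, hA]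
      have hne := h0 _ _ hA
      have hiff : hne.some ∈ α.pairSet u w ↔ u <+: u' ∧ w <+: w' := by
        constructor
        · exact fun h => ⟨prefix_total_of_mem h.1 hne.some_mem.1 (by omega),
            prefix_total_of_mem h.2 hne.some_mem.2 (by omega)⟩
        · exact fun h => ⟨mem_prefixSet_of_prefix hne.some_mem.1 h.1,
            mem_prefixSet_of_prefix hne.some_mem.2 h.2⟩
      have hex : (∃ h : (α.pairSet u' w').Nonempty, h.some ∈ α.pairSet u w) ↔
          u <+: u' ∧ w <+: w' := ⟨fun ⟨_, h⟩ => hiff.1 h, fun h => ⟨hne, hiff.2 h⟩⟩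
      simp only [F, hex, ite_and]
    obtain ⟨i, rfl⟩ := Nat.exists_eq_add_of_le hk1
    obtain ⟨j, hj⟩ := Nat.exists_eq_add_of_le hk2
    have hinc : ∀ x y, ¬ u ++ x <+: w ++ y ∧ ¬ w ++ y <+: u ++ x := by
      refine fun x y => ⟨fun h => ?_, fun h => ?_⟩
      · rcases List.prefix_or_prefix_of_prefix ((List.prefix_append u x).trans h)
          (List.prefix_append w y) with h' | h'
        exacts [h1 h', h2 h']
      · rcases List.prefix_or_prefix_of_prefix (List.prefix_append u x)
          ((List.prefix_append w y).trans h) with h' | h'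
        exacts [h1 h', h2 h']
    have hin : ∀ x, wordSum (u.length + i) (fun w' => if w <+: w' then A (u ++ x) w' else 0) =
        A (u ++ x) w := by
      intro x
      rw [hj, wordSum_prefix, wordSum_eq_apply_nil (F := fun y => A (u ++ x) (w ++ y)),
        List.append_nil]
      intro y
      rw [← hr _ _ (hinc x y).1 (hinc x y).2]
      simp only [List.append_assoc]
    calc Λ (u.length + i) (α.pairSet u w)
        = wordSum (u.length + i) fun u' => if u <+: u' then
            wordSum (u.length + i) (fun w' => if w <+: w' then A u' w' else 0) else 0 := by
          refine wordSum_congr fun u' hu' => ?_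
          rw [wordSum_congr fun w' hw' => hF u' w' hu' hw']
          split_ifs
          · rfl
          · exact wordSum_zero _
      _ = wordSum i fun x => A (u ++ x) w := by
          rw [wordSum_prefix]
          exact wordSum_congr fun x _ => hin x
      _ = A u w := by
          rw [wordSum_eq_apply_nil (F := fun x => A (u ++ x) w), List.append_nil]
          intro x
          have h3 := hinc x []
          rw [List.append_nil] at h3
          rw [← hl _ _ h3.1 h3.2]
          simp only [List.append_assoc]
  -- The values must depend on the set and not on the words that describe it; defining them as
  -- limits settles this.
  let a : Set (DoubleBoundary (Fin N)) → ℝ≥0 := fun P => limUnder atTop fun k => Λ k P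
  have ha : ∀ u w, ¬ u <+: w → ¬ w <+: u → a (α.pairSet u w) = A u w := fun u w h1 h2 =>
    (tendsto_const_nhds.congr' ((key u w h1 h2).mono fun k hk => hk.symm)).limUnder_eq
  obtain ⟨ν, hν, h⟩ : ∃ ν : Measure (DoubleBoundary (Fin N)), ν.Regular ∧
      ∀ P ∈ α.pairSets, ν P = a P := by
    refine exists_regular_measure_of_eventually_eq (Λ := Λ)
      (fun k S T hST => wordSum_mono fun u _ => wordSum_mono fun w _ => ?_)
      (fun k S T hST => ?_) (fun q => ?_) ?_ ?_ ?_
    · simp only [F]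
      split_ifs with hS hT
      · exact le_rfl
      · exact absurd (hS.imp fun _ h => hST h) hT
      · exact zero_le
      · exact le_rfl
    · rw [← wordSum_add]
      refine wordSum_congr fun u _ => ?_
      rw [← wordSum_add]
      refine wordSum_congr fun w _ => ?_
      by_cases hne : (α.pairSet u w).Nonempty
      · have : hne.some ∈ S → hne.some ∉ T := fun h1 => Set.disjoint_left.1 hST h1
        by_cases h1 : hne.some ∈ S <;> by_cases h2 : hne.some ∈ T <;> simp_all [F]
      · simp [F, hne]
    · obtain ⟨P, hP, hq, -⟩ := exists_mem_pairSets (α := α) isOpen_univ (Set.mem_univ q)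
      exact ⟨P, hP, hq⟩
    · rintro _ ⟨u, w, -, -, rfl⟩
      exact (isClopen_pairSet u w).2
    · rintro _ ⟨u, w, h1, h2, rfl⟩
      exact isCompact_pairSet h1 h2
    · rintro _ ⟨u, w, h1, h2, rfl⟩
      rw [ha u w h1 h2]
      exact key u w h1 h2
  refine ⟨ν, hν, fun u w h1 h2 => ?_⟩
  rw [h _ ⟨u, w, h1, h2, rfl⟩, ha u w h1 h2]

end Marking

/-! ## Existence of a current with given values on cylinders -/

namespace EdgeGraph

variable {V E : Type*} {Γ : EdgeGraph V E}

theorem NoValenceOne.exists_next (h : Γ.NoValenceOne) (d : E × Bool) :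
    ∃ d', Γ.init d' = Γ.term d ∧ d' ≠ flipLetter d := by
  by_contra! hcon
  refine h (Γ.term d) ?_
  rw [Nat.card_eq_one_iff_unique]
  exact ⟨⟨fun a b => Subtype.ext ((hcon _ a.2).trans (hcon _ b.2).symm)⟩,
    ⟨⟨flipLetter d, init_flipLetter d⟩⟩⟩

theorem NoValenceOne.exists_isRay (h : Γ.NoValenceOne) (d : E × Bool) :
    ∃ ζ : FreeBoundary E, Γ.IsRay (Γ.term d) ζ ∧ ζ.1 0 ≠ flipLetter d := by
  choose s h1 h2 using h.exists_next
  have hs : ∀ n, s^[n + 1] d = s (s^[n] d) := fun n => Function.iterate_succ_apply' s n d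
  refine ⟨⟨fun n => s^[n + 1] d, fun n => ?_⟩, ⟨h1 d, fun n => ?_⟩, h2 d⟩
  · change s^[n + 1 + 1] d ≠ flipLetter (s^[n + 1] d)
    rw [hs (n + 1)]
    exact h2 _
  · change Γ.term (s^[n + 1] d) = Γ.init (s^[n + 1 + 1] d)
    rw [hs (n + 1)]
    exact (h1 _).symm

end EdgeGraph

namespace Marking

open FreeBoundary

variable {N : ℕ} {V E : Type*} [Finite V] [DecidableEq E] [Fintype E] {Γ : EdgeGraph V E}
  {α : Marking N Γ}

theorem exists_boundaryMap_mem_prefixSet (hΓ : Γ.IsConnected) (hval : Γ.NoValenceOne)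
    {w : List (E × Bool)} {x : V} (hw : FreeGroup.IsReduced w) (hp : Γ.IsPath α.base w x)
    (hne : w ≠ []) : ∃ X, α.boundaryMap X ∈ prefixSet w := by
  obtain ⟨w, d, rfl⟩ := (List.eq_nil_or_concat' w).resolve_left hne
  obtain ⟨ζ, h1, h2⟩ := hval.exists_isRay d
  have hx : x = Γ.term d := by
    obtain ⟨z, -, -, h⟩ := EdgeGraph.isPath_append_iff.1 hp
    exact Eq.symm h
  obtain ⟨X, hX⟩ := α.exists_boundaryMap_eq_of_isRay hΓ
    (EdgeGraph.IsRay.smul ⟨_, hp, rfl⟩ (hx ▸ h1))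
  refine ⟨X, hX ▸ mk_smul_mem_prefixSet hw (by simp) ?_⟩
  rwa [List.getLast_append_singleton]

/-- Point masses can only be placed where there are points. Without valence-one vertices every
reduced path extends to a ray, and by connectedness every ray from the base vertex comes from a
boundary point. -/
theorem nonempty_pairSet (hΓ : Γ.IsConnected) (hval : Γ.NoValenceOne)
    {u w : List (E × Bool)} {x y : V} (h1 : ¬ u <+: w) (h2 : ¬ w <+: u)
    (hu : FreeGroup.IsReduced u) (hw : FreeGroup.IsReduced w) (hx : Γ.IsPath α.base u x)
    (hy : Γ.IsPath α.base w y) : (α.pairSet u w).Nonempty := by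
  obtain ⟨X, hX⟩ := exists_boundaryMap_mem_prefixSet hΓ hval hu hx
    (fun h => h1 (h ▸ List.nil_prefix))
  obtain ⟨Y, hY⟩ := exists_boundaryMap_mem_prefixSet hΓ hval hw hy
    (fun h => h2 (h ▸ List.nil_prefix))
  refine ⟨⟨(X, Y), ?_⟩, hX, hY⟩
  rintro (rfl : X = Y)
  rcases le_total u.length w.length with h | h
  · exact h1 (prefix_total_of_mem hX hY h)
  · exact h2 (prefix_total_of_mem hY hX h)

variable (α) in
/-- The pairs of incomparable reduced edge-paths that start at the base vertex. -/
def IsConePair (u w : List (E × Bool)) : Prop :=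
  ¬ u <+: w ∧ ¬ w <+: u ∧ FreeGroup.IsReduced u ∧ FreeGroup.IsReduced w ∧
    (∃ x, Γ.IsPath α.base u x) ∧ ∃ y, Γ.IsPath α.base w y

omit [Finite V] [DecidableEq E] [Fintype E] in
theorem IsConePair.symm {u w : List (E × Bool)} (h : α.IsConePair u w) : α.IsConePair w u :=
  ⟨h.2.1, h.1, h.2.2.2.1, h.2.2.1, h.2.2.2.2.2, h.2.2.2.2.1⟩

open Classical in
variable (α) in
/-- The weight of a pair of cones determined by a weight on edge-paths. -/
noncomputable def coneWeight (m : List (E × Bool) → ℝ≥0) (u w : List (E × Bool)) : ℝ≥0 :=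
  if α.IsConePair u w then m ((FreeGroup.mk u)⁻¹ * FreeGroup.mk w).toWord else 0

omit [Finite V] [Fintype E] in
theorem toWord_ne_nil_of_isConePair {u w : List (E × Bool)} (h : α.IsConePair u w) :
    ((FreeGroup.mk u)⁻¹ * FreeGroup.mk w).toWord ≠ [] := by
  intro hnil
  rw [FreeGroup.toWord_eq_nil_iff, inv_mul_eq_one] at hnil
  refine h.1 ?_
  rw [← FreeGroup.toWord_mk_of_isReduced h.2.2.1, hnil,
    FreeGroup.toWord_mk_of_isReduced h.2.2.2.1]

omit [Finite V] [Fintype E] in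
theorem coneWeight_symm {m : List (E × Bool) → ℝ≥0}
    (hi : ∀ v, v ≠ [] → m (FreeGroup.invRev v) = m v) (u w : List (E × Bool)) :
    α.coneWeight m u w = α.coneWeight m w u := by
  by_cases h : α.IsConePair u w
  · rw [coneWeight, coneWeight, if_pos h, if_pos h.symm, ← hi _ (toWord_ne_nil_of_isConePair h),
      ← FreeGroup.toWord_inv, mul_inv_rev, inv_inv]
  · rw [coneWeight, coneWeight, if_neg h, if_neg fun h' => h h'.symm]

-- Lengthening `w` by a letter lengthens the segment between the cones by the same letter. Letters
-- that do not continue to a reduced edge-path contribute nothing on either side, by `h0`.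
omit [Finite V] in
theorem sum_coneWeight_concat {m : List (E × Bool) → ℝ≥0}
    (hr : ∀ v, v ≠ [] → ∑ d, m (v ++ [d]) = m v)
    (h0 : ∀ v, v ≠ [] → m v ≠ 0 → FreeGroup.IsReduced v ∧ Γ.IsEdgePath v)
    {u w : List (E × Bool)} (h1 : ¬ u <+: w) (h2 : ¬ w <+: u) :
    ∑ d, α.coneWeight m u (w ++ [d]) = α.coneWeight m u w := by
  by_cases h : α.IsConePair u w
  swap
  · rw [coneWeight, if_neg h]
    refine Finset.sum_eq_zero fun d _ => if_neg fun h' => h ⟨h1, h2, h'.2.2.1, ?_, h'.2.2.2.2.1, ?_⟩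
    · exact h'.2.2.2.1.infix (List.prefix_append _ _).isInfix
    · obtain ⟨y, hy⟩ := h'.2.2.2.2.2
      obtain ⟨z, hz, -⟩ := EdgeGraph.isPath_append_iff.1 hy
      exact ⟨z, hz⟩
  rw [coneWeight, if_pos h, ← hr _ (toWord_ne_nil_of_isConePair h)]
  refine Finset.sum_congr rfl fun d _ => ?_
  obtain ⟨p, a, b, u', w', hab, rfl, rfl⟩ := exists_append_of_not_prefix h1 h2
  obtain ⟨-, -, hu, hw, hx, y, hy⟩ := h
  have happ : p ++ b :: w' ++ [d] = p ++ b :: (w' ++ [d]) := by simp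
  by_cases h' : α.IsConePair (p ++ a :: u') (p ++ b :: w' ++ [d])
  · rw [coneWeight, if_pos h', happ, toWord_inv_mk_mul_mk hab hu (happ ▸ h'.2.2.2.1),
      toWord_inv_mk_mul_mk hab hu hw]
    simp
  · rw [coneWeight, if_neg h', toWord_inv_mk_mul_mk hab hu hw]
    by_contra hne
    obtain ⟨hred, hpath⟩ := h0 _ (by simp) (Ne.symm hne)
    have hinf : b :: w' ++ [d] <:+: FreeGroup.invRev (a :: u') ++ b :: w' ++ [d] := by
      rw [List.append_assoc]
      exact (List.suffix_append _ _).isInfix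
    refine h' ⟨fun hc => ?_, fun hc => h2 ((List.prefix_append _ _).trans hc), hu, ?_, hx, ?_⟩
    · rw [happ, List.prefix_append_right_inj, List.cons_prefix_cons] at hc
      exact hab hc.1
    · rw [List.append_assoc]
      rw [← List.append_nil (p ++ (b :: w' ++ [d])), List.append_nil, ← List.append_assoc]
      exact hw.append_overlap (hred.infix hinf) (by simp)
    · obtain ⟨x', y', hp'⟩ := hpath.infix hinf
      obtain ⟨z, hz1, hz2⟩ := EdgeGraph.isPath_append_iff.1 hy
      refine ⟨y', ?_⟩
      rw [List.append_assoc]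
      refine EdgeGraph.isPath_append_iff.2 ⟨z, hz1, ?_⟩
      have : x' = z := hp'.1.symm.trans hz2.1
      exact this ▸ hp'

omit [Finite V] [DecidableEq E] in
theorem sum_apply_cons_of_invRev {m : List (E × Bool) → ℝ≥0}
    (hr : ∀ v, v ≠ [] → ∑ d, m (v ++ [d]) = m v)
    (hi : ∀ v, v ≠ [] → m (FreeGroup.invRev v) = m v) {v : List (E × Bool)} (hv : v ≠ []) :
    ∑ d, m (d :: v) = m v := by
  rw [← hi v hv, ← hr _ (invRev_ne_nil hv)]
  let e : E × Bool ≃ E × Bool :=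
    ⟨flipLetter, flipLetter, flipLetter_flipLetter, flipLetter_flipLetter⟩
  refine Fintype.sum_equiv e _ _ fun d => ?_
  rw [← hi (d :: v) (by simp)]
  simp [FreeGroup.invRev, e, flipLetter]

/-- A weight on reduced edge-paths which satisfies the Kirchhoff rule and is invariant under
inversion comes from a geodesic current. -/
theorem exists_current (hΓ : Γ.IsConnected) (hval : Γ.NoValenceOne) {m : List (E × Bool) → ℝ≥0}
    (hr : ∀ v, v ≠ [] → ∑ d, m (v ++ [d]) = m v)
    (hi : ∀ v, v ≠ [] → m (FreeGroup.invRev v) = m v)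
    (h0 : ∀ v, v ≠ [] → m v ≠ 0 → FreeGroup.IsReduced v ∧ Γ.IsEdgePath v) :
    ∃ μ : GeodesicCurrent N, ∀ c x v y, Γ.IsPathClass α.base c x → Γ.IsPath x v y → v ≠ [] →
      μ.toMeasure (α.cylinder c v) = m v := by
  obtain ⟨ν, hν, h⟩ := exists_measure_pairSet (α := α) (A := α.coneWeight m)
    (fun u w h1 h2 => sum_coneWeight_concat hr h0 h1 h2)
    (fun u w h1 h2 => by
      simp only [coneWeight_symm hi _ w]
      exact sum_coneWeight_concat hr h0 h2 h1)
    (fun u w hne => by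
      by_cases hc : α.IsConePair u w
      · obtain ⟨h1, h2, hu, hw, ⟨x, hx⟩, y, hy⟩ := hc
        exact nonempty_pairSet hΓ hval h1 h2 hu hw hx hy
      · exact absurd (if_neg hc) hne)
  have hcyl : ∀ c x v y, Γ.IsPathClass α.base c x → Γ.IsPath x v y → v ≠ [] →
      ν (α.cylinder c v) = m v := by
    intro c x v y hc hp hv
    refine measure_cylinder_eq_of_pairSet (m := fun v => (m v : ℝ≥0∞)) (fun v hv => ?_)
      (fun v hv => ?_) (fun v hv hne => h0 v hv (by simpa using hne)) ?_ hc hp hv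
    · rw [← hr v hv, ENNReal.ofNNReal_finsetSum]
    · rw [← sum_apply_cons_of_invRev hr hi hv, ENNReal.ofNNReal_finsetSum]
    · intro u w x y h1 h2 hu hw hx hy
      rw [h u w h1 h2, coneWeight, if_pos ⟨h1, h2, hu, hw, ⟨x, hx⟩, y, hy⟩]
  refine ⟨⟨ν, hν, fun g S hS => ?_, fun S hS => ?_⟩, hcyl⟩
  · have hmeas : Measurable (DoubleBoundary.translate g : DoubleBoundary (Fin N) → _) :=
      (DoubleBoundary.continuous_translate g).measurable
    -- Invariance is tested on cylinders only, where the mass depends on the word and not on its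
    -- lift.
    have : ν = ν.map (DoubleBoundary.translate g) := by
      refine ext_of_cylinder (α := α) fun c x v y hc hp _ hv => ?_
      rw [Measure.map_apply hmeas (measurableSet_cylinder hc hv), hcyl c x v y hc hp hv]
      have hc' : Γ.IsPathClass α.base ((α.hom g)⁻¹ * c) x := (α.isPathClass_hom g).inv.mul hc
      have := preimage_translate_cylinder (α := α) hc' hv g
      rw [mul_inv_cancel_left] at this
      rw [this, hcyl _ x v y hc' hp hv]
    conv_rhs => rw [this]
    rw [Measure.map_apply hmeas hS]
  · have hmeas : Measurable (DoubleBoundary.flip : DoubleBoundary (Fin N) → _) :=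
      DoubleBoundary.continuous_flip.measurable
    have : ν = ν.map DoubleBoundary.flip := by
      refine ext_of_cylinder (α := α) fun c x v y hc hp hred hv => ?_
      rw [Measure.map_apply hmeas (measurableSet_cylinder hc hv), hcyl c x v y hc hp hv,
        preimage_flip_cylinder hc hp hred hv, hcyl _ y _ x (hc.mul ⟨v, hp, rfl⟩)
        (Γ.isPath_invRev hp) (invRev_ne_nil hv), hi v hv]
    conv_rhs => rw [this]
    rw [Measure.map_apply hmeas hS]

end Marking

/-! ## Currents supported in the lamination -/

instance {A : Type*} [Countable A] : SecondCountableTopology (DoubleBoundary A) :=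
  TopologicalSpace.Subtype.secondCountableTopology
    {q : FreeBoundary A × FreeBoundary A | q.1 ≠ q.2}

theorem Marking.nonempty_edges {N : ℕ} (hN : 1 ≤ N) {V E : Type*} {Γ : EdgeGraph V E}
    (α : Marking N Γ) : Nonempty E := by
  by_contra hE
  rw [not_nonempty_iff] at hE
  have : (1 : FreeGroup (Fin N)) = FreeGroup.of ⟨0, hN⟩ :=
    α.injective (Subsingleton.elim _ _)
  exact FreeGroup.one_ne_of _ this

namespace Marking

open FreeBoundary

variable {N : ℕ} {V E : Type*} [DecidableEq E] [Fintype E] {Γ : EdgeGraph V E} {α : Marking N Γ}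

/-- The measure of a cylinder of a current does not depend on the lift of the edge-path. -/
theorem measure_cylinder_eq_of_isPathClass (ν : GeodesicCurrent N) {c c' : FreeGroup E} {x : V}
    (hc : Γ.IsPathClass α.base c x) (hc' : Γ.IsPathClass α.base c' x) {v : List (E × Bool)}
    (hv : v ≠ []) : ν.toMeasure (α.cylinder c v) = ν.toMeasure (α.cylinder c' v) := by
  obtain ⟨g, hg⟩ := α.exists_hom_eq (hc'.mul hc.inv)
  have h1 := preimage_translate_cylinder hc hv g
  have h2 : α.hom g * c = c' := by rw [hg, inv_mul_cancel_right]
  rw [h2] at h1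
  rw [← h1, ν.translate_invariant g _ (measurableSet_cylinder hc' hv)]

/-- The words along a geodesic do not depend on its parametrization. -/
theorem IsGeodesicFor.exists_segment_eq {q : DoubleBoundary (Fin N)} {vert : ℤ → FreeGroup E}
    {γ : ℤ → E × Bool} (h : α.IsGeodesicFor q vert γ) {c : FreeGroup E} {v : List (E × Bool)}
    (hv : v ≠ []) (hq : q ∈ α.cylinder c v) : ∃ n, segment_of_line γ n v.length = v := by
  have hc := isPathClass_of_mem_cylinder hq hv
  have h1 := ((mem_cylinder_iff hc hv).1 hq).1
  obtain ⟨n, rfl⟩ : ∃ n, vert n = c := by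
    obtain ⟨vert', γ', h', m, rfl, -⟩ := hq
    exact h.exists_vert_eq (h'.ends_ne m)
  refine ⟨n, ?_⟩
  rw [h.rightEnd_eq, mem_prefixSet] at h1
  exact h1

end Marking

/-! ### The stable current and unique ergodicity -/

namespace GraphMap

open Marking

variable {N : ℕ} {V E : Type*} [DecidableEq E] [Fintype E] {Γ : EdgeGraph V E} {α : Marking N Γ}
  {f : GraphMap Γ}

theorem mem_language_of_mem_cylinder {q : DoubleBoundary (Fin N)} (hq : q ∈ f.bfhLamination α)
    {c : FreeGroup E} {v : List (E × Bool)} (hv : v ≠ []) (h : q ∈ α.cylinder c v) :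
    v ∈ f.language := by
  obtain ⟨vert, γ, hγ, hL⟩ := hq
  obtain ⟨n, hn⟩ := hγ.exists_segment_eq hv h
  rw [← hn, mem_language_iff_or]
  exact hL n v.length

theorem mem_bfhLamination [Nonempty E] {q : DoubleBoundary (Fin N)}
    (h : ∀ c x v, Γ.IsPathClass α.base c x → v ≠ [] → q ∈ α.cylinder c v → v ∈ f.language) :
    q ∈ f.bfhLamination α := by
  obtain ⟨vert, γ, hγ⟩ := α.exists_isGeodesicFor q
  refine ⟨vert, γ, hγ, fun n k => mem_language_iff_or.1 ?_⟩
  rcases Nat.eq_zero_or_pos k with rfl | hk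
  · exact ⟨0, (Classical.arbitrary E, true), List.nil_infix⟩
  · have hl : (segment_of_line γ n k).length = k := by simp [segment_of_line]
    exact h _ _ _ (hγ.line.is_vertex n) (by rw [← List.length_pos_iff, hl]; exact hk)
      ⟨vert, γ, hγ, n, rfl, by rw [hl]⟩

variable [Nonempty E] (hm : f.IsMixing) (he : f.IsExpanding) (hne : ∀ n d, f.iter n d ≠ [])

include hm he hne

/-- There is a current whose values on cylinders are the frequencies. -/
theorem exists_current_frequency [Finite V] (hΓ : Γ.IsConnected) (hval : Γ.NoValenceOne)
    (hred : ∀ k d, FreeGroup.IsReduced (f.iter k d)) :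
    ∃ μ : GeodesicCurrent N, ∀ c x v y, Γ.IsPathClass α.base c x → Γ.IsPath x v y → v ≠ [] →
      μ.toMeasure (α.cylinder c v) = ENNReal.ofReal (f.frequency v) := by
  refine exists_current hΓ hval (m := fun v => (f.frequency v).toNNReal) (fun v hv => ?_)
    (fun v hv => by rw [frequency_invRev hm he hne hv]) fun v hv h => ?_
  · rw [← Real.toNNReal_sum_of_nonneg fun d _ => frequency_nonneg hm he hne (by simp),
      sum_frequency_concat hm he hne hv]
  · have hl : v ∈ f.language :=
      mem_language_of_frequency_ne_zero hm he hne hv fun h' => h (by simp [h'])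
    refine ⟨?_, isEdgePath_of_mem_language hl⟩
    obtain ⟨k, d, hk⟩ := hl
    exact (hred k d).infix hk

variable {μ : GeodesicCurrent N}
  (hμ : ∀ c x v y, Γ.IsPathClass α.base c x → Γ.IsPath x v y → v ≠ [] →
    μ.toMeasure (α.cylinder c v) = ENNReal.ofReal (f.frequency v))

include hμ

/-- Limits are unique, so any stable current has the same cylinder masses as `μ`, and these
determine it. -/
theorem isStableCurrent_iff {ν : GeodesicCurrent N} : f.IsStableCurrent α ν ↔ ν = μ := by
  constructor
  · intro h
    have := μ.regular
    refine GeodesicCurrent.ext (Eq.symm (ext_of_cylinder (α := α) fun c x v y hc hp hr hv => ?_))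
    obtain ⟨a, ha, hν⟩ := h x y v hp hr hv
    rw [hν c hc, hμ c x v y hc hp hv, tendsto_nhds_unique (ha (Classical.arbitrary E, true))
      (tendsto_frequency hm he hne hv _)]
  · rintro rfl x y v hp _ hv
    exact ⟨_, tendsto_frequency hm he hne hv, fun c hc => hμ c x v y hc hp hv⟩

/-- The frequencies of the letters add up to 2, so one of them is positive; connectedness provides a
lift of that edge. -/
theorem toMeasure_ne_zero_of_frequency (hΓ : Γ.IsConnected) : μ.toMeasure ≠ 0 := by
  intro h
  obtain ⟨d, -, hd⟩ : ∃ d ∈ Finset.univ, f.frequency [d] ≠ 0 := by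
    refine Finset.exists_ne_zero_of_sum_ne_zero ?_
    rw [sum_frequency_singleton hm he hne]
    exact two_ne_zero
  obtain ⟨w, hw⟩ := hΓ α.base (Γ.init d)
  have h1 := hμ _ _ [d] _ ⟨w, hw, rfl⟩ (EdgeGraph.isPath_singleton d) (by simp)
  rw [h, Measure.coe_zero, Pi.zero_apply, eq_comm, ENNReal.ofReal_eq_zero] at h1
  exact hd (le_antisymm h1 (frequency_nonneg hm he hne (by simp)))

/-- Cylinders are open, so those around a point of the support have positive mass, and a word of
positive frequency occurs in an iterate. -/
theorem support_subset_bfhLamination : μ.toMeasure.support ⊆ f.bfhLamination α := by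
  intro q hq
  refine mem_bfhLamination fun c x v hc hv h => ?_
  obtain ⟨y, hp⟩ := isPath_of_mem_cylinder hc h hv
  have h1 := (Measure.mem_support_iff_forall q).1 hq _ ((isClopen_cylinder hc hv).2.mem_nhds h)
  rw [hμ c x v y hc hp hv, ENNReal.ofReal_pos] at h1
  exact mem_language_of_frequency_ne_zero hm he hne hv h1.ne'

/-- A current with support in the lamination is a multiple of the current of frequencies. -/
theorem exists_toMeasure_eq_smul (hΓ : Γ.IsConnected) {ν : GeodesicCurrent N}
    (hν : ν.toMeasure.support ⊆ f.bfhLamination α) :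
    ∃ r : ℝ≥0, ν.toMeasure = r • μ.toMeasure := by
  have := ν.regular
  choose w hw using fun x => hΓ α.base x
  set C : V → FreeGroup E := fun x => FreeGroup.mk (w x) with hCdef
  have hC : ∀ x, Γ.IsPathClass α.base (C x) x := fun x => ⟨w x, hw x, rfl⟩
  have hfin : ∀ {c x v}, Γ.IsPathClass α.base c x → v ≠ [] → ν.toMeasure (α.cylinder c v) ≠ ∞ :=
    fun hc hv => (isCompact_cylinder hc hv).measure_lt_top.ne
  -- The default `α.base` concerns only the empty word, for which no rule is claimed.
  let start : List (E × Bool) → V := fun v => (v.head?.map Γ.init).getD α.base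
  have hstart : ∀ (d : E × Bool) v, start (d :: v) = Γ.init d := fun d v => rfl
  have hstart' : ∀ v (hv : v ≠ []), start v = Γ.init (v.head hv) := by
    intro v hv
    cases v with
    | nil => exact absurd rfl hv
    | cons d v => rfl
  let m : List (E × Bool) → ℝ := fun v => (ν.toMeasure (α.cylinder (C (start v)) v)).toReal
  have hmC : ∀ {c x v y}, Γ.IsPathClass α.base c x → Γ.IsPath x v y → v ≠ [] →
      m v = (ν.toMeasure (α.cylinder c v)).toReal := by
    intro c x v y hc hp hv
    have hx : start v = x := (hstart' v hv).trans (hp.init_head hv)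
    rw [← measure_cylinder_eq_of_isPathClass ν (hC x) hc hv, ← hx]
  have hpath : ∀ v, v ≠ [] → m v ≠ 0 → ∃ q ∈ f.bfhLamination α, q ∈ α.cylinder (C (start v)) v := by
    intro v hv h
    have hpos : 0 < ν.toMeasure (α.cylinder (C (start v)) v) := by
      rw [pos_iff_ne_zero]
      intro h'
      exact h (by simp [m, h'])
    obtain ⟨q, hq, hs⟩ := Measure.nonempty_inter_support_of_pos hpos
    exact ⟨q, hν hs, hq⟩
  have hr : ∀ v, v ≠ [] → ∑ d, m (v ++ [d]) = m v := by
    intro v hv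
    have h1 : ∀ d : E × Bool, start (v ++ [d]) = start v := fun d => by
      rw [hstart' _ (by simp), hstart' v hv, List.head_append_of_ne_nil hv]
    simp only [m, h1]
    rw [← ENNReal.toReal_sum fun d _ => hfin (hC _) (by simp),
      sum_measure_cylinder_concat _ (hC _) hv]
  have hl : ∀ v, v ≠ [] → ∑ d, m (d :: v) = m v := by
    intro v hv
    have hx := hstart' v hv
    have h1 : ∀ d : E × Bool, ν.toMeasure (α.cylinder (C (start (d :: v))) (d :: v)) =
        ν.toMeasure (α.cylinder (C (start v) * (FreeGroup.mk [d])⁻¹) (d :: v)) := by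
      intro d
      by_cases hd : Γ.term d = start v
      · refine measure_cylinder_eq_of_isPathClass ν (hC _) ?_ (by simp)
        exact (hC _).mul (hd ▸ (EdgeGraph.isPathClass_letter d).inv)
      · have e1 : α.cylinder (C (start (d :: v))) (d :: v) = ∅ := by
          refine Set.eq_empty_of_forall_notMem fun q hq => hd ?_
          obtain ⟨y, -, hy⟩ := isPath_of_mem_cylinder (hC _) hq (by simp)
          rw [hx, hy.init_head hv]
        have e2 : α.cylinder (C (start v) * (FreeGroup.mk [d])⁻¹) (d :: v) = ∅ := by
          refine Set.eq_empty_of_forall_notMem fun q hq => hd ?_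
          have := (isPathClass_of_mem_cylinder hq (by simp)).mul (EdgeGraph.isPathClass_letter d)
          rw [inv_mul_cancel_right] at this
          exact this.unique_end (hC _)
        rw [e1, e2]
    simp only [m, h1]
    rw [← ENNReal.toReal_sum fun d _ => by rw [← h1]; exact hfin (hC _) (by simp),
      sum_measure_cylinder_cons _ (hC _) hv]
  -- The flip identity for cylinders requires a reduced edge-path, which a nonzero mass guarantees.
  -- The case of mass zero follows by applying this to the inverse word.
  have hi' : ∀ v, v ≠ [] → m v ≠ 0 → m (FreeGroup.invRev v) = m v := by
    intro v hv h
    obtain ⟨q, -, hq⟩ := hpath v hv h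
    obtain ⟨y, hp⟩ := isPath_of_mem_cylinder (hC _) hq hv
    rw [hmC ((hC _).mul ⟨v, hp, rfl⟩) (Γ.isPath_invRev hp) (invRev_ne_nil hv),
      ← preimage_flip_cylinder (hC _) hp (isReduced_of_mem_cylinder hq hv) hv,
      ν.flip_invariant _ (measurableSet_cylinder (hC _) hv)]
  have hi : ∀ v, v ≠ [] → m (FreeGroup.invRev v) = m v := by
    intro v hv
    by_cases h : m v = 0
    · by_cases h' : m (FreeGroup.invRev v) = 0
      · rw [h, h']
      · have := hi' _ (invRev_ne_nil hv) h'
        rw [FreeGroup.invRev_invRev] at this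
        exact this.symm
    · exact hi' v hv h
  have key : ∀ v, v ≠ [] → 2 * m v = f.frequency v * ∑ d : E × Bool, m [d] := fun v hv =>
    weight_eq_frequency hm he hne (fun v => ENNReal.toReal_nonneg) hr hl hi
      (fun v hv h => by
        obtain ⟨q, hqL, hq⟩ := hpath v hv h
        exact mem_language_of_mem_cylinder hqL hv hq) hv
  set T := ∑ d : E × Bool, m [d]
  -- The factor is the ratio of the total letter weights: `T` for this current, 2 for the
  -- frequencies.
  refine ⟨(T / 2).toNNReal, ext_of_cylinder (α := α) fun c x v y hc hp _ hv => ?_⟩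
  have hT : 0 ≤ T := Finset.sum_nonneg fun d _ => ENNReal.toReal_nonneg
  rw [Measure.smul_apply, hμ c x v y hc hp hv, ENNReal.smul_def, smul_eq_mul,
    ← ENNReal.ofReal_toReal (hfin hc hv), ← hmC hc hp hv]
  change _ = ENNReal.ofReal (T / 2) * _
  rw [← ENNReal.ofReal_mul (by positivity)]
  congr 1
  linarith [key v hv]

theorem supportedIn_iff (hΓ : Γ.IsConnected) (hμ0 : μ.toMeasure ≠ 0) (p : ProjCurrent N) :
    p.SupportedIn (f.bfhLamination α) ↔ p = ProjCurrent.mk μ hμ0 := by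
  constructor
  · rintro ⟨ν, hν0, rfl, hν⟩
    obtain ⟨r, hr⟩ := exists_toMeasure_eq_smul hm he hne hμ hΓ hν
    refine Quotient.sound ⟨r, ?_, hr⟩
    rw [pos_iff_ne_zero]
    rintro rfl
    rw [zero_smul] at hr
    exact hν0 hr
  · rintro rfl
    exact ⟨μ, hμ0, rfl, support_subset_bfhLamination hm he hne hμ⟩

end GraphMap

theorem proposition4p4 {N : ℕ} (hN : 2 ≤ N) {V E : Type*} [Fintype V] [Fintype E] [DecidableEq E]
    (Γ : EdgeGraph V E) (α : Marking N Γ) (φ : OutAut (FreeGroup (Fin N)))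
    (hφ : φ.IsHyperbolicIwip) (f : GraphMap Γ) (hf : f.IsTrainTrackFor α φ) :
    IsUniquelyErgodic (f.bfhLamination α) ∧
      ∃ μ : GeodesicCurrent N, (∀ ν : GeodesicCurrent N, f.IsStableCurrent α ν ↔ ν = μ) ∧
        ∃ hμ : μ.toMeasure ≠ 0, ∀ p : ProjCurrent N,
          p.SupportedIn (f.bfhLamination α) ↔ p = ProjCurrent.mk μ hμ := by
  have hN' : 1 ≤ N := one_le_two.trans hN
  have := α.nonempty_edges hN'
  have hm := hf.isMixing hN' hφ
  have he := hf.isExpanding hN' hφ.2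
  have hne := f.iter_ne_nil hf.nondegenerate
  obtain ⟨μ, hμ⟩ := GraphMap.exists_current_frequency (α := α) hm he hne hf.connected
    hf.noValenceOne (f.isReduced_iter hf.noBacktracking)
  have hμ0 := GraphMap.toMeasure_ne_zero_of_frequency hm he hne hμ hf.connected
  have hp := GraphMap.supportedIn_iff hm he hne hμ hf.connected hμ0
  exact ⟨⟨ProjCurrent.mk μ hμ0, (hp _).2 rfl, fun p h => (hp p).1 h⟩, μ,
    fun ν => GraphMap.isStableCurrent_iff hm he hne hμ, hμ0, hp⟩
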